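/- Let $p,q\in(1,\infty)$ with $\frac1p+\frac1q=1$. **Setting.** For $s\in(1,\infty)$ let $\pi_s$ be the area of the unit ball $\mathbb{B}_s\subset\mathbb{R}^2$ of the $\ell^s$-norm. For $\theta\in[0,2\pi_s)$ let $(\cos_s\theta,\sin_s\theta)$ be the unique point $P$ of the $\ell^s$-unit circle such that the sector of $\mathbb{B}_s$ swept counterclockwise from the positive $x$-axis to the ray through $P$ has area $\theta/2$; extend $\cos_s,\sin_s$ to $\mathbb{R}$ by $2\pi_s$-periodicity. For $\theta\in\mathbb{R}$, let $\theta^\circ\in[0,2\pi_p)$ be the unique angle with $\cos_q\theta\cos_p\theta^\circ+\sin_q\theta\sin_p\theta^\circ=1$. The Heisenberg group $\mathbb{H}$ is $\mathbb{R}^3$ with the law $(x,y,z)\cdot(x',y',z')=(x+x',\,y+y',\,z+z'+\frac12(xy'-x'y))$, the identity $e=0$, the Lebesgue measure, and the left-invariant fields $X=\partial_x-\frac y2\partial_z$, $Y=\partial_y+\frac x2\partial_z$, $Z=\partial_z$. A curve is horizontal if it is absolutely continuous and $\dot\gamma=u_1X(\gamma)+u_2Y(\gamma)$ almost everywhere;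 its length is $\int(|u_1|^p+|u_2|^p)^{1/p}\,dt$, and $d(g_0,g_1)$ is the infimum of the lengths of horizontal curves joining $g_0$ to $g_1$. A horizontal curve is length minimising if its length equals the distance between its endpoints. A covector $\lambda\in T^*_e\mathbb{H}\cong\mathbb{R}^3$ is written $\lambda=(h_X,h_Y,h_Z)=(r\cos_q\theta,\,r\sin_q\theta,\,w)$ with $r\ge0$, $\theta\in\mathbb{R}$ (modulo $2\pi_q$), $w\in\mathbb{R}$, and is then also denoted $(r,\theta,w)$. Set $\exp_e^t(r,\theta,w)=(x(t),y(t),z(t))$, where, for $w\ne0$, $$x(t)=\tfrac rw\big(\sin_q(wt+\theta)-\sin_q\theta\big),\qquad y(t)=-\tfrac rw\big(\cos_q(wt+\theta)-\cos_q\theta\big),$$ $$z(t)=\tfrac{r^2}{2w^2}\big(wt+\cos_q(wt+\theta)\sin_q\theta-\sin_q(wt+\theta)\cos_q\theta\big),$$ and, for $w=0$, $(x(t),y(t),z(t))=(rt\cos_p\theta^\circ,\,rt\sin_p\theta^\circ,\,0)$. Put $\exp_e=\exp_e^1$. The cut time $t_{\mathrm{cut}}[r,\theta,w]\in[0,\infty]$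 is the supremum of the $T>0$ such that $[0,T]\to\mathbb{H}$, $t\mapsto\exp_e^t(r,\theta,w)$ is length minimising. The cotangent injectivity domain from $e$ is the set of the covectors $\lambda$ such that $[0,1]\to\mathbb{H}$, $t\mapsto\exp_e^t(\lambda)$ is non-constant and is, up to reparametrisation, the unique length minimiser between its endpoints. A space $(M,d,\mathfrak m)$ has negligible cut locus if for every $x\in M$ there are a set $\mathcal C(x)$ with $\mathfrak m(\mathcal C(x))=0$ and a measurable map $\Phi_x:(M\setminus\mathcal C(x))\times[0,1]\to M$ such that, for every $y\in M\setminus\mathcal C(x)$, the curve $t\mapsto\Phi_x(y,t)$ is the unique minimising geodesic from $x$ to $y$, that is, the unique $\gamma:[0,1]\to M$ with $\gamma(0)=x$, $\gamma(1)=y$ and $d(\gamma(s),\gamma(t))=|s-t|\,d(x,y)$ for all $s,t\in[0,1]$. **Proposition.** 1. For all $r>0$ and $\theta,w\in\mathbb{R}$, $\ t_{\mathrm{cut}}[r,\theta,w]=\dfrac{2\pi_q}{|w|}$, where $\frac{2\pi_q}{0}=+\infty$. 2. The cotangent injectivity domain from $e$ is $D=\{(r,\theta,w)\in T_e^*\mathbb{H}\mid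 r>0,\ |w|<2\pi_q\}$. 3. $\exp_e:D\to\exp_e(D)$ is a homeomorphism (for the topologies induced by $T^*_e\mathbb{H}\cong\mathbb{R}^3$ and $\mathbb{H}=\mathbb{R}^3$), and $\mathbb{H}\setminus\exp_e(D)=\{(x,y,z)\mid x=y=0\}$, which is a set of Lebesgue measure zero. 4. The $\ell^p$-Heisenberg group $(\mathbb{H},d,\mathcal L^3)$ has negligible cut locus. -/

import Mathlib

noncomputable section

namespace LpHeisenberg

/-! ### Shelupsky's trigonometric functions -/

/-- The unit ball of the plane for the `ℓ^p`-norm. -/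
def unitBall (p : ℝ) : Set (ℝ × ℝ) := {v | |v.1| ^ p + |v.2| ^ p ≤ 1}

/-- `π_p`, the area of the unit ball of the `ℓ^p`-norm. -/
def pip (p : ℝ) : ℝ := (MeasureTheory.volume (unitBall p)).toReal

/-- The Euclidean polar angle of a vector of the plane, in `[0, 2π)`
(with the value `0` at the origin). -/
def euclAngle (v : ℝ × ℝ) : ℝ :=
  if 0 ≤ Complex.arg ⟨v.1, v.2⟩ then Complex.arg ⟨v.1, v.2⟩
  else Complex.arg ⟨v.1, v.2⟩ + 2 * Real.pi

/-- The sector of the `ℓ^p`-unit ball swept counterclockwise from the positive `x`-axis to the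
half-line from the origin through `v`. -/
def sector (p : ℝ) (v : ℝ × ℝ) : Set (ℝ × ℝ) :=
  {u | u ∈ unitBall p ∧ euclAngle u ≤ euclAngle v}

/-- The `ℓ^p`-angle of `v`: twice the area of its sector. -/
def lpAngle (p : ℝ) (v : ℝ × ℝ) : ℝ := 2 * (MeasureTheory.volume (sector p v)).toReal

/-- The unique point of the `ℓ^p`-unit sphere whose sector has area `θ / 2`, for
`0 ≤ θ < 2 π_p`; extended to all real `θ` by `2 π_p`-periodicity. -/
def trigPoint (p θ : ℝ) : ℝ × ℝ :=
  Classical.epsilon fun P : ℝ × ℝ =>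
    |P.1| ^ p + |P.2| ^ p = 1 ∧ lpAngle p P = 2 * pip p * Int.fract (θ / (2 * pip p))

/-- `cos_p`. -/
def cosp (p θ : ℝ) : ℝ := (trigPoint p θ).1

/-- `sin_p`. -/
def sinp (p θ : ℝ) : ℝ := (trigPoint p θ).2

/-- The dual angle `θ°` of an `ℓ^q`-angle `θ`: the unique `φ ∈ [0, 2 π_p)` for which equality
holds in `cos_q θ cos_p φ + sin_q θ sin_p φ ≤ 1`. -/
def dualAngle (p q θ : ℝ) : ℝ :=
  Classical.epsilon fun φ : ℝ =>
    φ ∈ Set.Ico 0 (2 * pip p) ∧ cosp q θ * cosp p φ + sinp q θ * sinp p φ = 1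

/-! ### The Heisenberg group and its `ℓ^p`-sub-Finsler distance -/

/-- The Heisenberg group in exponential coordinates `(x, y, z)`; the group law is
`(x, y, z) · (x', y', z') = (x + x', y + y', z + z' + (x y' - x' y) / 2)`, the identity is `0`,
and the Haar measure is the Lebesgue measure of `ℝ³`. Tangent vectors are written in the
coordinate frame. -/
abbrev Heis : Type := ℝ × ℝ × ℝ

/-- The left-invariant vector field `X = ∂_x - (y / 2) ∂_z`. -/
def fieldX (g : Heis) : Heis := (1, 0, -(g.2.1 / 2))

/-- The left-invariant vector field `Y = ∂_y + (x / 2) ∂_z`. -/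
def fieldY (g : Heis) : Heis := (0, 1, g.1 / 2)

/-- An absolutely continuous curve on `[a, b]` tangent almost everywhere to the distribution
spanned by `X` and `Y`. -/
def IsHorizontal (γ : ℝ → Heis) (a b : ℝ) : Prop :=
  AbsolutelyContinuousOnInterval γ a b ∧
    ∀ᵐ t ∂(MeasureTheory.volume.restrict (Set.Icc a b)),
      ∃ u₁ u₂ : ℝ, HasDerivAt γ (u₁ • fieldX (γ t) + u₂ • fieldY (γ t)) t

/-- The norm `(|u₁|^p + |u₂|^p)^(1/p)` of a horizontal vector `v = u₁ X + u₂ Y`; the coefficients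
`u₁`, `u₂` are the first two coordinates of `v`. -/
def horNorm (p : ℝ) (v : Heis) : ℝ := (|v.1| ^ p + |v.2.1| ^ p) ^ (1 / p)

/-- The `ℓ^p`-length on `[a, b]` of a horizontal curve. -/
def curveLength (p : ℝ) (γ : ℝ → Heis) (a b : ℝ) : ENNReal :=
  ∫⁻ t in Set.Icc a b, ENNReal.ofReal (horNorm p (deriv γ t))

/-- The distance of the `ℓ^p`-Heisenberg group. -/
def heisDist (p : ℝ) (g₀ g₁ : Heis) : ENNReal :=
  ⨅ γ ∈ {γ : ℝ → Heis | IsHorizontal γ 0 1 ∧ γ 0 = g₀ ∧ γ 1 = g₁}, curveLength p γ 0 1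

/-- `γ` is a horizontal curve on `[a, b]` which is a length minimiser between its endpoints. -/
def IsLengthMinimising (p : ℝ) (γ : ℝ → Heis) (a b : ℝ) : Prop :=
  IsHorizontal γ a b ∧ curveLength p γ a b = heisDist p (γ a) (γ b)

/-! ### The exponential map -/

/-- A covector `λ` at the identity, in the coordinates `(h_X(λ), h_Y(λ), h_Z(λ))`. -/
abbrev Covector : Type := ℝ × ℝ × ℝ

/-- The covector with parameters `(r, θ, w)`, that is, `h_X = r cos_q θ`, `h_Y = r sin_q θ` and
`h_Z = w`. -/
def covector (q r θ w : ℝ) : Covector := (r * cosp q θ, r * sinp q θ, w)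

/-- The curve `t ↦ (x(t), y(t), z(t))` with parameters `(r, θ, w)`. -/
def geodesic (p q r θ w t : ℝ) : Heis :=
  if w = 0 then
    (r * cosp p (dualAngle p q θ) * t, r * sinp p (dualAngle p q θ) * t, 0)
  else
    (r / w * (sinp q (w * t + θ) - sinp q θ),
      -(r / w) * (cosp q (w * t + θ) - cosp q θ),
      r ^ 2 / (2 * w ^ 2) *
        (w * t + cosp q (w * t + θ) * sinp q θ - sinp q (w * t + θ) * cosp q θ))

/-- The exponential map `exp_e^t`: the `ℓ^q`-polar coordinates `(r, θ)` of `(h_X, h_Y)` are its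
`ℓ^q`-norm and its `ℓ^q`-angle. -/
def expMap (p q t : ℝ) (l : Covector) : Heis :=
  geodesic p q ((|l.1| ^ q + |l.2.1| ^ q) ^ (1 / q)) (lpAngle q (l.1, l.2.1)) l.2.2 t

/-- The cut time of the geodesic `t ↦ exp_e^t(λ)`, an element of `[0, ∞]`. -/
def cutTime (p q : ℝ) (l : Covector) : ENNReal :=
  ⨆ T ∈ {T : ℝ | 0 < T ∧ IsLengthMinimising p (fun t => expMap p q t l) 0 T}, ENNReal.ofReal T

/-- The cotangent injectivity domain at the identity: the covectors for which
`[0, 1] → ℍ, t ↦ exp_e^t(λ)` is not constant and is, up to reparametrisation, the unique length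
minimiser between its endpoints. -/
def cotangentInjectivityDomain (p q : ℝ) : Set Covector :=
  {l | (∃ t ∈ Set.Icc (0 : ℝ) 1, expMap p q t l ≠ expMap p q 0 l) ∧
    IsLengthMinimising p (fun t => expMap p q t l) 0 1 ∧
    ∀ η : ℝ → Heis, IsLengthMinimising p η 0 1 →
      η 0 = expMap p q 0 l → η 1 = expMap p q 1 l →
      ∃ φ : ℝ → ℝ, ContinuousOn φ (Set.Icc 0 1) ∧ MonotoneOn φ (Set.Icc 0 1) ∧
        φ 0 = 0 ∧ φ 1 = 1 ∧ ∀ t ∈ Set.Icc (0 : ℝ) 1, η t = expMap p q (φ t) l}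

/-- The set `D` of the covectors with parameters `r > 0` and `|w| < 2 π_q`. -/
def domainD (q : ℝ) : Set Covector :=
  {l | ∃ r θ w : ℝ, 0 < r ∧ |w| < 2 * pip q ∧ l = covector q r θ w}

/-! ### Negligible cut locus -/

/-- `γ : [0, 1] → X` is a (constant speed) minimising geodesic from `x` to `y` for the
distance `d`. -/
def IsMinGeodesic {X : Type*} (d : X → X → ENNReal) (x y : X) (γ : unitInterval → X) : Prop :=
  γ 0 = x ∧ γ 1 = y ∧
    ∀ s t : unitInterval, d (γ s) (γ t) = ENNReal.ofReal |(s : ℝ) - (t : ℝ)| * d x y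

/-- `(X, d, μ)` has negligible cut locus: for every `x` there are a negligible set `C` and a
measurable map `Φ : (X ∖ C) × [0, 1] → X` such that, for every `y ∉ C`, the curve `Φ(y, ·)` is the
unique minimising geodesic from `x` to `y`. -/
def HasNegligibleCutLocus {X : Type*} [MeasurableSpace X] (d : X → X → ENNReal)
    (μ : MeasureTheory.Measure X) : Prop :=
  ∀ x : X, ∃ C : Set X, μ C = 0 ∧
    ∃ Φ : (Cᶜ : Set X) × unitInterval → X, Measurable Φ ∧
      ∀ y : (Cᶜ : Set X),
        IsMinGeodesic d x y (fun t => Φ (y, t)) ∧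
        ∀ γ : unitInterval → X, IsMinGeodesic d x y γ → γ = fun t => Φ (y, t)

end LpHeisenberg

end

open LpHeisenberg

open LpHeisenberg

noncomputable section

namespace LpHeisenberg

open MeasureTheory Set Filter Topology
open scoped NNReal Real

/-! ### Absolutely continuous functions with prescribed derivative -/

/-! The third coordinate of a horizontal curve from the origin is the signed area swept by its
projection to the plane, so minimising length is Dido's problem for the `ℓ^p`-norm. Its solution is
the isoperimetric inequality: a closed plane curve of `ℓ^p`-length `L` encloses area at most `L² /
(4 π_q)`, with equality only for `ℓ^q`-circles. What is used is its equality case,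
`isoperimetric_eq`, proved by Schmidt's comparison with an `ℓ^q`-circle of the same width
(`schmidt_aux`). An absolutely continuous curve on an `ℓ^q`-circle is then parametrised by `cos_q`,
`sin_q` of its arc length divided by the radius (`isoperimetric_param`).

Let `0 < w ≤ 2 π_q`, and let a competitor have the endpoint of the geodesic `(r, θ, w)` and length
at most `r`. Continue it by the rest of the geodesic, up to the time `2 π_q / w` at which the
projected circle closes. The resulting closed curve has the area of the circle of radius `r / w` and
at most its perimeter, so it is such a circle and the competitor has length exactly `r`. If `w < 2
π_q`, the added arc is nontrivial; it fixes the centre and the phase, and the competitor is a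
reparametrised geodesic. Hölder's inequality settles `w = 0` and a reflection settles `w < 0`
(`geodesic_minimal`).

An intermediate value argument shows that every point off the vertical axis is the endpoint of a
geodesic with `|w| < 2 π_q` (`exists_geodesic`). Uniqueness then excludes minimality when `T |w| > 2
π_q`; if the endpoint lies on the axis, one loop is shorter than several loops of the same total
height. This gives the cut time (`isLengthMinimising_geodesic_iff`). At `|w| = 2 π_q` the geodesics
are single loops, and all values of `θ` give the same endpoint, so uniqueness fails.

The inverse of the exponential map is continuous because preimages of convergent sequences are
bounded by homogeneity under dilations, while the boundary of `D` is mapped into the axis. For the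
cut locus, a metric geodesic is Lipschitz for `d`, hence horizontal with controlled speed
(`horCoord_of_lipschitz`), so uniqueness among horizontal curves applies to it; left translations
move the base point. -/

theorem absolutelyContinuousOnInterval_lipschitz_comp {X Y : Type*} [PseudoMetricSpace X]
    [PseudoMetricSpace Y] {f : ℝ → X} {g : X → Y} {K : ℝ≥0} {s : Set X} {a b : ℝ}
    (hf : AbsolutelyContinuousOnInterval f a b) (hg : LipschitzOnWith K g s)
    (hm : MapsTo f (uIcc a b) s) : AbsolutelyContinuousOnInterval (fun t => g (f t)) a b := by
  have h0 : Tendsto (fun E : ℕ × (ℕ → ℝ × ℝ) =>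
      (K : ℝ) * ∑ i ∈ Finset.range E.1, dist (f (E.2 i).1) (f (E.2 i).2))
      (AbsolutelyContinuousOnInterval.totalLengthFilter ⊓
        𝓟 (AbsolutelyContinuousOnInterval.disjWithin a b)) (𝓝 0) := by
    simpa using Tendsto.const_mul (K : ℝ) hf
  refine squeeze_zero' (Eventually.of_forall fun E => ?_) ?_ h0
  · exact Finset.sum_nonneg fun i _ => dist_nonneg
  · filter_upwards [mem_inf_of_right (mem_principal_self _)] with E hE
    rw [Finset.mul_sum]
    refine Finset.sum_le_sum fun i hi => ?_
    exact hg.dist_le_mul _ (hm (hE.1 i hi).1) _ (hm (hE.1 i hi).2)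

theorem absolutelyContinuousOnInterval_prodMk {X Y : Type*} [PseudoMetricSpace X]
    [PseudoMetricSpace Y] {f : ℝ → X} {g : ℝ → Y} {a b : ℝ}
    (hf : AbsolutelyContinuousOnInterval f a b) (hg : AbsolutelyContinuousOnInterval g a b) :
    AbsolutelyContinuousOnInterval (fun t => (f t, g t)) a b := by
  have h0 := Tendsto.add hf hg
  rw [add_zero] at h0
  refine squeeze_zero (fun E => Finset.sum_nonneg fun i _ => dist_nonneg) (fun E => ?_) h0
  rw [← Finset.sum_add_distrib]
  refine Finset.sum_le_sum fun i _ => ?_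
  rw [Prod.dist_eq]
  exact max_le (le_add_of_nonneg_right dist_nonneg) (le_add_of_nonneg_left dist_nonneg)

/-- `f` is absolutely continuous on `[a, b]` with derivative `f'` almost everywhere. -/
def ACD (f f' : ℝ → ℝ) (a b : ℝ) : Prop :=
  AbsolutelyContinuousOnInterval f a b ∧ ∀ᵐ t, t ∈ Icc a b → HasDerivAt f (f' t) t

namespace ACD

variable {f f' g g' : ℝ → ℝ} {a b c : ℝ}

theorem continuousOn (h : ACD f f' a b) : ContinuousOn f (Icc a b) := by
  rcases le_total a b with hab | hab
  · simpa [uIcc_of_le hab] using h.1.continuousOn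
  · rcases hab.eq_or_lt with rfl | hab
    · simp
    · simp [Icc_eq_empty hab.not_ge]

theorem mono (h : ACD f f' a b) {c d : ℝ} (hac : a ≤ c) (hcd : c ≤ d) (hdb : d ≤ b) :
    ACD f f' c d := by
  refine ⟨h.1.mono ?_, ?_⟩
  · rw [uIcc_of_le hcd, uIcc_of_le (hac.trans (hcd.trans hdb))]
    exact Icc_subset_Icc hac hdb
  · filter_upwards [h.2] with t ht h1
    exact ht ⟨hac.trans h1.1, h1.2.trans hdb⟩

theorem ae_uIoc (h : ACD f f' a b) (hab : a ≤ b) :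
    ∀ᵐ t, t ∈ uIoc a b → deriv f t = f' t := by
  filter_upwards [h.2] with t ht h1
  rw [uIoc_of_le hab] at h1
  exact (ht (Ioc_subset_Icc_self h1)).deriv

theorem intervalIntegrable (h : ACD f f' a b) (hab : a ≤ b) :
    IntervalIntegrable f' volume a b :=
  h.1.intervalIntegrable_deriv.congr_ae
    ((ae_restrict_iff' measurableSet_uIoc).2 (h.ae_uIoc hab))

theorem integral_eq (h : ACD f f' a b) (hab : a ≤ b) : ∫ t in a..b, f' t = f b - f a := by
  rw [← h.1.integral_deriv_eq_sub]
  refine intervalIntegral.integral_congr_ae ?_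
  filter_upwards [h.ae_uIoc hab] with t ht h1 using (ht h1).symm

theorem congr_deriv (h : ACD f f' a b) (hg : ∀ᵐ t, t ∈ Icc a b → f' t = g' t) : ACD f g' a b := by
  refine ⟨h.1, ?_⟩
  filter_upwards [h.2, hg] with t h1 h2 h3
  rw [← h2 h3]
  exact h1 h3

theorem const (k a b : ℝ) : ACD (fun _ => k) (fun _ => 0) a b :=
  ⟨(LipschitzWith.const k).lipschitzOnWith.absolutelyContinuousOnInterval,
    Eventually.of_forall fun t _ => hasDerivAt_const t k⟩

theorem add (hf : ACD f f' a b) (hg : ACD g g' a b) :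
    ACD (fun t => f t + g t) (fun t => f' t + g' t) a b := by
  refine ⟨hf.1.add hg.1, ?_⟩
  filter_upwards [hf.2, hg.2] with t h1 h2 h3 using (h1 h3).add (h2 h3)

theorem neg (hf : ACD f f' a b) : ACD (fun t => -f t) (fun t => -f' t) a b := by
  refine ⟨hf.1.neg, ?_⟩
  filter_upwards [hf.2] with t h1 h3 using (h1 h3).neg

theorem sub (hf : ACD f f' a b) (hg : ACD g g' a b) :
    ACD (fun t => f t - g t) (fun t => f' t - g' t) a b := by
  refine ⟨hf.1.sub hg.1, ?_⟩
  filter_upwards [hf.2, hg.2] with t h1 h2 h3 using (h1 h3).sub (h2 h3)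

theorem mul (hf : ACD f f' a b) (hg : ACD g g' a b) :
    ACD (fun t => f t * g t) (fun t => f' t * g t + f t * g' t) a b := by
  refine ⟨hf.1.mul hg.1, ?_⟩
  filter_upwards [hf.2, hg.2] with t h1 h2 h3 using (h1 h3).mul (h2 h3)

theorem const_mul (k : ℝ) (hf : ACD f f' a b) :
    ACD (fun t => k * f t) (fun t => k * f' t) a b := by
  refine ⟨hf.1.const_mul k, ?_⟩
  filter_upwards [hf.2] with t h1 h3 using (h1 h3).const_mul k

theorem sub_const (hf : ACD f f' a b) (k : ℝ) : ACD (fun t => f t - k) f' a b := by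
  have := hf.sub (const k a b)
  simpa using this

/-- Chain rule with an outer function which is continuously differentiable on a segment. -/
theorem comp {c d : ℝ} (hab : a ≤ b) (hf : ACD f f' a b) (hm : MapsTo f (Icc a b) (Icc c d))
    (hg : ∀ x ∈ Icc c d, HasDerivAt g (g' x) x) (hc : ContinuousOn g' (Icc c d)) :
    ACD (fun t => g (f t)) (fun t => g' (f t) * f' t) a b := by
  obtain ⟨C, hC⟩ := isCompact_Icc.exists_bound_of_continuousOn hc
  have hL : LipschitzOnWith C.toNNReal g (Icc c d) := by
    refine (convex_Icc c d).lipschitzOnWith_of_nnnorm_hasDerivWithin_le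
      (fun x hx => (hg x hx).hasDerivWithinAt) fun x hx => ?_
    rw [← NNReal.coe_le_coe]
    exact (hC x hx).trans (Real.le_coe_toNNReal C)
  refine ⟨absolutelyContinuousOnInterval_lipschitz_comp hf.1 hL (by rwa [uIcc_of_le hab]), ?_⟩
  filter_upwards [hf.2] with t h1 h2
  exact (hg _ (hm h2)).comp t (h1 h2)

theorem exists_mapsTo_Icc (hf : ACD f f' a b) : ∃ c d, MapsTo f (Icc a b) (Icc c d) := by
  obtain ⟨C, hC⟩ := isCompact_Icc.exists_bound_of_continuousOn hf.continuousOn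
  exact ⟨-C, C, fun x hx => abs_le.1 (hC x hx)⟩

theorem comp_global (hab : a ≤ b) (hf : ACD f f' a b)
    (hg : ∀ x, HasDerivAt g (g' x) x) (hc : Continuous g') :
    ACD (fun t => g (f t)) (fun t => g' (f t) * f' t) a b := by
  obtain ⟨c, d, hm⟩ := hf.exists_mapsTo_Icc
  exact hf.comp hab hm (fun x _ => hg x) hc.continuousOn

theorem of_hasDerivAt (hg : ∀ x, HasDerivAt g (g' x) x) (hc : Continuous g') (hab : a ≤ b) :
    ACD g g' a b := by
  have h : ACD (fun t => t) (fun _ => 1) a b :=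
    ⟨LipschitzWith.id.lipschitzOnWith.absolutelyContinuousOnInterval,
      Eventually.of_forall fun t _ => hasDerivAt_id t⟩
  simpa using h.comp_global hab hg hc

theorem of_integral (hf : IntervalIntegrable f' volume a b) (hab : a ≤ b) (k : ℝ) :
    ACD (fun t => k + ∫ s in a..t, f' s) f' a b := by
  have h1 : ACD (fun t => ∫ s in a..t, f' s) f' a b := by
    refine ⟨hf.absolutelyContinuousOnInterval_intervalIntegral (by simp), ?_⟩
    filter_upwards [hf.ae_hasDerivAt_integral] with t h1 h2
    rw [uIcc_of_le hab] at h1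
    exact h1 h2 a ⟨le_rfl, hab⟩
  simpa using (const k a b).add h1

theorem eq_add_integral (h : ACD f f' a b) {t : ℝ} (ht : t ∈ Icc a b) :
    f t = f a + ∫ s in a..t, f' s := by
  rw [(h.mono le_rfl ht.1 ht.2).integral_eq ht.1]; ring

theorem eqOn_of_deriv_eq (hf : ACD f f' a b) (hg : ACD g f' a b) (h0 : f a = g a) :
    EqOn f g (Icc a b) := fun t ht => by
  rw [hf.eq_add_integral ht, hg.eq_add_integral ht, h0]

/-- Equality on the closed interval says nothing about two-sided derivatives at `a` and `b`, but
these two points are negligible. -/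
theorem congr (hf : ACD f f' a b) (hab : a ≤ b) (h : EqOn f g (Icc a b)) : ACD g f' a b := by
  have hu : EqOn f g (uIcc a b) := by rwa [uIcc_of_le hab]
  refine ⟨?_, ?_⟩
  · refine Tendsto.congr' ?_ hf.1
    filter_upwards [mem_inf_of_right (mem_principal_self _)] with E hE
    refine Finset.sum_congr rfl fun i hi => ?_
    rw [hu (hE.1 i hi).1, hu (hE.1 i hi).2]
  · have h1 : ∀ᵐ t : ℝ, t ≠ a := by simp [ae_iff, measure_singleton]
    have h2 : ∀ᵐ t : ℝ, t ≠ b := by simp [ae_iff, measure_singleton]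
    filter_upwards [hf.2, h1, h2] with t h3 h4 h5 h6
    refine (h3 h6).congr_of_eventuallyEq ?_
    filter_upwards [Icc_mem_nhds (lt_of_le_of_ne h6.1 h4.symm) (lt_of_le_of_ne h6.2 h5)] with s hs
    exact (h hs).symm

/-- Concatenation of absolutely continuous functions. -/
theorem concat (hab : a ≤ b) (hbc : b ≤ c) (hf : ACD f f' a b) (hg : ACD g g' b c)
    (h : f b = g b) :
    ACD (fun t => if t ≤ b then f t else g t) (fun t => if t ≤ b then f' t else g' t) a c := by
  set k' : ℝ → ℝ := fun t => if t ≤ b then f' t else g' t with hk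
  have e1 : ∀ x ∈ Icc a b, ∫ s in a..x, k' s = ∫ s in a..x, f' s := by
    intro x hx
    refine intervalIntegral.integral_congr_ae (Eventually.of_forall fun s hs => ?_)
    rw [uIoc_of_le hx.1] at hs
    simp [hk, hs.2.trans hx.2]
  have e2 : ∀ x ∈ Icc b c, ∫ s in b..x, k' s = ∫ s in b..x, g' s := by
    intro x hx
    refine intervalIntegral.integral_congr_ae (Eventually.of_forall fun s hs => ?_)
    rw [uIoc_of_le hx.1] at hs
    simp [hk, not_le.2 hs.1]
  have i1 : IntervalIntegrable k' volume a b := by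
    refine (hf.intervalIntegrable hab).congr_ae ((ae_restrict_iff' measurableSet_uIoc).2
      (Eventually.of_forall fun s hs => ?_))
    rw [uIoc_of_le hab] at hs
    simp [hk, hs.2]
  have i2 : IntervalIntegrable k' volume b c := by
    refine (hg.intervalIntegrable hbc).congr_ae ((ae_restrict_iff' measurableSet_uIoc).2
      (Eventually.of_forall fun s hs => ?_))
    rw [uIoc_of_le hbc] at hs
    simp [hk, not_le.2 hs.1]
  -- The glued function is recognised as the primitive of the glued derivative, which gives absolute
  -- continuity and the derivative almost everywhere together.
  refine (of_integral (i1.trans i2) (hab.trans hbc) (f a)).congr (hab.trans hbc) fun t ht => ?_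
  rcases le_or_gt t b with htb | htb
  · simp only [htb, if_true]
    rw [e1 t ⟨ht.1, htb⟩, hf.eq_add_integral ⟨ht.1, htb⟩]
  · simp only [not_le.2 htb, if_false]
    rw [← intervalIntegral.integral_add_adjacent_intervals i1
      (i2.mono_set (by rw [uIcc_of_le hbc, uIcc_of_le htb.le]; exact Icc_subset_Icc_right ht.2)),
      e1 b ⟨hab, le_rfl⟩, e2 t ⟨htb.le, ht.2⟩, hf.integral_eq hab,
      (hg.mono le_rfl htb.le ht.2).integral_eq htb.le, h]
    ring

end ACD

/-! ### The duality map of the real line -/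

/-- The odd power `x ↦ |x|^(q-2) x`, the derivative of `|x|^q / q`. -/
def phi (q x : ℝ) : ℝ := |x| ^ (q - 2) * x

variable {p q : ℝ}

@[simp] theorem phi_zero (q : ℝ) : phi q 0 = 0 := by simp [phi]

@[simp] theorem phi_neg (q x : ℝ) : phi q (-x) = -phi q x := by simp [phi]

theorem phi_mul_self (hq : 1 < q) (x : ℝ) : phi q x * x = |x| ^ q := by
  rcases eq_or_ne x 0 with rfl | hx
  · simp [Real.zero_rpow (by linarith : q ≠ 0)]
  · have h : 0 < |x| := abs_pos.2 hx
    rw [phi, mul_assoc, ← sq, ← sq_abs, ← Real.rpow_natCast, ← Real.rpow_add h]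
    norm_num

theorem abs_phi (hq : 1 < q) (x : ℝ) : |phi q x| = |x| ^ (q - 1) := by
  rcases eq_or_ne x 0 with rfl | hx
  · simp [Real.zero_rpow (by linarith : q - 1 ≠ 0)]
  · have h : 0 < |x| := abs_pos.2 hx
    rw [phi, abs_mul, abs_of_nonneg (Real.rpow_nonneg h.le _)]
    nth_rewrite 2 [← Real.rpow_one |x|]
    rw [← Real.rpow_add h]
    norm_num [show q - 2 + 1 = q - 1 by ring]

/-- For `q < 2` the factor `|x| ^ (q - 2)` is unbounded near `0`, so continuity there comes from the
absolute value `|x| ^ (q - 1)` of the product. -/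
theorem continuous_phi (hq : 1 < q) : Continuous (phi q) := by
  rw [continuous_iff_continuousAt]
  intro x
  rcases eq_or_ne x 0 with rfl | hx
  · rw [ContinuousAt, phi_zero]
    refine squeeze_zero_norm (a := fun x => |x| ^ (q - 1))
      (fun x => by rw [Real.norm_eq_abs, abs_phi hq]) ?_
    have : Continuous fun x : ℝ => |x| ^ (q - 1) :=
      continuous_abs.rpow_const fun _ => Or.inr (by linarith)
    simpa [Real.zero_rpow (by linarith : q - 1 ≠ 0)] using this.tendsto 0
  · exact (continuousAt_id.abs.rpow_const (Or.inl (abs_ne_zero.2 hx))).mul continuousAt_id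

theorem phi_strictMono (hq : 1 < q) : StrictMono (phi q) := by
  refine strictMono_of_odd_strictMonoOn_nonneg (phi_neg q) fun x hx y hy hxy => ?_
  have h := fun z (hz : (0 : ℝ) ≤ z) => show phi q z = z ^ (q - 1) by
    have h0 : 0 ≤ phi q z := mul_nonneg (Real.rpow_nonneg (abs_nonneg _) _) hz
    rw [← abs_of_nonneg h0, abs_phi hq, abs_of_nonneg hz]
  rw [h x hx, h y hy]
  exact Real.rpow_lt_rpow hx hxy (by linarith)

theorem phi_smul (hq : 1 < q) {k : ℝ} (hk : 0 ≤ k) (x : ℝ) :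
    phi q (k * x) = k ^ (q - 1) * phi q x := by
  rcases hk.eq_or_lt with rfl | hk
  · simp [Real.zero_rpow (by linarith : q - 1 ≠ 0)]
  · rw [phi, abs_mul, abs_of_pos hk, Real.mul_rpow hk.le (abs_nonneg x), phi,
      show q - 1 = (q - 2) + 1 by ring, Real.rpow_add_one hk.ne']
    ring

theorem hasDerivAt_abs_rpow_phi (hq : 1 < q) (x : ℝ) :
    HasDerivAt (fun x : ℝ => |x| ^ q) (q * phi q x) x := by
  have := hasDerivAt_abs_rpow x hq
  rwa [mul_assoc] at this

theorem one_lt_of_conj (hp : 1 < p) (hpq : 1 / p + 1 / q = 1) : 1 < q := by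
  have h1 : 1 / q = 1 - 1 / p := by linarith
  have h2 : 1 / p < 1 := by rw [div_lt_one (by linarith)]; exact hp
  have h3 : 0 < 1 / p := by positivity
  have hq : 0 < q := by
    have : 0 < 1 / q := by linarith
    exact one_div_pos.1 this
  have h4 : 1 / q < 1 := by linarith
  rwa [div_lt_one hq] at h4

theorem conj_mul (hp : 1 < p) (hpq : 1 / p + 1 / q = 1) : p + q = p * q := by
  have hq := one_lt_of_conj hp hpq
  field_simp at hpq
  linarith

/-- Conjugate exponents satisfy `(p - 1) (q - 1) = 1`, so these two odd powers are inverse to each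
other. Coordinatewise they form the duality map between the `ℓ^q`- and `ℓ^p`-unit spheres. -/
theorem phi_phi (hp : 1 < p) (hpq : 1 / p + 1 / q = 1) (x : ℝ) : phi p (phi q x) = x := by
  have hq := one_lt_of_conj hp hpq
  have hm := conj_mul hp hpq
  rcases eq_or_ne x 0 with rfl | hx
  · simp
  · have h : 0 < |x| := abs_pos.2 hx
    rw [phi, abs_phi hq, ← Real.rpow_mul h.le, phi, ← mul_assoc, ← Real.rpow_add h,
      show (q - 1) * (p - 2) + (q - 2) = 0 by linarith, Real.rpow_zero, one_mul]

theorem abs_phi_rpow (hp : 1 < p) (hpq : 1 / p + 1 / q = 1) (x : ℝ) :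
    |phi q x| ^ p = |x| ^ q := by
  have hm := conj_mul hp hpq
  rw [abs_phi (one_lt_of_conj hp hpq), ← Real.rpow_mul (abs_nonneg x),
    show (q - 1) * p = q by linarith]

/-! ### The radial function of the unit ball and the swept area -/

/-- The sum `|cos α|^q + |sin α|^q`. -/
def cosSinPow (q α : ℝ) : ℝ := |Real.cos α| ^ q + |Real.sin α| ^ q

/-- The Euclidean norm of the point of the `ℓ^q`-unit sphere with Euclidean angle `α`. -/
def rad (q α : ℝ) : ℝ := cosSinPow q α ^ (-(1 / q))

/-- Twice the area of the sector of the unit ball with Euclidean angles in `[0, α]`. -/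
def sweep (q α : ℝ) : ℝ := ∫ t in (0 : ℝ)..α, rad q t ^ 2

theorem cosSinPow_pos (q α : ℝ) : 0 < cosSinPow q α := by
  have h1 := Real.rpow_nonneg (abs_nonneg (Real.cos α)) q
  have h2 := Real.rpow_nonneg (abs_nonneg (Real.sin α)) q
  rcases eq_or_ne (Real.cos α) 0 with h | h
  · have h3 : Real.sin α ≠ 0 := by
      intro h3
      have := Real.sin_sq_add_cos_sq α
      rw [h, h3] at this; norm_num at this
    have := Real.rpow_pos_of_pos (abs_pos.2 h3) q
    unfold cosSinPow; linarith
  · have := Real.rpow_pos_of_pos (abs_pos.2 h) q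
    unfold cosSinPow; linarith

theorem cosSinPow_le_two (hq : 1 < q) (α : ℝ) : cosSinPow q α ≤ 2 := by
  have h1 := Real.rpow_le_one (abs_nonneg _) (Real.abs_cos_le_one α) (by linarith : 0 ≤ q)
  have h2 := Real.rpow_le_one (abs_nonneg _) (Real.abs_sin_le_one α) (by linarith : 0 ≤ q)
  unfold cosSinPow; linarith

theorem rad_pos (q α : ℝ) : 0 < rad q α := Real.rpow_pos_of_pos (cosSinPow_pos q α) _

theorem rad_rpow (hq : 1 < q) (α : ℝ) : rad q α ^ q * cosSinPow q α = 1 := by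
  have h := cosSinPow_pos q α
  rw [rad, ← Real.rpow_mul h.le, show -(1 / q) * q = -1 by field_simp, Real.rpow_neg_one,
    inv_mul_cancel₀ h.ne']

theorem hasDerivAt_cosSinPow (hq : 1 < q) (α : ℝ) : HasDerivAt (cosSinPow q)
    (q * (phi q (Real.sin α) * Real.cos α - phi q (Real.cos α) * Real.sin α)) α := by
  have h1 := (hasDerivAt_abs_rpow_phi hq (Real.cos α)).comp α (Real.hasDerivAt_cos α)
  have h2 := (hasDerivAt_abs_rpow_phi hq (Real.sin α)).comp α (Real.hasDerivAt_sin α)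
  exact (h1.add h2).congr_deriv (by ring)

theorem hasDerivAt_rad (hq : 1 < q) (α : ℝ) : HasDerivAt (rad q)
    (rad q α ^ (q + 1) * (phi q (Real.cos α) * Real.sin α - phi q (Real.sin α) * Real.cos α))
    α := by
  have h := cosSinPow_pos q α
  refine ((hasDerivAt_cosSinPow hq α).rpow_const (p := -(1 / q)) (Or.inl h.ne')).congr_deriv ?_
  rw [rad, ← Real.rpow_mul h.le,
    show -(1 / q) * (q + 1) = -(1 / q) - 1 by field_simp; ring]
  field_simp
  ring

theorem continuous_rad (hq : 1 < q) : Continuous (rad q) :=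
  continuous_iff_continuousAt.2 fun α => (hasDerivAt_rad hq α).continuousAt

theorem rad_add_pi (q α : ℝ) : rad q (α + π) = rad q α := by
  simp [rad, cosSinPow]

theorem rad_neg (q α : ℝ) : rad q (-α) = rad q α := by
  simp [rad, cosSinPow]

theorem hasDerivAt_sweep (hq : 1 < q) (α : ℝ) : HasDerivAt (sweep q) (rad q α ^ 2) α :=
  ((continuous_rad hq).pow 2).integral_hasStrictDerivAt 0 α |>.hasDerivAt

@[simp] theorem sweep_zero (q : ℝ) : sweep q 0 = 0 := by simp [sweep]

theorem continuous_sweep (hq : 1 < q) : Continuous (sweep q) :=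
  continuous_iff_continuousAt.2 fun α => (hasDerivAt_sweep hq α).continuousAt

theorem intervalIntegrable_rad_sq (hq : 1 < q) (a b : ℝ) :
    IntervalIntegrable (fun t => rad q t ^ 2) volume a b :=
  ((continuous_rad hq).pow 2).intervalIntegrable a b

theorem sweep_sub (hq : 1 < q) (a b : ℝ) : sweep q b - sweep q a = ∫ t in a..b, rad q t ^ 2 :=
  intervalIntegral.integral_interval_sub_left (intervalIntegrable_rad_sq hq _ _)
    (intervalIntegrable_rad_sq hq _ _)

theorem sweep_add_pi (hq : 1 < q) (α : ℝ) : sweep q (α + π) = sweep q α + sweep q π := by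
  have h1 := sweep_sub hq π (α + π)
  have h2 : ∫ t in π..(α + π), rad q t ^ 2 = sweep q α := by
    have := intervalIntegral.integral_comp_add_right (a := 0) (b := α) (fun t => rad q t ^ 2) π
    simp only [rad_add_pi, zero_add] at this
    exact this.symm
  linarith

theorem sweep_neg (q α : ℝ) : sweep q (-α) = -sweep q α := by
  have := intervalIntegral.integral_comp_neg (a := 0) (b := α) (fun t => rad q t ^ 2)
  simp only [rad_neg, neg_zero] at this
  rw [sweep, intervalIntegral.integral_symm, ← this, sweep]

theorem sweep_strictMono (hq : 1 < q) : StrictMono (sweep q) :=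
  strictMono_of_deriv_pos fun α => by
    rw [(hasDerivAt_sweep hq α).deriv]; exact pow_pos (rad_pos q α) 2

/-- The sum `cosSinPow` is at most `2`, so `rad` is bounded below by `2 ^ (-(1 / q))` and `sweep`
grows at least linearly; oddness handles `-∞`. Every `ℓ^q`-angle can thus be replaced by a Euclidean
angle. -/
theorem sweep_surjective (hq : 1 < q) : Function.Surjective (sweep q) := by
  have h1 : ∀ α : ℝ, 0 ≤ α → ((2 : ℝ) ^ (-(1 / q))) ^ 2 * α ≤ sweep q α := by
    intro α hα
    have h2 : ∫ _ in (0 : ℝ)..α, ((2 : ℝ) ^ (-(1 / q))) ^ 2 ≤ sweep q α := by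
      refine intervalIntegral.integral_mono_on hα (by simp) (intervalIntegrable_rad_sq hq _ _)
        fun t _ => ?_
      have h3 : (2 : ℝ) ^ (-(1 / q)) ≤ rad q t :=
        Real.rpow_le_rpow_of_nonpos (cosSinPow_pos q t) (cosSinPow_le_two hq t)
          (by have : 0 < 1 / q := by positivity
              linarith)
      have h4 : (0 : ℝ) ≤ (2 : ℝ) ^ (-(1 / q)) := by positivity
      gcongr
    simpa [mul_comm] using h2
  have h3 : Tendsto (sweep q) atTop atTop := by
    refine tendsto_atTop_mono' _ ?_ (tendsto_id.const_mul_atTop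
      (by positivity : (0 : ℝ) < ((2 : ℝ) ^ (-(1 / q))) ^ 2))
    filter_upwards [eventually_ge_atTop 0] with α hα using h1 α hα
  refine (continuous_sweep hq).surjective h3 ?_
  have h4 := tendsto_neg_atTop_atBot.comp (h3.comp tendsto_neg_atBot_atTop)
  refine h4.congr fun α => ?_
  simp [sweep_neg]

/-! ### Areas of sectors -/

theorem euclAngle_polar {s α : ℝ} (hs : 0 < s) (h0 : 0 ≤ α) (h1 : α < 2 * π) :
    euclAngle (s * Real.cos α, s * Real.sin α) = α := by
  have e : ∀ β : ℝ, (⟨s * Real.cos β, s * Real.sin β⟩ : ℂ) =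
      (s : ℂ) * (Complex.cos β + Complex.sin β * Complex.I) := by
    intro β
    apply Complex.ext <;>
      simp [Complex.cos_ofReal_re, Complex.sin_ofReal_re, Complex.cos_ofReal_im,
        Complex.sin_ofReal_im]
  unfold euclAngle
  rcases le_or_gt α π with h | h
  · have : Complex.arg ⟨s * Real.cos α, s * Real.sin α⟩ = α := by
      rw [e]
      exact Complex.arg_mul_cos_add_sin_mul_I hs ⟨by linarith [Real.pi_pos], h⟩
    simp [this, h0]
  · have : Complex.arg ⟨s * Real.cos α, s * Real.sin α⟩ = α - 2 * π := by
      rw [← Real.cos_sub_two_pi α, ← Real.sin_sub_two_pi α, e]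
      exact Complex.arg_mul_cos_add_sin_mul_I hs ⟨by linarith, by linarith [Real.pi_pos]⟩
    simp only [this]
    rw [if_neg (by linarith)]
    ring

theorem euclAngle_mem (v : ℝ × ℝ) : euclAngle v ∈ Ico 0 (2 * π) := by
  unfold euclAngle
  have h1 := Complex.neg_pi_lt_arg ⟨v.1, v.2⟩
  have h2 := Complex.arg_le_pi ⟨v.1, v.2⟩
  have h3 := Real.pi_pos
  split_ifs with h
  · exact ⟨h, by linarith⟩
  · exact ⟨by linarith, by linarith⟩

theorem exists_polar {v : ℝ × ℝ} (hv : v ≠ 0) :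
    ∃ s : ℝ, 0 < s ∧ v = (s * Real.cos (euclAngle v), s * Real.sin (euclAngle v)) := by
  have hz : (⟨v.1, v.2⟩ : ℂ) ≠ 0 := by
    intro h
    apply hv
    have h1 := congrArg Complex.re h
    have h2 := congrArg Complex.im h
    exact Prod.ext h1 h2
  refine ⟨‖(⟨v.1, v.2⟩ : ℂ)‖, norm_pos_iff.2 hz, ?_⟩
  have hc : Real.cos (euclAngle v) = Real.cos (Complex.arg ⟨v.1, v.2⟩) := by
    unfold euclAngle; split_ifs <;> simp
  have hs : Real.sin (euclAngle v) = Real.sin (Complex.arg ⟨v.1, v.2⟩) := by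
    unfold euclAngle; split_ifs <;> simp
  rw [hc, hs, Complex.norm_mul_cos_arg, Complex.norm_mul_sin_arg]

theorem measurable_euclAngle : Measurable euclAngle := by
  have h : Measurable fun v : ℝ × ℝ => Complex.arg ⟨v.1, v.2⟩ :=
    Complex.measurable_arg.comp Complex.measurableEquivRealProd.symm.measurable
  exact Measurable.ite (measurableSet_le measurable_const h) h (h.add_const _)

theorem measurableSet_unitBall (q : ℝ) : MeasurableSet (unitBall q) := by
  have : Measurable fun v : ℝ × ℝ => |v.1| ^ q + |v.2| ^ q :=
    (measurable_fst.abs.pow_const q).add (measurable_snd.abs.pow_const q)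
  exact measurableSet_le this measurable_const

theorem polar_mem_unitBall (hq : 1 < q) {r : ℝ} (hr : 0 < r) (α : ℝ) :
    (r * Real.cos α, r * Real.sin α) ∈ unitBall q ↔ r ≤ rad q α := by
  have h1 : |r * Real.cos α| ^ q + |r * Real.sin α| ^ q = r ^ q * cosSinPow q α := by
    rw [abs_mul, abs_mul, abs_of_pos hr, Real.mul_rpow hr.le (abs_nonneg _),
      Real.mul_rpow hr.le (abs_nonneg _), cosSinPow]
    ring
  have h2 := rad_rpow hq α
  have h3 := cosSinPow_pos q α
  show |r * Real.cos α| ^ q + |r * Real.sin α| ^ q ≤ 1 ↔ _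
  rw [h1, ← h2, mul_le_mul_iff_left₀ h3, Real.rpow_le_rpow_iff hr.le (rad_pos q α).le (by linarith)]

/-- The representative in `[0, 2π)` of an angle in `(-π, π)`. -/
def posAngle (t : ℝ) : ℝ := if 0 ≤ t then t else t + 2 * π

theorem euclAngle_polar_posAngle {r t : ℝ} (hr : 0 < r) (ht : t ∈ Ioo (-π) π) :
    euclAngle (r * Real.cos t, r * Real.sin t) = posAngle t := by
  unfold posAngle
  split_ifs with h
  · exact euclAngle_polar hr h (by linarith [ht.2, Real.pi_pos])
  · rw [← Real.cos_add_two_pi t, ← Real.sin_add_two_pi t]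
    exact euclAngle_polar hr (by linarith [ht.1, Real.pi_pos]) (by linarith)

theorem measurable_posAngle : Measurable posAngle :=
  Measurable.ite measurableSet_Ici measurable_id (measurable_id.add_const _)

theorem lintegral_rad_sq (hq : 1 < q) {a b : ℝ} (hab : a ≤ b) :
    ∫⁻ t in Ioc a b, ENNReal.ofReal (rad q t ^ 2 / 2) =
      ENNReal.ofReal ((sweep q b - sweep q a) / 2) := by
  rw [sweep_sub hq, ← intervalIntegral.integral_div, intervalIntegral.integral_of_le hab,
    ofReal_integral_eq_lintegral_ofReal]
  · exact ((intervalIntegrable_rad_sq hq a b).div_const 2).1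
  · exact Eventually.of_forall fun t => by positivity

/-- Mathlib's polar coordinates use angles in `(-π, π)`, whereas sectors are measured from angle `0`
up to `2π`. For `α > π` the sector therefore corresponds to two intervals, and the periodicity of
`rad` joins their contributions. -/
theorem lintegral_posAngle (hq : 1 < q) {α : ℝ} (h0 : 0 ≤ α) (h1 : α ≤ 2 * π) :
    ∫⁻ t in Ioo (-π) π, {t | posAngle t ≤ α}.indicator
      (fun t => ENNReal.ofReal (rad q t ^ 2 / 2)) t = ENNReal.ofReal (sweep q α / 2) := by
  have hpi := Real.pi_pos
  have hper : ∀ t, sweep q (t + 2 * π) = sweep q t + 2 * sweep q π := by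
    intro t
    rw [show t + 2 * π = t + π + π by ring, sweep_add_pi hq, sweep_add_pi hq]; ring
  rw [lintegral_indicator (measurableSet_le measurable_posAngle measurable_const),
    Measure.restrict_restrict (measurableSet_le measurable_posAngle measurable_const)]
  rcases le_or_gt α π with h | h
  · have hs : ({t | posAngle t ≤ α} ∩ Ioo (-π) π : Set ℝ) =ᵐ[volume] Ioc 0 α := by
      have n1 : ∀ᵐ t : ℝ, t ≠ 0 := by simp [ae_iff, measure_singleton]
      have n2 : ∀ᵐ t : ℝ, t ≠ π := by simp [ae_iff, measure_singleton]
      filter_upwards [n1, n2] with t ht1 ht2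
      refine propext ⟨fun ⟨ha, hb⟩ => ?_, fun ⟨ha, hb⟩ => ⟨?_, by linarith, ?_⟩⟩
      · have ha : posAngle t ≤ α := ha
        unfold posAngle at ha
        split_ifs at ha with hc
        · exact ⟨lt_of_le_of_ne hc ht1.symm, ha⟩
        · linarith [hb.1]
      · show posAngle t ≤ α
        rw [posAngle, if_pos ha.le]; exact hb
      · exact lt_of_le_of_ne (hb.trans h) ht2
    rw [setLIntegral_congr hs, lintegral_rad_sq hq h0, sweep_zero, sub_zero]
  · have hs : ({t | posAngle t ≤ α} ∩ Ioo (-π) π : Set ℝ) =ᵐ[volume]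
        (Ioc (-π) (α - 2 * π) ∪ Ioc 0 π : Set ℝ) := by
      have n1 : ∀ᵐ t : ℝ, t ≠ 0 := by simp [ae_iff, measure_singleton]
      have n2 : ∀ᵐ t : ℝ, t ≠ π := by simp [ae_iff, measure_singleton]
      filter_upwards [n1, n2] with t ht1 ht2
      refine propext ⟨fun ⟨ha, hb⟩ => ?_, fun hh => ?_⟩
      · have ha : posAngle t ≤ α := ha
        unfold posAngle at ha
        split_ifs at ha with hc
        · exact Or.inr ⟨lt_of_le_of_ne hc ht1.symm, hb.2.le⟩
        · exact Or.inl ⟨hb.1, by linarith⟩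
      · rcases hh with ⟨ha, hb⟩ | ⟨ha, hb⟩
        · have hlt : t < 0 := lt_of_le_of_ne (by linarith) ht1
          refine ⟨?_, ha, by linarith⟩
          show posAngle t ≤ α
          rw [posAngle, if_neg (by linarith)]; linarith
        · refine ⟨?_, by linarith, lt_of_le_of_ne hb ht2⟩
          show posAngle t ≤ α
          rw [posAngle, if_pos ha.le]; linarith
    rw [setLIntegral_congr hs, lintegral_union measurableSet_Ioc, lintegral_rad_sq hq hpi.le,
      lintegral_rad_sq hq (by linarith), sweep_zero, sub_zero, ← ENNReal.ofReal_add]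
    · congr 1
      have := hper (α - 2 * π)
      rw [sub_add_cancel] at this
      rw [sweep_neg, this]; ring
    · have := (sweep_strictMono hq).monotone (show -π ≤ α - 2 * π by linarith)
      linarith
    · have := (sweep_strictMono hq).monotone hpi.le
      rw [sweep_zero] at this
      linarith
    · exact Set.disjoint_left.2 fun t ht1 ht2 => by
        have := ht1.2; have := ht2.1; linarith

/-- In polar coordinates the unit ball is `r ≤ rad q t`, and integrating `r dr` leaves `rad² / 2`.
This ties the measure-theoretic definitions of `pip` and `lpAngle` to the smooth function `sweep`.
-/
theorem volume_sector_le (hq : 1 < q) {α : ℝ} (h0 : 0 ≤ α) (h1 : α ≤ 2 * π) :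
    volume {u : ℝ × ℝ | u ∈ unitBall q ∧ euclAngle u ≤ α} = ENNReal.ofReal (sweep q α / 2) := by
  set S : Set (ℝ × ℝ) := {u : ℝ × ℝ | u ∈ unitBall q ∧ euclAngle u ≤ α} with hS
  have hSm : MeasurableSet S :=
    (measurableSet_unitBall q).inter (measurableSet_le measurable_euclAngle measurable_const)
  rw [← lintegral_posAngle hq h0 h1, ← lintegral_indicator_one hSm,
    ← lintegral_comp_polarCoord_symm, polarCoord_target]
  change ∫⁻ z in Ioi (0 : ℝ) ×ˢ Ioo (-π) π, _ ∂((volume : Measure ℝ).prod volume) = _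
  rw [← Measure.prod_restrict, lintegral_prod_symm]
  · refine setLIntegral_congr_fun measurableSet_Ioo fun t ht => ?_
    have e1 : ∀ r ∈ Ioi (0 : ℝ), ENNReal.ofReal r • S.indicator (1 : ℝ × ℝ → ENNReal)
        (polarCoord.symm (r, t)) = {t | posAngle t ≤ α}.indicator
          (fun _ => (Iic (rad q t)).indicator (fun r => ENNReal.ofReal r) r) t := by
      intro r hr
      have hr : 0 < r := hr
      have hmem : polarCoord.symm (r, t) ∈ S ↔ r ≤ rad q t ∧ posAngle t ≤ α := by
        rw [polarCoord_symm_apply, hS, mem_ofPred_eq, polar_mem_unitBall hq hr,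
          euclAngle_polar_posAngle hr ht]
      by_cases ha : posAngle t ≤ α <;> by_cases hb : r ≤ rad q t <;>
        simp [indicator, hmem, ha, hb, -polarCoord_symm_apply]
    rw [setLIntegral_congr_fun measurableSet_Ioi e1]
    by_cases ha : posAngle t ≤ α
    · simp only [indicator, mem_ofPred_eq, ha, if_true]
      change ∫⁻ r in Ioi (0 : ℝ), (Iic (rad q t)).indicator (fun r => ENNReal.ofReal r) r = _
      rw [lintegral_indicator measurableSet_Iic, Measure.restrict_restrict measurableSet_Iic,
        inter_comm, Ioi_inter_Iic, ← ofReal_integral_eq_lintegral_ofReal,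
        ← intervalIntegral.integral_of_le (rad_pos q t).le]
      · simp
      · exact (continuous_id.intervalIntegrable 0 (rad q t)).1
      · exact (ae_restrict_iff' measurableSet_Ioc).2 (Eventually.of_forall fun r hr => hr.1.le)
    · simp [indicator, ha]
  · refine Measurable.aemeasurable ?_
    exact (ENNReal.measurable_ofReal.comp measurable_fst).mul
      ((measurable_one.indicator hSm).comp continuous_polarCoord_symm.measurable)

theorem pip_eq_sweep (hq : 1 < q) : pip q = sweep q π := by
  have h := volume_sector_le hq (show (0 : ℝ) ≤ 2 * π by positivity) le_rfl
  have hs : {u : ℝ × ℝ | u ∈ unitBall q ∧ euclAngle u ≤ 2 * π} = unitBall q := by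
    ext u
    exact ⟨fun h => h.1, fun h => ⟨h, (euclAngle_mem u).2.le⟩⟩
  have h2 : sweep q (2 * π) = 2 * sweep q π := by
    rw [two_mul, sweep_add_pi hq]; ring
  have h3 : 0 ≤ sweep q π := by
    have := (sweep_strictMono hq).monotone Real.pi_pos.le
    rwa [sweep_zero] at this
  rw [hs, h2] at h
  rw [pip, h, ENNReal.toReal_ofReal (by linarith)]
  ring

theorem pip_pos (hq : 1 < q) : 0 < pip q := by
  have := sweep_strictMono hq Real.pi_pos
  rw [pip_eq_sweep hq]
  rwa [sweep_zero] at this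

theorem lpAngle_eq_sweep (hq : 1 < q) (v : ℝ × ℝ) : lpAngle q v = sweep q (euclAngle v) := by
  have hm := euclAngle_mem v
  have h0 := (sweep_strictMono hq).monotone hm.1
  rw [sweep_zero] at h0
  unfold lpAngle sector
  rw [volume_sector_le hq hm.1 hm.2.le, ENNReal.toReal_ofReal (by linarith)]
  ring

/-! ### The generalised trigonometric functions -/

theorem sweep_add_two_pi_mul (hq : 1 < q) (α : ℝ) (k : ℤ) :
    sweep q (α + k * (2 * π)) = sweep q α + k * (2 * pip q) := by
  have h1 : ∀ β, sweep q (β + 2 * π) = sweep q β + 2 * pip q := fun β => by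
    rw [two_mul, ← add_assoc, sweep_add_pi hq, sweep_add_pi hq, pip_eq_sweep hq]; ring
  induction k using Int.induction_on with
  | zero => simp
  | succ n ih =>
    rw [show α + ((n : ℤ) + 1 : ℤ) * (2 * π) = (α + (n : ℤ) * (2 * π)) + 2 * π by push_cast; ring,
      h1, ih]
    push_cast; ring
  | pred n ih =>
    have h2 := h1 (α + (-(n : ℤ) - 1 : ℤ) * (2 * π))
    rw [show α + (-(n : ℤ) - 1 : ℤ) * (2 * π) + 2 * π = α + (-(n : ℤ) : ℤ) * (2 * π) by
      push_cast; ring, ih] at h2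
    push_cast at h2 ⊢; linarith

theorem rad_add_two_pi_mul (q α : ℝ) (k : ℤ) : rad q (α + k * (2 * π)) = rad q α := by
  simp only [rad, cosSinPow, Real.cos_add_int_mul_two_pi, Real.sin_add_int_mul_two_pi]

/-- A point of the `ℓ^q`-unit sphere is determined by its Euclidean angle. -/
theorem eq_of_mem_sphere (hq : 1 < q) {v : ℝ × ℝ} (hv : |v.1| ^ q + |v.2| ^ q = 1) {s α : ℝ}
    (hs : 0 < s) (h : v = (s * Real.cos α, s * Real.sin α)) : s = rad q α := by
  have h1 : |s * Real.cos α| ^ q + |s * Real.sin α| ^ q = s ^ q * cosSinPow q α := by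
    rw [abs_mul, abs_mul, abs_of_pos hs, Real.mul_rpow hs.le (abs_nonneg _),
      Real.mul_rpow hs.le (abs_nonneg _), cosSinPow]
    ring
  rw [h] at hv
  simp only at hv
  rw [h1] at hv
  have h2 := (hv.trans (rad_rpow hq α).symm)
  have h3 := mul_right_cancel₀ (cosSinPow_pos q α).ne' h2
  exact (Real.rpow_left_inj hs.le (rad_pos q α).le (by linarith)).1 h3

theorem rad_mem_sphere (hq : 1 < q) (α : ℝ) :
    |rad q α * Real.cos α| ^ q + |rad q α * Real.sin α| ^ q = 1 := by
  have hs := rad_pos q α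
  rw [abs_mul, abs_mul, abs_of_pos hs, Real.mul_rpow hs.le (abs_nonneg _),
    Real.mul_rpow hs.le (abs_nonneg _), ← mul_add]
  exact rad_rpow hq α

theorem ne_zero_of_mem_sphere (hq : 1 < q) {v : ℝ × ℝ} (hv : |v.1| ^ q + |v.2| ^ q = 1) :
    v ≠ 0 := by
  rintro rfl
  simp [Real.zero_rpow (by linarith : q ≠ 0)] at hv

/-- This evaluates the choice operator in the definition of `trigPoint`. Symmetries, periodicity and
derivatives of `cos_q`, `sin_q` are all transported from ordinary trigonometry through this formula.
-/
theorem trigPoint_sweep (hq : 1 < q) (α : ℝ) :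
    trigPoint q (sweep q α) = (rad q α * Real.cos α, rad q α * Real.sin α) := by
  have hpp := pip_pos hq
  have h2p : (0 : ℝ) < 2 * pip q := by linarith
  -- `β` is the representative of `α` modulo `2π` in `[0, 2π)`, the range of `euclAngle`.
  obtain ⟨β, hβ⟩ := sweep_surjective hq (2 * pip q * Int.fract (sweep q α / (2 * pip q)))
  have hβ2 : sweep q β = sweep q (α + (-⌊sweep q α / (2 * pip q)⌋ : ℤ) * (2 * π)) := by
    rw [hβ, sweep_add_two_pi_mul hq, Int.fract]
    push_cast
    field_simp
    ring
  have hβα := (sweep_strictMono hq).injective hβ2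
  have hβ0 : 0 ≤ β := by
    rw [← (sweep_strictMono hq).le_iff_le, sweep_zero, hβ]
    exact mul_nonneg h2p.le (Int.fract_nonneg _)
  have hβ1 : β < 2 * π := by
    rw [← (sweep_strictMono hq).lt_iff_lt, hβ]
    have h3 := sweep_add_two_pi_mul hq 0 1
    simp only [Int.cast_one, one_mul, zero_add, sweep_zero] at h3
    rw [h3]
    have := Int.fract_lt_one (sweep q α / (2 * pip q))
    nlinarith
  have hex : ∃ P : ℝ × ℝ, |P.1| ^ q + |P.2| ^ q = 1 ∧
      lpAngle q P = 2 * pip q * Int.fract (sweep q α / (2 * pip q)) := by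
    refine ⟨(rad q β * Real.cos β, rad q β * Real.sin β), rad_mem_sphere hq β, ?_⟩
    rw [lpAngle_eq_sweep hq, euclAngle_polar (rad_pos q β) hβ0 hβ1, hβ]
  obtain ⟨h1, h2⟩ := Classical.epsilon_spec hex
  change |(trigPoint q (sweep q α)).1| ^ q + |(trigPoint q (sweep q α)).2| ^ q = 1 at h1
  change lpAngle q (trigPoint q (sweep q α)) = _ at h2
  obtain ⟨s, hs, hv⟩ := exists_polar (ne_zero_of_mem_sphere hq h1)
  have h3 : euclAngle (trigPoint q (sweep q α)) = β := by
    apply (sweep_strictMono hq).injective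
    rw [← lpAngle_eq_sweep hq, h2, hβ]
  rw [h3] at hv
  rw [hv, eq_of_mem_sphere hq h1 hs hv, hβα, rad_add_two_pi_mul, Real.cos_add_int_mul_two_pi,
    Real.sin_add_int_mul_two_pi]

theorem cosp_sweep (hq : 1 < q) (α : ℝ) : cosp q (sweep q α) = rad q α * Real.cos α := by
  rw [cosp, trigPoint_sweep hq]

theorem sinp_sweep (hq : 1 < q) (α : ℝ) : sinp q (sweep q α) = rad q α * Real.sin α := by
  rw [sinp, trigPoint_sweep hq]

theorem cosp_sinp_sphere (hq : 1 < q) (θ : ℝ) : |cosp q θ| ^ q + |sinp q θ| ^ q = 1 := by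
  obtain ⟨α, rfl⟩ := sweep_surjective hq θ
  rw [cosp_sweep hq, sinp_sweep hq, rad_mem_sphere hq]

theorem cosp_add_pip (hq : 1 < q) (θ : ℝ) : cosp q (θ + pip q) = -cosp q θ := by
  obtain ⟨α, rfl⟩ := sweep_surjective hq θ
  rw [pip_eq_sweep hq, ← sweep_add_pi hq, cosp_sweep hq, cosp_sweep hq, rad_add_pi,
    Real.cos_add_pi]
  ring

theorem sinp_add_pip (hq : 1 < q) (θ : ℝ) : sinp q (θ + pip q) = -sinp q θ := by
  obtain ⟨α, rfl⟩ := sweep_surjective hq θ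
  rw [pip_eq_sweep hq, ← sweep_add_pi hq, sinp_sweep hq, sinp_sweep hq, rad_add_pi,
    Real.sin_add_pi]
  ring

theorem cosp_neg (hq : 1 < q) (θ : ℝ) : cosp q (-θ) = cosp q θ := by
  obtain ⟨α, rfl⟩ := sweep_surjective hq θ
  rw [← sweep_neg, cosp_sweep hq, cosp_sweep hq, rad_neg, Real.cos_neg]

theorem sinp_neg (hq : 1 < q) (θ : ℝ) : sinp q (-θ) = -sinp q θ := by
  obtain ⟨α, rfl⟩ := sweep_surjective hq θ
  rw [← sweep_neg, sinp_sweep hq, sinp_sweep hq, rad_neg, Real.sin_neg, mul_neg]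

theorem cosp_add_two_pip (hq : 1 < q) (θ : ℝ) : cosp q (θ + 2 * pip q) = cosp q θ := by
  rw [two_mul, ← add_assoc, cosp_add_pip hq, cosp_add_pip hq, neg_neg]

theorem sinp_add_two_pip (hq : 1 < q) (θ : ℝ) : sinp q (θ + 2 * pip q) = sinp q θ := by
  rw [two_mul, ← add_assoc, sinp_add_pip hq, sinp_add_pip hq, neg_neg]

theorem cosp_add_int_mul (hq : 1 < q) (θ : ℝ) (k : ℤ) :
    cosp q (θ + k * (2 * pip q)) = cosp q θ :=
  Function.Periodic.int_mul (cosp_add_two_pip hq) k θ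

theorem sinp_add_int_mul (hq : 1 < q) (θ : ℝ) (k : ℤ) :
    sinp q (θ + k * (2 * pip q)) = sinp q θ :=
  Function.Periodic.int_mul (sinp_add_two_pip hq) k θ

/-- Equal points have equal Euclidean norms, so `rad` cancels and the Euclidean angles agree modulo
`2π`. -/
theorem exists_int_of_trig_eq (hq : 1 < q) {a b : ℝ} (hc : cosp q a = cosp q b)
    (hs : sinp q a = sinp q b) : ∃ k : ℤ, a = b + k * (2 * pip q) := by
  obtain ⟨α, rfl⟩ := sweep_surjective hq a
  obtain ⟨β, rfl⟩ := sweep_surjective hq b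
  rw [cosp_sweep hq, cosp_sweep hq] at hc
  rw [sinp_sweep hq, sinp_sweep hq] at hs
  have h1 : rad q α ^ 2 = rad q β ^ 2 := by
    have e1 : rad q α ^ 2 = (rad q α * Real.cos α) ^ 2 + (rad q α * Real.sin α) ^ 2 := by
      linear_combination -(rad q α) ^ 2 * Real.sin_sq_add_cos_sq α
    have e2 : rad q β ^ 2 = (rad q β * Real.cos β) ^ 2 + (rad q β * Real.sin β) ^ 2 := by
      linear_combination -(rad q β) ^ 2 * Real.sin_sq_add_cos_sq β
    rw [e1, e2, hc, hs]
  have h2 : rad q α = rad q β := (sq_eq_sq₀ (rad_pos q α).le (rad_pos q β).le).1 h1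
  rw [h2] at hc hs
  have h3 := mul_left_cancel₀ (rad_pos q β).ne' hc
  have h4 := mul_left_cancel₀ (rad_pos q β).ne' hs
  obtain ⟨k, hk⟩ := Real.Angle.angle_eq_iff_two_pi_dvd_sub.1 (Real.Angle.cos_sin_inj h3 h4)
  refine ⟨k, ?_⟩
  rw [← sweep_add_two_pi_mul hq]
  congr 1
  linarith

/-- Equality of the trigonometric functions at two angles persists after a rotation. -/
theorem trig_add_eq (hq : 1 < q) {a b : ℝ} (hc : cosp q a = cosp q b)
    (hs : sinp q a = sinp q b) (t : ℝ) :
    cosp q (t + a) = cosp q (t + b) ∧ sinp q (t + a) = sinp q (t + b) := by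
  obtain ⟨k, rfl⟩ := exists_int_of_trig_eq hq hc hs
  rw [← add_assoc]
  exact ⟨cosp_add_int_mul hq _ k, sinp_add_int_mul hq _ k⟩

theorem exists_trig_eq (hq : 1 < q) {u v : ℝ} (h : |u| ^ q + |v| ^ q = 1) :
    ∃ θ ∈ Ico 0 (2 * pip q), cosp q θ = u ∧ sinp q θ = v := by
  obtain ⟨s, hs, hv⟩ := exists_polar (ne_zero_of_mem_sphere hq (v := (u, v)) h)
  have hs2 := eq_of_mem_sphere hq (v := (u, v)) h hs hv
  have hm := euclAngle_mem (u, v)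
  have h3 := sweep_add_two_pi_mul hq 0 1
  simp only [Int.cast_one, one_mul, zero_add, sweep_zero] at h3
  refine ⟨sweep q (euclAngle (u, v)), ⟨?_, ?_⟩, ?_, ?_⟩
  · rw [← sweep_zero q]; exact (sweep_strictMono hq).monotone hm.1
  · rw [← h3]; exact sweep_strictMono hq hm.2
  · rw [cosp_sweep hq, ← hs2]; exact (congrArg Prod.fst hv).symm
  · rw [sinp_sweep hq, ← hs2]; exact (congrArg Prod.snd hv).symm

/-- The `ℓ^q`-angle of a vector on the ray of `(cos_q θ, sin_q θ)`. -/
theorem trig_lpAngle (hq : 1 < q) {r : ℝ} (hr : 0 < r) (θ : ℝ) :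
    cosp q (lpAngle q (r * cosp q θ, r * sinp q θ)) = cosp q θ ∧
      sinp q (lpAngle q (r * cosp q θ, r * sinp q θ)) = sinp q θ := by
  obtain ⟨α, rfl⟩ := sweep_surjective hq θ
  set v : ℝ × ℝ := (r * cosp q (sweep q α), r * sinp q (sweep q α)) with hvdef
  have hpos : 0 < r * rad q α := mul_pos hr (rad_pos q α)
  have hv : v = (r * rad q α * Real.cos α, r * rad q α * Real.sin α) := by
    rw [hvdef, cosp_sweep hq, sinp_sweep hq, mul_assoc, mul_assoc]
  have hk : euclAngle v = α + (-⌊α / (2 * π)⌋ : ℤ) * (2 * π) := by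
    have h2p := Real.two_pi_pos
    have h1 : α + (-⌊α / (2 * π)⌋ : ℤ) * (2 * π) = Int.fract (α / (2 * π)) * (2 * π) := by
      rw [Int.fract]; push_cast; field_simp; ring
    rw [hv, ← Real.cos_add_int_mul_two_pi α (-⌊α / (2 * π)⌋),
      ← Real.sin_add_int_mul_two_pi α (-⌊α / (2 * π)⌋)]
    refine euclAngle_polar hpos ?_ ?_
    · rw [h1]; exact mul_nonneg (Int.fract_nonneg _) h2p.le
    · rw [h1]; have := Int.fract_lt_one (α / (2 * π)); nlinarith
  rw [lpAngle_eq_sweep hq, hk, sweep_add_two_pi_mul hq]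
  exact ⟨cosp_add_int_mul hq _ _, sinp_add_int_mul hq _ _⟩

/-! ### Derivatives -/

/-- The factor `rad²` is the derivative of `sweep`. It cancels once the point is parametrised by
area instead of Euclidean angle, as in `hasDerivAt_trig`. -/
theorem hasDerivAt_trig_aux (hq : 1 < q) (α : ℝ) :
    HasDerivAt (fun α => rad q α * Real.cos α)
      (-phi q (rad q α * Real.sin α) * rad q α ^ 2) α ∧
    HasDerivAt (fun α => rad q α * Real.sin α)
      (phi q (rad q α * Real.cos α) * rad q α ^ 2) α := by
  have hr := rad_pos q α
  have h1 := rad_rpow hq α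
  have h2 : rad q α = rad q α ^ (q + 1) * cosSinPow q α := by
    rw [Real.rpow_add_one hr.ne']; linear_combination -(rad q α) * h1
  have h3 : rad q α ^ (q - 1) * rad q α ^ 2 = rad q α ^ (q + 1) := by
    rw [← Real.rpow_natCast, ← Real.rpow_add hr]; norm_num; ring_nf
  have h4 := phi_mul_self hq (Real.cos α)
  have h5 := phi_mul_self hq (Real.sin α)
  have h6 := Real.sin_sq_add_cos_sq α
  rw [phi_smul hq hr.le, phi_smul hq hr.le]
  constructor
  · refine ((hasDerivAt_rad hq α).mul (Real.hasDerivAt_cos α)).congr_deriv ?_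
    rw [cosSinPow, ← h4, ← h5] at h2
    linear_combination (Real.sin α) * (-h2) + phi q (Real.sin α) * h3 -
      rad q α ^ (q + 1) * phi q (Real.sin α) * h6
  · refine ((hasDerivAt_rad hq α).mul (Real.hasDerivAt_sin α)).congr_deriv ?_
    rw [cosSinPow, ← h4, ← h5] at h2
    linear_combination (Real.cos α) * h2 - phi q (Real.cos α) * h3 +
      rad q α ^ (q + 1) * phi q (Real.cos α) * h6

theorem hasDerivAt_trig (hq : 1 < q) (θ : ℝ) :
    HasDerivAt (cosp q) (-phi q (sinp q θ)) θ ∧ HasDerivAt (sinp q) (phi q (cosp q θ)) θ := by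
  let e := (sweep_strictMono hq).orderIsoOfSurjective _ (sweep_surjective hq)
  have he : ∀ x, sweep q (e.symm x) = x := fun x => e.apply_symm_apply x
  have hd : HasDerivAt e.symm (rad q (e.symm θ) ^ 2)⁻¹ θ :=
    HasDerivAt.of_local_left_inverse e.symm.continuous.continuousAt
      (hasDerivAt_sweep hq _) (pow_pos (rad_pos q _) 2).ne' (Eventually.of_forall he)
  have hpos := (pow_pos (rad_pos q (e.symm θ)) 2).ne'
  obtain ⟨h1, h2⟩ := hasDerivAt_trig_aux hq (e.symm θ)
  have ec : cosp q = fun x => rad q (e.symm x) * Real.cos (e.symm x) :=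
    funext fun x => by rw [← cosp_sweep hq, he]
  have es : sinp q = fun x => rad q (e.symm x) * Real.sin (e.symm x) :=
    funext fun x => by rw [← sinp_sweep hq, he]
  have h3 := h1.comp θ hd
  have h4 := h2.comp θ hd
  rw [mul_assoc, mul_inv_cancel₀ hpos, mul_one] at h3 h4
  rw [← sinp_sweep hq, he] at h3
  rw [← cosp_sweep hq, he] at h4
  exact ⟨ec ▸ h3, es ▸ h4⟩

theorem continuous_cosp (hq : 1 < q) : Continuous (cosp q) :=
  continuous_iff_continuousAt.2 fun θ => (hasDerivAt_trig hq θ).1.continuousAt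

theorem continuous_sinp (hq : 1 < q) : Continuous (sinp q) :=
  continuous_iff_continuousAt.2 fun θ => (hasDerivAt_trig hq θ).2.continuousAt

/-! ### Equality in Young's inequality and the dual angle -/

/-- The gap in Young's inequality is a nonnegative function of `x`, so a zero `s` is a minimum. Its
derivative `phi p s - a` vanishes there, and `phi q` inverts this relation. -/
theorem young_eq (hp : 1 < p) (hpq : 1 / p + 1 / q = 1) {s a : ℝ}
    (h : s * a = |s| ^ p / p + |a| ^ q / q) : s = phi q a := by
  have hc : p.HolderConjugate q :=
    Real.holderConjugate_iff.2 ⟨hp, by simpa using hpq⟩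
  have hmin : IsLocalMin (fun x => |x| ^ p / p + |a| ^ q / q - x * a) s := by
    refine Eventually.of_forall fun x => ?_
    have := Real.young_inequality x a hc
    simp only
    linarith
  have hd : HasDerivAt (fun x => |x| ^ p / p + |a| ^ q / q - x * a) (phi p s - a) s := by
    have h1 := (hasDerivAt_abs_rpow_phi hp s).div_const p
    refine ((h1.add_const _).sub ((hasDerivAt_id s).mul_const a)).congr_deriv ?_
    field_simp
  have h0 := hmin.hasDerivAt_eq_zero hd
  have hpq' : 1 / q + 1 / p = 1 := by linarith
  rw [← sub_eq_zero.1 h0, phi_phi (one_lt_of_conj hp hpq) hpq']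

/-- Equality in Hölder's inequality for unit vectors. -/
theorem dual_eq (hp : 1 < p) (hpq : 1 / p + 1 / q = 1) {a b s t : ℝ}
    (h1 : |a| ^ q + |b| ^ q = 1) (h2 : |s| ^ p + |t| ^ p = 1) (h : a * s + b * t = 1) :
    s = phi q a ∧ t = phi q b := by
  have hc : p.HolderConjugate q := Real.holderConjugate_iff.2 ⟨hp, by simpa using hpq⟩
  have e1 := Real.young_inequality s a hc
  have e2 := Real.young_inequality t b hc
  have e3 : |s| ^ p / p + |a| ^ q / q + (|t| ^ p / p + |b| ^ q / q) = 1 := by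
    calc _ = (|s| ^ p + |t| ^ p) * (1 / p) + (|a| ^ q + |b| ^ q) * (1 / q) := by ring
      _ = 1 := by rw [h1, h2]; linarith
  constructor
  · exact young_eq hp hpq (by linarith)
  · exact young_eq hp hpq (by linarith)

/-- The duality map sends the `ℓ^q`-sphere to the `ℓ^p`-sphere, which provides an admissible angle;
the equality case of Hölder's inequality shows that any admissible angle gives this same point. -/
theorem dualAngle_spec (hp : 1 < p) (hpq : 1 / p + 1 / q = 1) (θ : ℝ) :
    cosp p (dualAngle p q θ) = phi q (cosp q θ) ∧
      sinp p (dualAngle p q θ) = phi q (sinp q θ) := by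
  have hq := one_lt_of_conj hp hpq
  have h1 := cosp_sinp_sphere hq θ
  have hex : ∃ φ : ℝ, φ ∈ Ico 0 (2 * pip p) ∧
      cosp q θ * cosp p φ + sinp q θ * sinp p φ = 1 := by
    obtain ⟨φ, h2, h3, h4⟩ := exists_trig_eq hp (u := phi q (cosp q θ)) (v := phi q (sinp q θ))
      (by rw [abs_phi_rpow hp hpq, abs_phi_rpow hp hpq, h1])
    refine ⟨φ, h2, ?_⟩
    rw [h3, h4, mul_comm, phi_mul_self hq, mul_comm, phi_mul_self hq, h1]
  obtain ⟨-, h5⟩ := Classical.epsilon_spec hex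
  exact dual_eq hp hpq h1 (cosp_sinp_sphere hp _) h5

/-! ### The `ℓ^p`-norm of the plane -/

/-- The `ℓ^p`-norm of the vector `(a, b)`. -/
def lpn (p a b : ℝ) : ℝ := (|a| ^ p + |b| ^ p) ^ (1 / p)

theorem lpn_sum_nonneg (p a b : ℝ) : 0 ≤ |a| ^ p + |b| ^ p :=
  add_nonneg (Real.rpow_nonneg (abs_nonneg _) _) (Real.rpow_nonneg (abs_nonneg _) _)

theorem lpn_nonneg (p a b : ℝ) : 0 ≤ lpn p a b := Real.rpow_nonneg (lpn_sum_nonneg p a b) _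

theorem lpn_rpow (hp : 1 < p) (a b : ℝ) : lpn p a b ^ p = |a| ^ p + |b| ^ p := by
  rw [lpn, ← Real.rpow_mul (lpn_sum_nonneg p a b), one_div_mul_cancel (by linarith), Real.rpow_one]

theorem lpn_eq_of_rpow (hp : 1 < p) {a b r : ℝ} (hr : 0 ≤ r) (h : |a| ^ p + |b| ^ p = r ^ p) :
    lpn p a b = r := by
  rw [lpn, h, ← Real.rpow_mul hr, mul_one_div_cancel (by linarith), Real.rpow_one]

theorem lpn_smul (hp : 1 < p) (k a b : ℝ) : lpn p (k * a) (k * b) = |k| * lpn p a b := by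
  refine lpn_eq_of_rpow hp (mul_nonneg (abs_nonneg _) (lpn_nonneg _ _ _)) ?_
  rw [Real.mul_rpow (abs_nonneg _) (lpn_nonneg _ _ _), lpn_rpow hp, abs_mul, abs_mul,
    Real.mul_rpow (abs_nonneg _) (abs_nonneg _), Real.mul_rpow (abs_nonneg _) (abs_nonneg _)]
  ring

theorem lpn_neg_neg (p a b : ℝ) : lpn p (-a) (-b) = lpn p a b := by simp [lpn]

theorem lpn_neg_swap (p a b : ℝ) : lpn p (-b) a = lpn p a b := by simp [lpn, add_comm]

theorem abs_fst_le_lpn (hp : 1 < p) (a b : ℝ) : |a| ≤ lpn p a b := by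
  rw [← Real.rpow_le_rpow_iff (abs_nonneg _) (lpn_nonneg _ _ _) (by linarith : 0 < p), lpn_rpow hp]
  exact le_add_of_nonneg_right (Real.rpow_nonneg (abs_nonneg _) _)

theorem abs_snd_le_lpn (hp : 1 < p) (a b : ℝ) : |b| ≤ lpn p a b := by
  rw [← Real.rpow_le_rpow_iff (abs_nonneg _) (lpn_nonneg _ _ _) (by linarith : 0 < p), lpn_rpow hp]
  exact le_add_of_nonneg_left (Real.rpow_nonneg (abs_nonneg _) _)

theorem lpn_eq_zero (hp : 1 < p) {a b : ℝ} (h : lpn p a b = 0) : a = 0 ∧ b = 0 :=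
  ⟨abs_nonpos_iff.1 (h ▸ abs_fst_le_lpn hp a b), abs_nonpos_iff.1 (h ▸ abs_snd_le_lpn hp a b)⟩

theorem lpn_pos (hp : 1 < p) {a b : ℝ} (h : (a, b) ≠ 0) : 0 < lpn p a b :=
  (lpn_nonneg p a b).lt_of_ne' fun h0 => h (by
    obtain ⟨h1, h2⟩ := lpn_eq_zero hp h0
    rw [h1, h2]; rfl)

theorem lpn_sphere (hp : 1 < p) {a b : ℝ} (h : 0 < lpn p a b) :
    |a / lpn p a b| ^ p + |b / lpn p a b| ^ p = 1 := by
  rw [abs_div, abs_div, abs_of_pos h, Real.div_rpow (abs_nonneg _) h.le,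
    Real.div_rpow (abs_nonneg _) h.le, ← add_div, ← lpn_rpow hp]
  exact div_self (Real.rpow_pos_of_pos h p).ne'

theorem lpn_le (hp : 1 < p) (a b : ℝ) : lpn p a b ≤ |a| + |b| := by
  have h := Real.add_rpow_le_rpow_add (abs_nonneg a) (abs_nonneg b) hp.le
  rwa [← lpn_rpow hp, Real.rpow_le_rpow_iff (lpn_nonneg _ _ _) (by positivity) (by linarith)] at h

theorem continuous_lpn (hp : 1 < p) : Continuous fun v : ℝ × ℝ => lpn p v.1 v.2 := by
  have hp0 : 0 ≤ p := by linarith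
  refine ((continuous_fst.abs.rpow_const fun _ => Or.inr hp0).add
    (continuous_snd.abs.rpow_const fun _ => Or.inr hp0)).rpow_const fun _ => Or.inr ?_
  positivity

/-- Hölder's inequality in the plane. -/
theorem holder_le (hp : 1 < p) (hpq : 1 / p + 1 / q = 1) {a b ρ : ℝ} (hρ : 0 ≤ ρ)
    (h : |a| ^ q + |b| ^ q = ρ ^ q) (s t : ℝ) : a * s + b * t ≤ ρ * lpn p s t := by
  have hq := one_lt_of_conj hp hpq
  have hl : lpn q a b = ρ := lpn_eq_of_rpow hq hρ h
  rcases hρ.eq_or_lt with h0 | h0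
  · obtain ⟨rfl, rfl⟩ := lpn_eq_zero hq (hl.trans h0.symm)
    simp [← h0]
  rcases (lpn_nonneg p s t).eq_or_lt with h1 | h1
  · obtain ⟨rfl, rfl⟩ := lpn_eq_zero hp h1.symm
    simp [← h1]
  have hc : p.HolderConjugate q := Real.holderConjugate_iff.2 ⟨hp, by simpa using hpq⟩
  have e1 := Real.young_inequality (s / lpn p s t) (a / ρ) hc
  have e2 := Real.young_inequality (t / lpn p s t) (b / ρ) hc
  have e4 := lpn_sphere hp h1
  have e5 := lpn_sphere hq (hl.symm ▸ h0)
  rw [hl] at e5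
  have e3 : |s / lpn p s t| ^ p / p + |a / ρ| ^ q / q + (|t / lpn p s t| ^ p / p + |b / ρ| ^ q / q)
      = 1 := by
    calc _ = (|s / lpn p s t| ^ p + |t / lpn p s t| ^ p) * (1 / p)
          + (|a / ρ| ^ q + |b / ρ| ^ q) * (1 / q) := by ring
      _ = 1 := by rw [e4, e5]; linarith
  have e6 : (a * s + b * t) / (ρ * lpn p s t) ≤ 1 := by
    calc _ = s / lpn p s t * (a / ρ) + t / lpn p s t * (b / ρ) := by field_simp
      _ ≤ 1 := by linarith
  rwa [div_le_one (mul_pos h0 h1)] at e6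

/-- Equality makes the velocity `(s, t)` a nonnegative multiple of the dual of `(a, b)`. This
converts equality of integrals into pointwise information on the velocity of a curve; a zero
velocity is allowed. -/
theorem holder_eq (hp : 1 < p) (hpq : 1 / p + 1 / q = 1) {a b ρ s t : ℝ} (hρ : 0 < ρ)
    (h : |a| ^ q + |b| ^ q = ρ ^ q) (he : a * s + b * t = ρ * lpn p s t) :
    s = lpn p s t * phi q (a / ρ) ∧ t = lpn p s t * phi q (b / ρ) := by
  have hq := one_lt_of_conj hp hpq
  have hl : lpn q a b = ρ := lpn_eq_of_rpow hq hρ.le h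
  rcases (lpn_nonneg p s t).eq_or_lt with h1 | h1
  · obtain ⟨rfl, rfl⟩ := lpn_eq_zero hp h1.symm
    simp [← h1]
  have e5 := lpn_sphere hq (hl.symm ▸ hρ)
  rw [hl] at e5
  have e6 : a / ρ * (s / lpn p s t) + b / ρ * (t / lpn p s t) = 1 := by
    field_simp
    linarith
  obtain ⟨h2, h3⟩ := dual_eq hp hpq e5 (lpn_sphere hp h1) e6
  rw [← h2, ← h3]
  constructor <;> field_simp

theorem ACD.intervalIntegrable_lpn (hp : 1 < p) {a a' b b' : ℝ → ℝ} {s t : ℝ} (hst : s ≤ t)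
    (ha : ACD a a' s t) (hb : ACD b b' s t) :
    IntervalIntegrable (fun x => lpn p (a' x) (b' x)) volume s t := by
  have h1 := ha.intervalIntegrable hst
  have h2 := hb.intervalIntegrable hst
  refine (h1.norm.add h2.norm).mono_fun ?_ (Eventually.of_forall fun x => ?_)
  · have hm : AEStronglyMeasurable (fun x => (a' x, b' x)) (volume.restrict (uIoc s t)) :=
      (h1.def'.aestronglyMeasurable).prodMk h2.def'.aestronglyMeasurable
    have hc := (continuous_lpn hp).comp_aestronglyMeasurable hm
    exact hc
  · simp only [Real.norm_eq_abs]
    rw [abs_of_nonneg (lpn_nonneg _ _ _), abs_of_nonneg (by positivity)]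
    exact lpn_le hp _ _

/-! ### The area of the unit ball as an integral over its projection -/

/-- The function whose graph over `[-R, R]` is the upper half of the `ℓ^q`-sphere of radius `R`. -/
def capFun (q R x : ℝ) : ℝ := (max 0 (R ^ q - |x| ^ q)) ^ (1 / q)

theorem capFun_nonneg (q R x : ℝ) : 0 ≤ capFun q R x := Real.rpow_nonneg (le_max_left _ _) _

theorem continuous_capFun (hq : 1 < q) (R : ℝ) : Continuous (capFun q R) :=
  (continuous_const.max (continuous_const.sub
    (continuous_abs.rpow_const fun _ => Or.inr (by linarith)))).rpow_const
    fun _ => Or.inr (by positivity)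

theorem capFun_rpow (hq : 1 < q) {R x : ℝ} (hx : |x| ≤ R) :
    |x| ^ q + capFun q R x ^ q = R ^ q := by
  have h := Real.rpow_le_rpow (abs_nonneg x) hx (by linarith : 0 ≤ q)
  rw [capFun, ← Real.rpow_mul (le_max_left _ _), one_div_mul_cancel (by linarith), Real.rpow_one,
    max_eq_right (by linarith)]
  ring

theorem capFun_eq_zero (hq : 1 < q) {R x : ℝ} (hR : 0 ≤ R) (hx : R ≤ |x|) : capFun q R x = 0 := by
  have h := Real.rpow_le_rpow hR hx (by linarith : 0 ≤ q)
  rw [capFun, max_eq_left (by linarith), Real.zero_rpow (by positivity)]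

theorem capFun_scale (hq : 1 < q) {R : ℝ} (hR : 0 < R) (x : ℝ) :
    capFun q R x = R * capFun q 1 (x / R) := by
  have hRq := Real.rpow_pos_of_pos hR q
  have h1 : R ^ q - |x| ^ q = R ^ q * (1 - |x / R| ^ q) := by
    rw [abs_div, abs_of_pos hR, Real.div_rpow (abs_nonneg _) hR.le]; field_simp
  rw [capFun, capFun, h1, Real.one_rpow]
  nth_rewrite 1 [← mul_zero (R ^ q)]
  rw [← mul_max_of_nonneg _ _ hRq.le, Real.mul_rpow hRq.le (le_max_left _ _), ← Real.rpow_mul hR.le,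
    mul_one_div_cancel (by linarith), Real.rpow_one]

/-- By Fubini: the vertical slice of the unit ball at abscissa `x` has length `2 * capFun q 1 x`.
Schmidt's comparison uses the area of the ball in this form. -/
theorem integral_capFun_one (hq : 1 < q) : ∫ x in (-1 : ℝ)..1, capFun q 1 x = pip q / 2 := by
  have hs : ∀ x : ℝ, volume (Prod.mk x ⁻¹' unitBall q) = ENNReal.ofReal (2 * capFun q 1 x) := by
    intro x
    rcases le_or_gt |x| 1 with hx | hx
    · have h1 := capFun_rpow hq hx
      have : Prod.mk x ⁻¹' unitBall q = Icc (-capFun q 1 x) (capFun q 1 x) := by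
        ext y
        show |x| ^ q + |y| ^ q ≤ 1 ↔ _
        rw [Real.one_rpow] at h1
        rw [mem_Icc, ← abs_le, ← Real.rpow_le_rpow_iff (abs_nonneg y) (capFun_nonneg _ _ _)
          (by linarith : 0 < q)]
        constructor <;> intro h <;> linarith
      rw [this, Real.volume_Icc]
      congr 1; ring
    · have : Prod.mk x ⁻¹' unitBall q = ∅ := by
        ext y
        simp only [mem_empty_iff_false, iff_false]
        intro h
        have h : |x| ^ q + |y| ^ q ≤ 1 := h
        have h2 := Real.one_lt_rpow hx (by linarith : 0 < q)
        have h3 := Real.rpow_nonneg (abs_nonneg y) q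
        linarith
      rw [this, capFun_eq_zero hq zero_le_one hx.le]
      simp
  have hv : volume (unitBall q) = ∫⁻ x, ENNReal.ofReal (2 * capFun q 1 x) := by
    change ((volume : Measure ℝ).prod volume) _ = _
    rw [Measure.prod_apply (measurableSet_unitBall q)]
    exact lintegral_congr hs
  have hi : (fun x => ENNReal.ofReal (2 * capFun q 1 x)) =
      (Ioc (-1 : ℝ) 1).indicator fun x => ENNReal.ofReal (2 * capFun q 1 x) := by
    ext x
    by_cases hx : x ∈ Ioc (-1 : ℝ) 1
    · rw [indicator_of_mem hx]
    · rw [indicator_of_notMem hx, capFun_eq_zero hq zero_le_one, mul_zero, ENNReal.ofReal_zero]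
      by_contra! h
      rw [abs_lt] at h
      exact hx ⟨h.1, h.2.le⟩
  have hc : IntervalIntegrable (fun x => 2 * capFun q 1 x) volume (-1) 1 :=
    ((continuous_capFun hq 1).const_mul 2).intervalIntegrable _ _
  have hn : 0 ≤ ∫ x in (-1 : ℝ)..1, 2 * capFun q 1 x :=
    intervalIntegral.integral_nonneg (by norm_num) fun x _ =>
      mul_nonneg zero_le_two (capFun_nonneg _ _ _)
  rw [hi, lintegral_indicator measurableSet_Ioc, ← ofReal_integral_eq_lintegral_ofReal hc.1
    (Eventually.of_forall fun x => mul_nonneg zero_le_two (capFun_nonneg _ _ _)),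
    ← intervalIntegral.integral_of_le (by norm_num)] at hv
  rw [pip, hv, ENNReal.toReal_ofReal hn, intervalIntegral.integral_const_mul]
  ring

theorem integral_capFun (hq : 1 < q) {R : ℝ} (hR : 0 ≤ R) :
    ∫ x in -R..R, capFun q R x = pip q * R ^ 2 / 2 := by
  rcases hR.eq_or_lt with rfl | hR
  · simp
  · simp_rw [capFun_scale hq hR]
    rw [intervalIntegral.integral_const_mul, intervalIntegral.integral_comp_div _ hR.ne', neg_div,
      div_self hR.ne', integral_capFun_one hq, smul_eq_mul]
    ring

/-! ### The isoperimetric inequality, after Schmidt -/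

/-- Schmidt's comparison. Let `2R` be the width of the curve in the direction of `a`, and pair each
point of the curve with the point `(ξ, Y)` of the `ℓ^q`-circle of radius `R` over the same abscissa,
on the lower arc while `t₁ < t ≤ t₂` and on the upper arc otherwise. Then `∫ ξ b' = π_q ρ²` is the
area of the curve, `-∫ Y a' = π_q R²` is that of the circle, and Hölder's inequality bounds the sum
of the integrands by `R` times the speed. Hence `π_q (ρ² + R²) ≤ R L ≤ 2 π_q ρ R`, that is, `(ρ -
R)² ≤ 0`. So `R = ρ`, and Hölder's inequality is an equality almost everywhere. -/
theorem schmidt_aux (hp : 1 < p) (hpq : 1 / p + 1 / q = 1) {a a' b b' : ℝ → ℝ} {T t₁ t₂ ρ : ℝ}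
    (ha : ACD a a' 0 T) (hb : ACD b b' 0 T) (ha0 : a 0 = a T) (hb0 : b 0 = b T)
    (h1 : 0 ≤ t₁) (h12 : t₁ ≤ t₂) (h2 : t₂ ≤ T)
    (hmin : ∀ t ∈ Icc 0 T, a t₁ ≤ a t) (hmax : ∀ t ∈ Icc 0 T, a t ≤ a t₂) (hρ : 0 < ρ)
    (hA : ∫ t in (0 : ℝ)..T, (a t * b' t - b t * a' t) = 2 * pip q * ρ ^ 2)
    (hL : ∫ t in (0 : ℝ)..T, lpn p (a' t) (b' t) ≤ 2 * pip q * ρ) :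
    ∃ (a₀ : ℝ) (Y : ℝ → ℝ), ∫ t in (0 : ℝ)..T, lpn p (a' t) (b' t) = 2 * pip q * ρ ∧
      ∀ᵐ t, t ∈ Icc 0 T → |a t - a₀| ^ q + |Y t| ^ q = ρ ^ q ∧
        (a t - a₀) * b' t - Y t * a' t = ρ * lpn p (a' t) (b' t) := by
  have hq := one_lt_of_conj hp hpq
  have hpip := pip_pos hq
  have hT : 0 ≤ T := h1.trans (h12.trans h2)
  have m1 : t₁ ∈ Icc 0 T := ⟨h1, h12.trans h2⟩
  have m2 : t₂ ∈ Icc 0 T := ⟨h1.trans h12, h2⟩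
  set R : ℝ := (a t₂ - a t₁) / 2 with hR
  set a₀ : ℝ := (a t₂ + a t₁) / 2 with ha₀
  have hR0 : 0 ≤ R := by have := hmin t₂ m2; simp only [hR]; linarith
  set ξ : ℝ → ℝ := fun t => a t - a₀ with hξ
  have hξa : ACD ξ a' 0 T := ha.sub_const a₀
  have hξR : ∀ t ∈ Icc 0 T, |ξ t| ≤ R := fun t ht => by
    have e1 := hmin t ht
    have e2 := hmax t ht
    rw [abs_le]; simp only [hξ, hR, ha₀]; constructor <;> linarith
  set F : ℝ → ℝ := fun x => ∫ s in (0 : ℝ)..x, capFun q R s with hF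
  have hFd : ∀ x, HasDerivAt F (capFun q R x) x := fun x =>
    ((continuous_capFun hq R).integral_hasStrictDerivAt 0 x).hasDerivAt
  have hFR : F R - F (-R) = pip q * R ^ 2 / 2 := by
    rw [← integral_capFun hq hR0]
    exact intervalIntegral.integral_interval_sub_left
      ((continuous_capFun hq R).intervalIntegrable _ _)
      ((continuous_capFun hq R).intervalIntegrable _ _)
  set G : ℝ → ℝ := fun t => F (ξ t) with hG
  set G' : ℝ → ℝ := fun t => capFun q R (ξ t) * a' t with hG'
  have hGd : ACD G G' 0 T := hξa.comp_global hT hFd (continuous_capFun hq R)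
  have hG1 : ACD G G' 0 t₁ := hGd.mono le_rfl h1 (h12.trans h2)
  have hG2 : ACD G G' t₁ t₂ := hGd.mono h1 h12 h2
  have hG3 : ACD G G' t₂ T := hGd.mono (h1.trans h12) h2 le_rfl
  set Y : ℝ → ℝ := fun t => if t ≤ t₁ then capFun q R (ξ t) else
    if t ≤ t₂ then -capFun q R (ξ t) else capFun q R (ξ t) with hY
  set H' : ℝ → ℝ := fun t => -(Y t * a' t) with hH'
  have c1 : EqOn H' (fun t => -G' t) (uIoc 0 t₁) := by
    intro t ht
    rw [uIoc_of_le h1] at ht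
    simp [hH', hY, hG', ht.2]
  have c2 : EqOn H' G' (uIoc t₁ t₂) := by
    intro t ht
    rw [uIoc_of_le h12] at ht
    simp [hH', hY, hG', ht.2, not_le.2 ht.1]
  have c3 : EqOn H' (fun t => -G' t) (uIoc t₂ T) := by
    intro t ht
    rw [uIoc_of_le h2] at ht
    simp [hH', hY, hG', not_le.2 ht.1, not_le.2 (h12.trans_lt ht.1)]
  have i1 : IntervalIntegrable H' volume 0 t₁ :=
    (hG1.neg.intervalIntegrable h1).congr c1.symm
  have i2 : IntervalIntegrable H' volume t₁ t₂ := (hG2.intervalIntegrable h12).congr c2.symm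
  have i3 : IntervalIntegrable H' volume t₂ T := (hG3.neg.intervalIntegrable h2).congr c3.symm
  have iH : IntervalIntegrable H' volume 0 T := (i1.trans i2).trans i3
  -- On each piece the integrand is, up to sign, the derivative of `F ∘ ξ`, so backtracking of `ξ`
  -- is harmless and the total is `2 (F R - F (-R))`.
  have eH : ∫ t in (0 : ℝ)..T, H' t = pip q * R ^ 2 := by
    rw [← intervalIntegral.integral_add_adjacent_intervals (i1.trans i2) i3,
      ← intervalIntegral.integral_add_adjacent_intervals i1 i2,
      intervalIntegral.integral_congr_ae (Eventually.of_forall fun t ht => c1 ht),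
      intervalIntegral.integral_congr_ae (Eventually.of_forall fun t ht => c2 ht),
      intervalIntegral.integral_congr_ae (Eventually.of_forall fun t ht => c3 ht),
      hG1.neg.integral_eq h1, hG2.integral_eq h12, hG3.neg.integral_eq h2]
    have e0 : G 0 = G T := by simp only [hG, hξ, ha0]
    have e1 : G t₁ = F (-R) := by simp only [hG, hξ, hR, ha₀]; congr 1; ring
    have e2 : G t₂ = F R := by simp only [hG, hξ, hR, ha₀]; congr 1; ring
    rw [e0, e1, e2]
    linarith
  have iab : IntervalIntegrable (fun t => ξ t * b' t) volume 0 T :=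
    (hb.intervalIntegrable hT).continuousOn_mul (by rw [uIcc_of_le hT]; exact hξa.continuousOn)
  have iba : IntervalIntegrable (fun t => a' t * b t) volume 0 T :=
    (ha.intervalIntegrable hT).mul_continuousOn (by rw [uIcc_of_le hT]; exact hb.continuousOn)
  have eA : ∫ t in (0 : ℝ)..T, ξ t * b' t = pip q * ρ ^ 2 := by
    have e1 := (hξa.mul hb).integral_eq hT
    rw [intervalIntegral.integral_add iba iab] at e1
    have e2 : ∫ t in (0 : ℝ)..T, (a t * b' t - b t * a' t) =
        ∫ t in (0 : ℝ)..T, ((ξ t * b' t - a' t * b t) + a₀ * b' t) :=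
      intervalIntegral.integral_congr fun t _ => by simp only [hξ]; ring
    rw [intervalIntegral.integral_add (iab.sub iba) ((hb.intervalIntegrable hT).const_mul _),
      intervalIntegral.integral_sub iab iba, intervalIntegral.integral_const_mul,
      hb.integral_eq hT, hb0, sub_self, mul_zero, add_zero, hA] at e2
    have e3 : ξ T * b T - ξ 0 * b 0 = 0 := by simp only [hξ, ha0, hb0]; ring
    rw [e3] at e1
    linarith
  have iL := ACD.intervalIntegrable_lpn hp hT ha hb
  have hYR : ∀ t ∈ Icc 0 T, |ξ t| ^ q + |Y t| ^ q = R ^ q := by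
    intro t ht
    have : |Y t| = capFun q R (ξ t) := by
      simp only [hY]
      split_ifs <;> simp [abs_of_nonneg (capFun_nonneg q R (ξ t))]
    rw [this, capFun_rpow hq (hξR t ht)]
  have hW : ∀ t ∈ Icc 0 T, ξ t * b' t + H' t ≤ R * lpn p (a' t) (b' t) := by
    intro t ht
    have := holder_le hp hpq (a := -Y t) (b := ξ t) hR0
      (by rw [abs_neg, add_comm]; exact hYR t ht) (a' t) (b' t)
    simp only [hH']
    linarith
  have eW : ∫ t in (0 : ℝ)..T, (ξ t * b' t + H' t) = pip q * ρ ^ 2 + pip q * R ^ 2 := by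
    rw [intervalIntegral.integral_add iab iH, eA, eH]
  have hle := intervalIntegral.integral_mono_on hT (iab.add iH) (iL.const_mul R) hW
  rw [eW, intervalIntegral.integral_const_mul] at hle
  have hsq : pip q * (ρ - R) ^ 2 ≤ 0 := by
    have := mul_le_mul_of_nonneg_left hL hR0
    nlinarith
  have hρR : R = ρ := by
    have h3 : (ρ - R) ^ 2 ≤ 0 := by
      by_contra! h
      exact absurd hsq (not_le.2 (mul_pos hpip h))
    have h4 : (ρ - R) = 0 := pow_eq_zero_iff two_ne_zero |>.1 (le_antisymm h3 (sq_nonneg _))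
    linarith
  rw [hρR] at hle hW hYR eW
  have hLe : ∫ t in (0 : ℝ)..T, lpn p (a' t) (b' t) = 2 * pip q * ρ := by
    refine le_antisymm hL ?_
    by_contra! h
    have := mul_lt_mul_of_pos_left h hρ
    nlinarith
  refine ⟨a₀, Y, hLe, ?_⟩
  have hz : ∫ t in (0 : ℝ)..T, (ρ * lpn p (a' t) (b' t) - (ξ t * b' t + H' t)) = 0 := by
    rw [intervalIntegral.integral_sub (iL.const_mul ρ) (iab.add iH), eW,
      intervalIntegral.integral_const_mul, hLe]
    ring
  rw [intervalIntegral.integral_eq_zero_iff_of_le_of_nonneg_ae hT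
    ((ae_restrict_iff' measurableSet_Ioc).2 (Eventually.of_forall fun t ht =>
      sub_nonneg.2 (hW t (Ioc_subset_Icc_self ht)))) ((iL.const_mul ρ).sub (iab.add iH))] at hz
  have hz2 := (ae_restrict_iff' measurableSet_Ioc).1 hz
  have n0 : ∀ᵐ t : ℝ, t ≠ 0 := by simp [ae_iff, measure_singleton]
  filter_upwards [hz2, n0] with t ht h0 hm
  refine ⟨hYR t hm, ?_⟩
  have h5 := ht ⟨lt_of_le_of_ne hm.1 h0.symm, hm.2⟩
  simp only [hH', Pi.zero_apply] at h5
  linarith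

/-- If the maximum of `a` precedes its minimum, the central reflection of the curve exchanges the
two extrema and keeps area and length. -/
theorem schmidt (hp : 1 < p) (hpq : 1 / p + 1 / q = 1) {a a' b b' : ℝ → ℝ} {T ρ : ℝ} (hT : 0 ≤ T)
    (ha : ACD a a' 0 T) (hb : ACD b b' 0 T) (ha0 : a 0 = a T) (hb0 : b 0 = b T) (hρ : 0 < ρ)
    (hA : ∫ t in (0 : ℝ)..T, (a t * b' t - b t * a' t) = 2 * pip q * ρ ^ 2)
    (hL : ∫ t in (0 : ℝ)..T, lpn p (a' t) (b' t) ≤ 2 * pip q * ρ) :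
    ∃ (a₀ : ℝ) (Y : ℝ → ℝ), ∫ t in (0 : ℝ)..T, lpn p (a' t) (b' t) = 2 * pip q * ρ ∧
      ∀ᵐ t, t ∈ Icc 0 T → |a t - a₀| ^ q + |Y t| ^ q = ρ ^ q ∧
        (a t - a₀) * b' t - Y t * a' t = ρ * lpn p (a' t) (b' t) := by
  obtain ⟨t₁, m1, hmin⟩ := isCompact_Icc.exists_isMinOn (nonempty_Icc.2 hT) ha.continuousOn
  obtain ⟨t₂, m2, hmax⟩ := isCompact_Icc.exists_isMaxOn (nonempty_Icc.2 hT) ha.continuousOn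
  rcases le_total t₁ t₂ with h | h
  · exact schmidt_aux hp hpq ha hb ha0 hb0 m1.1 h m2.2 (fun t ht => hmin ht) (fun t ht => hmax ht)
      hρ hA hL
  · obtain ⟨a₀, Y, h1, h2⟩ := schmidt_aux hp hpq (t₁ := t₂) (t₂ := t₁) ha.neg hb.neg
      (by simp [ha0]) (by simp [hb0]) m2.1 h m1.2 (fun t ht => neg_le_neg (hmax ht))
      (fun t ht => neg_le_neg (hmin ht)) hρ (by simpa using hA)
      (by simpa only [lpn_neg_neg] using hL)
    simp only [lpn_neg_neg] at h1 h2
    refine ⟨-a₀, fun t => -Y t, h1, ?_⟩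
    filter_upwards [h2] with t ht hm
    obtain ⟨e1, e2⟩ := ht hm
    rw [abs_neg]
    refine ⟨?_, by linarith⟩
    rw [← e1, ← abs_neg (-a t - a₀)]
    congr 3; ring

/-- Equality in the isoperimetric inequality: the curve lies on an `ℓ^q`-sphere. -/
theorem isoperimetric_eq (hp : 1 < p) (hpq : 1 / p + 1 / q = 1) {a a' b b' : ℝ → ℝ} {T ρ : ℝ}
    (hT : 0 ≤ T) (ha : ACD a a' 0 T) (hb : ACD b b' 0 T) (ha0 : a 0 = a T) (hb0 : b 0 = b T)
    (hρ : 0 < ρ)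
    (hA : ∫ t in (0 : ℝ)..T, (a t * b' t - b t * a' t) = 2 * pip q * ρ ^ 2)
    (hL : ∫ t in (0 : ℝ)..T, lpn p (a' t) (b' t) ≤ 2 * pip q * ρ) :
    ∃ a₀ b₀ : ℝ, ∫ t in (0 : ℝ)..T, lpn p (a' t) (b' t) = 2 * pip q * ρ ∧
      (∀ t ∈ Icc 0 T, |a t - a₀| ^ q + |b t - b₀| ^ q = ρ ^ q) ∧
      ∀ᵐ t, t ∈ Icc 0 T → (a t - a₀) * b' t - (b t - b₀) * a' t = ρ * lpn p (a' t) (b' t) := by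
  have hq := one_lt_of_conj hp hpq
  have hpip := pip_pos hq
  obtain ⟨a₀, Y, hLe, hY⟩ := schmidt hp hpq hT ha hb ha0 hb0 hρ hA hL
  -- One application does not relate the auxiliary ordinate `Y` to `b`. The second one is made on
  -- the curve turned by a quarter, whose abscissa is `-b`.
  obtain ⟨c₀, X, -, hX⟩ := schmidt hp hpq hT hb.neg ha (by simp [hb0]) ha0 hρ
    (by rw [← hA]; exact intervalIntegral.integral_congr fun t _ => by ring)
    (by simpa only [lpn_neg_swap] using hL)
  simp only [lpn_neg_swap] at hX
  -- Where the velocity is nonzero, both equality cases express `a'` through an injective `phi q`,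
  -- once with `Y` and once with `b`. Comparing them identifies `Y` with `b` up to a constant.
  have key : ∀ᵐ t, t ∈ Icc 0 T → (lpn p (a' t) (b' t) = 0 ∨
      (|a t - a₀| ^ q + |b t - -c₀| ^ q = ρ ^ q ∧
      (a t - a₀) * b' t - (b t - -c₀) * a' t = ρ * lpn p (a' t) (b' t))) := by
    filter_upwards [hX, hY] with t h1 h2 hm
    obtain ⟨e1, e2⟩ := h1 hm
    obtain ⟨e3, e4⟩ := h2 hm
    by_cases h0 : lpn p (a' t) (b' t) = 0
    · exact Or.inl h0
    refine Or.inr ?_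
    obtain ⟨k1, -⟩ := holder_eq hp hpq (a := -Y t) (b := a t - a₀) (s := a' t) (t := b' t) hρ
      (by rw [abs_neg, add_comm]; exact e3) (by linarith)
    obtain ⟨k2, -⟩ := holder_eq hp hpq (a := -b t - c₀) (b := X t) (s := a' t) (t := b' t) hρ e1
      (by linarith)
    have k3 : phi q (-Y t / ρ) = phi q ((-b t - c₀) / ρ) :=
      mul_left_cancel₀ h0 (k1.symm.trans k2)
    have k4 := (phi_strictMono hq).injective k3
    have k5 : Y t = b t - -c₀ := by
      rw [div_left_inj' hρ.ne'] at k4; linarith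
    rw [← k5]
    exact ⟨e3, e4⟩
  refine ⟨a₀, -c₀, hLe, ?_, ?_⟩
  · have hξ := ha.sub_const a₀
    have hη := hb.sub_const (-c₀)
    have hqc : Continuous fun x => q * phi q x := (continuous_phi hq).const_mul q
    have hg := (hξ.comp_global hT (hasDerivAt_abs_rpow_phi hq) hqc).add
      (hη.comp_global hT (hasDerivAt_abs_rpow_phi hq) hqc)
    -- By the equality case the velocity is a multiple of `(-phi q (b - b₀), phi q (a - a₀))` with
    -- `b₀ = -c₀`, which is tangent to the level sets of the `ℓ^q`-norm.
    have hg0 := hg.congr_deriv (g' := fun _ => 0) (by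
      filter_upwards [key] with t ht hm
      rcases ht hm with h0 | ⟨e1, e2⟩
      · obtain ⟨z1, z2⟩ := lpn_eq_zero hp h0
        rw [z1, z2]; ring
      · obtain ⟨k1, k2⟩ := holder_eq hp hpq (a := -(b t - -c₀)) (b := a t - a₀) (s := a' t)
          (t := b' t) hρ (by rw [abs_neg, add_comm]; exact e1) (by linarith)
        have hρi : 0 ≤ ρ⁻¹ := by positivity
        rw [div_eq_inv_mul, phi_smul hq hρi] at k1 k2
        rw [phi_neg] at k1
        linear_combination q * phi q (a t - a₀) * k1 + q * phi q (b t - -c₀) * k2)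
    have hconst : ∀ t ∈ Icc 0 T, ∀ s ∈ Icc 0 T, |a t - a₀| ^ q + |b t - -c₀| ^ q =
        |a s - a₀| ^ q + |b s - -c₀| ^ q := by
      intro t ht s hs
      have h1 := hg0.eq_add_integral ht
      have h2 := hg0.eq_add_integral hs
      simp only [intervalIntegral.integral_zero, add_zero] at h1 h2
      rw [h1, h2]
    -- If the constant differed from `ρ ^ q`, the velocity would vanish almost everywhere, against
    -- the positive length.
    have hex : ∃ s ∈ Icc 0 T, |a s - a₀| ^ q + |b s - -c₀| ^ q = ρ ^ q := by
      by_contra! hne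
      have : ∫ t in (0 : ℝ)..T, lpn p (a' t) (b' t) = 0 := by
        refine intervalIntegral.integral_zero_ae ?_
        filter_upwards [key] with t ht hm
        rw [uIoc_of_le hT] at hm
        rcases ht (Ioc_subset_Icc_self hm) with h0 | ⟨e1, -⟩
        · exact h0
        · exact absurd e1 (hne t (Ioc_subset_Icc_self hm))
      rw [this] at hLe
      have := mul_pos hpip hρ
      linarith
    obtain ⟨s, hs, he⟩ := hex
    intro t ht
    rw [hconst t ht s hs, he]
  · filter_upwards [key] with t ht hm
    rcases ht hm with h0 | ⟨-, e2⟩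
    · obtain ⟨z1, z2⟩ := lpn_eq_zero hp h0
      rw [h0, z1, z2]; ring
    · exact e2

/-! ### Curves on an `ℓ^q`-circle -/

/-- An absolutely continuous curve on an `ℓ^q`-circle is parametrised by its swept area. -/
theorem exists_trig_param (hq : 1 < q) {ξ ξ' η η' v : ℝ → ℝ} {T ρ : ℝ} (hT : 0 ≤ T) (hρ : 0 < ρ)
    (hξ : ACD ξ ξ' 0 T) (hη : ACD η η' 0 T)
    (hs : ∀ t ∈ Icc 0 T, |ξ t| ^ q + |η t| ^ q = ρ ^ q)
    (hv : ∀ᵐ t, t ∈ Icc 0 T → ξ t * η' t - η t * ξ' t = ρ * v t) :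
    ∃ ψ : ℝ, ∀ t ∈ Icc 0 T, ξ t = ρ * cosp q (ψ + (∫ s in (0 : ℝ)..t, v s) / ρ) ∧
      η t = ρ * sinp q (ψ + (∫ s in (0 : ℝ)..t, v s) / ρ) := by
  have hsph : ∀ t ∈ Icc 0 T, |ξ t / ρ| ^ q + |η t / ρ| ^ q = 1 := fun t ht => by
    have hρq := Real.rpow_pos_of_pos hρ q
    rw [abs_div, abs_div, abs_of_pos hρ, Real.div_rpow (abs_nonneg _) hρ.le,
      Real.div_rpow (abs_nonneg _) hρ.le, ← add_div, hs t ht, div_self hρq.ne']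
  set n : ℝ → ℝ := fun t => ξ t * ξ t + η t * η t with hn
  have hnpos : ∀ t ∈ Icc 0 T, 0 < n t := by
    intro t ht
    have h0 := ne_zero_of_mem_sphere hq (v := (ξ t / ρ, η t / ρ)) (hsph t ht)
    by_contra! h
    have e1 : ξ t = 0 := by simp only [hn] at h; nlinarith [mul_self_nonneg (ξ t), mul_self_nonneg (η t)]
    have e2 : η t = 0 := by simp only [hn] at h; nlinarith [mul_self_nonneg (ξ t), mul_self_nonneg (η t)]
    apply h0
    rw [e1, e2, zero_div]; rfl
  have m0 : (0 : ℝ) ∈ Icc 0 T := ⟨le_rfl, hT⟩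
  have hnd : ACD n _ 0 T := (hξ.mul hξ).add (hη.mul hη)
  obtain ⟨tm, htm, hm⟩ := isCompact_Icc.exists_isMinOn ⟨0, m0⟩ hnd.continuousOn
  obtain ⟨tM, htM, hM⟩ := isCompact_Icc.exists_isMaxOn ⟨0, m0⟩ hnd.continuousOn
  have hinv : ACD (fun t => (n t)⁻¹) _ 0 T :=
    hnd.comp (c := n tm) (d := n tM) hT (fun t ht => ⟨hm ht, hM ht⟩)
      (fun x hx => hasDerivAt_inv ((hnpos tm htm).trans_le hx.1).ne')
      ((continuousOn_id.pow 2).inv₀ fun x hx =>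
        pow_ne_zero 2 ((hnpos tm htm).trans_le hx.1).ne').neg
  obtain ⟨s, hspos, hs0⟩ := exists_polar (v := (ξ 0, η 0)) (fun h => by
    have h1 : ξ 0 = 0 := congrArg Prod.fst h
    have h2 : η 0 = 0 := congrArg Prod.snd h
    have := hnpos 0 m0
    simp [hn, h1, h2] at this)
  set A₀ := euclAngle (ξ 0, η 0) with hA₀
  have hξ0 : ξ 0 = s * Real.cos A₀ := congrArg Prod.fst hs0
  have hη0 : η 0 = s * Real.sin A₀ := congrArg Prod.snd hs0
  -- The derivative of the polar angle. Its primitive `A` is a continuous lift of the angle, which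
  -- remains to be checked.
  set A' : ℝ → ℝ := fun t => (ξ t * η' t - η t * ξ' t) * (n t)⁻¹ with hA'
  have hAint : IntervalIntegrable A' volume 0 T := by
    have hu : uIcc 0 T = Icc 0 T := uIcc_of_le hT
    refine IntervalIntegrable.mul_continuousOn (IntervalIntegrable.sub ?_ ?_)
      (by rw [hu]; exact hinv.continuousOn)
    · exact (hη.intervalIntegrable hT).continuousOn_mul (by rw [hu]; exact hξ.continuousOn)
    · exact (hξ.intervalIntegrable hT).continuousOn_mul (by rw [hu]; exact hη.continuousOn)
  set A : ℝ → ℝ := fun t => A₀ + ∫ s in (0 : ℝ)..t, A' s with hA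
  have hAd : ACD A A' 0 T := ACD.of_integral hAint hT A₀
  have hA0 : A 0 = A₀ := by simp [hA]
  have hC := hAd.comp_global hT Real.hasDerivAt_cos Real.continuous_sin.neg
  have hS := hAd.comp_global hT Real.hasDerivAt_sin Real.continuous_cos
  set W : ℝ → ℝ := fun t => η t * Real.cos (A t) - ξ t * Real.sin (A t) with hW
  have hWd := (hη.mul hC).sub (hξ.mul hS)
  -- `W` is the component of the curve orthogonal to the direction of angle `A`, so `W² / n` is the
  -- squared sine of the angular error; it is constant and vanishes at time `0`.
  have hK := ((hWd.mul hWd).mul hinv).congr_deriv (g' := fun _ => 0) (by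
    refine Eventually.of_forall fun t ht => ?_
    have hnt := (hnpos t ht).ne'
    simp only [hA']
    field_simp
    simp only [hn]
    ring)
  have hW0 : ∀ t ∈ Icc 0 T, W t = 0 := by
    intro t ht
    have h1 := hK.eq_add_integral ht
    have h2 : W 0 = 0 := by simp only [hW, hA0, hξ0, hη0]; ring
    change W t * W t * (n t)⁻¹ = W 0 * W 0 * (n 0)⁻¹ + _ at h1
    rw [h2] at h1
    simp only [intervalIntegral.integral_zero, mul_zero, zero_mul, add_zero] at h1
    rcases mul_eq_zero.1 h1 with h3 | h3
    · exact mul_self_eq_zero.1 h3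
    · exact absurd h3 (inv_ne_zero (hnpos t ht).ne')
  set U : ℝ → ℝ := fun t => ξ t * Real.cos (A t) + η t * Real.sin (A t) with hU
  have hUd := (hξ.mul hC).add (hη.mul hS)
  have hUn : ∀ t ∈ Icc 0 T, U t ^ 2 = n t := by
    intro t ht
    have h1 := hW0 t ht
    have h2 := Real.sin_sq_add_cos_sq (A t)
    have h3 : U t ^ 2 + W t ^ 2 = n t := by
      simp only [hU, hW, hn]
      linear_combination (ξ t ^ 2 + η t ^ 2) * h2
    rw [h1] at h3
    linarith
  have hU0 : U 0 = s := by
    simp only [hU, hA0, hξ0, hη0]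
    linear_combination s * Real.sin_sq_add_cos_sq A₀
  have hUpos : ∀ t ∈ Icc 0 T, 0 < U t := by
    intro t ht
    by_contra! h
    have hc : ContinuousOn U (Icc 0 t) := hUd.continuousOn.mono (Icc_subset_Icc_right ht.2)
    obtain ⟨x, hx, hx0⟩ := intermediate_value_Icc' ht.1 hc ⟨h, hU0 ▸ hspos.le⟩
    have hx2 : x ∈ Icc 0 T := ⟨hx.1, hx.2.trans ht.2⟩
    have := hUn x hx2
    rw [hx0] at this
    have := hnpos x hx2
    linarith
  have hpol : ∀ t ∈ Icc 0 T, ξ t = U t * Real.cos (A t) ∧ η t = U t * Real.sin (A t) := by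
    intro t ht
    have h1 := hW0 t ht
    have h2 := Real.sin_sq_add_cos_sq (A t)
    simp only [hW] at h1
    simp only [hU]
    constructor
    · linear_combination -(ξ t) * h2 - Real.sin (A t) * h1
    · linear_combination -(η t) * h2 + Real.cos (A t) * h1
  have hrad : ∀ t ∈ Icc 0 T, U t / ρ = rad q (A t) := by
    intro t ht
    obtain ⟨h1, h2⟩ := hpol t ht
    refine eq_of_mem_sphere hq (v := (ξ t / ρ, η t / ρ)) (hsph t ht) (div_pos (hUpos t ht) hρ) ?_
    rw [h1, h2]
    ext <;> simp <;> ring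
  -- By the chain rule the swept area has derivative `rad² A' = (U² / ρ²) (ρ v / U²) = v / ρ`.
  have hsw := (hAd.comp_global hT (hasDerivAt_sweep hq) ((continuous_rad hq).pow 2)).congr_deriv
    (g' := fun t => v t / ρ) (by
      filter_upwards [hv] with t h1 ht
      have h2 := hUn t ht
      have h3 := (hnpos t ht).ne'
      simp only [hA']
      rw [← hrad t ht, h1 ht, div_pow, h2]
      field_simp)
  refine ⟨sweep q A₀, fun t ht => ?_⟩
  have h1 := hsw.eq_add_integral ht
  rw [intervalIntegral.integral_div, hA0] at h1
  obtain ⟨h2, h3⟩ := hpol t ht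
  rw [← h1, cosp_sweep hq, sinp_sweep hq, ← hrad t ht, h2, h3]
  constructor <;> field_simp

theorem isoperimetric_param (hp : 1 < p) (hpq : 1 / p + 1 / q = 1) {a a' b b' : ℝ → ℝ} {T ρ : ℝ}
    (hT : 0 ≤ T) (ha : ACD a a' 0 T) (hb : ACD b b' 0 T) (ha0 : a 0 = a T) (hb0 : b 0 = b T)
    (hρ : 0 < ρ)
    (hA : ∫ t in (0 : ℝ)..T, (a t * b' t - b t * a' t) = 2 * pip q * ρ ^ 2)
    (hL : ∫ t in (0 : ℝ)..T, lpn p (a' t) (b' t) ≤ 2 * pip q * ρ) :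
    ∫ t in (0 : ℝ)..T, lpn p (a' t) (b' t) = 2 * pip q * ρ ∧ ∃ a₀ b₀ ψ : ℝ, ∀ t ∈ Icc 0 T,
      a t = a₀ + ρ * cosp q (ψ + (∫ s in (0 : ℝ)..t, lpn p (a' s) (b' s)) / ρ) ∧
      b t = b₀ + ρ * sinp q (ψ + (∫ s in (0 : ℝ)..t, lpn p (a' s) (b' s)) / ρ) := by
  obtain ⟨a₀, b₀, h1, h2, h3⟩ := isoperimetric_eq hp hpq hT ha hb ha0 hb0 hρ hA hL
  obtain ⟨ψ, h4⟩ := exists_trig_param (one_lt_of_conj hp hpq) hT hρ (ha.sub_const a₀)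
    (hb.sub_const b₀) h2 h3
  refine ⟨h1, a₀, b₀, ψ, fun t ht => ?_⟩
  obtain ⟨h5, h6⟩ := h4 t ht
  constructor <;> linarith

/-! ### Horizontal curves in coordinates -/

theorem hasDerivAt_heis {γ : ℝ → Heis} {v : Heis} {t : ℝ} : HasDerivAt γ v t ↔
    HasDerivAt (fun t => (γ t).1) v.1 t ∧ HasDerivAt (fun t => (γ t).2.1) v.2.1 t ∧
      HasDerivAt (fun t => (γ t).2.2) v.2.2 t := by
  constructor
  · intro h
    exact ⟨(ContinuousLinearMap.fst ℝ ℝ (ℝ × ℝ)).hasFDerivAt.comp_hasDerivAt t h,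
      (ContinuousLinearMap.fst ℝ ℝ ℝ).hasFDerivAt.comp_hasDerivAt t
        ((ContinuousLinearMap.snd ℝ ℝ (ℝ × ℝ)).hasFDerivAt.comp_hasDerivAt t h),
      (ContinuousLinearMap.snd ℝ ℝ ℝ).hasFDerivAt.comp_hasDerivAt t
        ((ContinuousLinearMap.snd ℝ ℝ (ℝ × ℝ)).hasFDerivAt.comp_hasDerivAt t h)⟩
  · rintro ⟨h1, h2, h3⟩
    exact h1.prodMk (h2.prodMk h3)

theorem hor_eq (u₁ u₂ : ℝ) (g : Heis) : u₁ • fieldX g + u₂ • fieldY g =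
    (u₁, u₂, (g.1 * u₂ - g.2.1 * u₁) / 2) := by
  simp only [fieldX, fieldY]
  ext
  · simp
  · simp
  · simp only [Prod.smul_snd, Prod.snd_add, smul_eq_mul]; ring

/-- The coordinates of a horizontal curve with control `(x', y')`. -/
def HorCoord (γ : ℝ → Heis) (x' y' : ℝ → ℝ) (a b : ℝ) : Prop :=
  ACD (fun t => (γ t).1) x' a b ∧ ACD (fun t => (γ t).2.1) y' a b ∧
    ACD (fun t => (γ t).2.2) (fun t => ((γ t).1 * y' t - (γ t).2.1 * x' t) / 2) a b

theorem IsHorizontal.horCoord {γ : ℝ → Heis} {a b : ℝ} (h : IsHorizontal γ a b) :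
    HorCoord γ (fun t => (deriv γ t).1) (fun t => (deriv γ t).2.1) a b := by
  have h2 := (ae_restrict_iff' measurableSet_Icc).1 h.2
  have a1 : AbsolutelyContinuousOnInterval (fun t => (γ t).1) a b :=
    absolutelyContinuousOnInterval_lipschitz_comp (g := fun g : Heis => g.1) (s := univ) h.1
      (K := 1) LipschitzWith.prod_fst.lipschitzOnWith (mapsTo_univ _ _)
  have a2 : AbsolutelyContinuousOnInterval (fun t => (γ t).2) a b :=
    absolutelyContinuousOnInterval_lipschitz_comp (g := fun g : Heis => g.2) (s := univ) h.1
      (K := 1) LipschitzWith.prod_snd.lipschitzOnWith (mapsTo_univ _ _)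
  have a3 : AbsolutelyContinuousOnInterval (fun t => (γ t).2.1) a b :=
    absolutelyContinuousOnInterval_lipschitz_comp (g := fun g : ℝ × ℝ => g.1) (s := univ) a2
      (K := 1) LipschitzWith.prod_fst.lipschitzOnWith (mapsTo_univ _ _)
  have a4 : AbsolutelyContinuousOnInterval (fun t => (γ t).2.2) a b :=
    absolutelyContinuousOnInterval_lipschitz_comp (g := fun g : ℝ × ℝ => g.2) (s := univ) a2
      (K := 1) LipschitzWith.prod_snd.lipschitzOnWith (mapsTo_univ _ _)
  refine ⟨⟨a1, ?_⟩, ⟨a3, ?_⟩, ⟨a4, ?_⟩⟩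
  all_goals
    filter_upwards [h2] with t h3 ht
    obtain ⟨u₁, u₂, h4⟩ := h3 ht
    rw [hor_eq] at h4
    have h5 := h4.deriv
    rw [hasDerivAt_heis] at h4
    rw [h5]
  · exact h4.1
  · exact h4.2.1
  · exact h4.2.2

theorem HorCoord.isHorizontal {γ : ℝ → Heis} {x' y' : ℝ → ℝ} {a b : ℝ}
    (h : HorCoord γ x' y' a b) : IsHorizontal γ a b := by
  obtain ⟨hx, hy, hz⟩ := h
  refine ⟨absolutelyContinuousOnInterval_prodMk hx.1
    (absolutelyContinuousOnInterval_prodMk hy.1 hz.1),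
    (ae_restrict_iff' measurableSet_Icc).2 ?_⟩
  filter_upwards [hx.2, hy.2, hz.2] with t h1 h2 h3 ht
  refine ⟨x' t, y' t, ?_⟩
  rw [hor_eq]
  exact hasDerivAt_heis.2 ⟨h1 ht, h2 ht, h3 ht⟩

theorem HorCoord.curveLength_eq (hp : 1 < p) {γ : ℝ → Heis} {x' y' : ℝ → ℝ} {a b : ℝ}
    (hab : a ≤ b) (h : HorCoord γ x' y' a b) :
    curveLength p γ a b = ENNReal.ofReal (∫ t in a..b, lpn p (x' t) (y' t)) := by
  obtain ⟨hx, hy, hz⟩ := h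
  have hi := ACD.intervalIntegrable_lpn hp hab hx hy
  rw [intervalIntegral.integral_of_le hab, ofReal_integral_eq_lintegral_ofReal hi.1
    (Eventually.of_forall fun t => lpn_nonneg _ _ _), curveLength,
    restrict_Ioc_eq_restrict_Icc]
  refine setLIntegral_congr_fun_ae measurableSet_Icc ?_
  filter_upwards [hx.2, hy.2, hz.2] with t h1 h2 h3 ht
  have := (hasDerivAt_heis (γ := γ) (v := (x' t, y' t, _))).2 ⟨h1 ht, h2 ht, h3 ht⟩
  rw [this.deriv]
  rfl

/-! ### Geodesics -/

/-- The control is `r` times the dual of the point of angle `w t + θ`, for `w = 0` as well, since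
`dualAngle` encodes the same duality map. -/
theorem geodesic_hasDerivAt (hp : 1 < p) (hpq : 1 / p + 1 / q = 1) (r θ w t : ℝ) :
    HasDerivAt (fun t => (geodesic p q r θ w t).1) (r * phi q (cosp q (w * t + θ))) t ∧
    HasDerivAt (fun t => (geodesic p q r θ w t).2.1) (r * phi q (sinp q (w * t + θ))) t ∧
    HasDerivAt (fun t => (geodesic p q r θ w t).2.2)
      (((geodesic p q r θ w t).1 * (r * phi q (sinp q (w * t + θ))) -
        (geodesic p q r θ w t).2.1 * (r * phi q (cosp q (w * t + θ)))) / 2) t := by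
  have hq := one_lt_of_conj hp hpq
  by_cases hw : w = 0
  · obtain ⟨h1, h2⟩ := dualAngle_spec hp hpq θ
    simp only [geodesic, hw, if_true, h1, h2, zero_mul, zero_add]
    refine ⟨?_, ?_, ?_⟩
    · simpa using (hasDerivAt_id t).const_mul (r * phi q (cosp q θ))
    · simpa using (hasDerivAt_id t).const_mul (r * phi q (sinp q θ))
    · exact (hasDerivAt_const t (0 : ℝ)).congr_deriv (by ring)
  · have hl : HasDerivAt (fun t => w * t + θ) w t := by
      simpa using ((hasDerivAt_id t).const_mul w).add_const θ
    have hc := (hasDerivAt_trig hq (w * t + θ)).1.comp t hl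
    have hs := (hasDerivAt_trig hq (w * t + θ)).2.comp t hl
    have hlw : HasDerivAt (fun t => w * t) w t := by
      simpa using (hasDerivAt_id t).const_mul w
    simp only [geodesic, hw, if_false]
    refine ⟨?_, ?_, ?_⟩
    · refine ((hs.sub_const (sinp q θ)).const_mul (r / w)).congr_deriv ?_
      field_simp
    · refine ((hc.sub_const (cosp q θ)).const_mul (-(r / w))).congr_deriv ?_
      field_simp
    · refine (((hlw.add (hc.mul_const (sinp q θ))).sub (hs.mul_const (cosp q θ))).const_mul
        (r ^ 2 / (2 * w ^ 2))).congr_deriv ?_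
      have e1 := cosp_sinp_sphere hq (w * t + θ)
      rw [← phi_mul_self hq, ← phi_mul_self hq] at e1
      field_simp
      linear_combination -(r ^ 2) * e1

theorem continuous_control (hq : 1 < q) (r θ w : ℝ) :
    Continuous (fun t => r * phi q (cosp q (w * t + θ))) ∧
      Continuous (fun t => r * phi q (sinp q (w * t + θ))) := by
  have h : Continuous fun t : ℝ => w * t + θ := by fun_prop
  exact ⟨((continuous_phi hq).comp ((continuous_cosp hq).comp h)).const_mul r,
    ((continuous_phi hq).comp ((continuous_sinp hq).comp h)).const_mul r⟩

theorem continuous_geodesic (hp : 1 < p) (hpq : 1 / p + 1 / q = 1) (r θ w : ℝ) :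
    Continuous (geodesic p q r θ w) :=
  continuous_iff_continuousAt.2 fun t =>
    (hasDerivAt_heis.2 (geodesic_hasDerivAt hp hpq r θ w t :
      _ ∧ _ ∧ _)).continuousAt (f := geodesic p q r θ w) (f' := (_, _, _))

theorem geodesic_horCoord (hp : 1 < p) (hpq : 1 / p + 1 / q = 1) (r θ w : ℝ) {a b : ℝ}
    (hab : a ≤ b) : HorCoord (geodesic p q r θ w) (fun t => r * phi q (cosp q (w * t + θ)))
      (fun t => r * phi q (sinp q (w * t + θ))) a b := by
  have hq := one_lt_of_conj hp hpq
  obtain ⟨c1, c2⟩ := continuous_control hq r θ w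
  have c3 := continuous_geodesic hp hpq r θ w
  refine ⟨ACD.of_hasDerivAt (fun t => (geodesic_hasDerivAt hp hpq r θ w t).1) c1 hab,
    ACD.of_hasDerivAt (fun t => (geodesic_hasDerivAt hp hpq r θ w t).2.1) c2 hab,
    ACD.of_hasDerivAt (fun t => (geodesic_hasDerivAt hp hpq r θ w t).2.2) ?_ hab⟩
  exact ((c3.fst.mul c2).sub (c3.snd.fst.mul c1)).div_const 2

theorem lpn_phi (hp : 1 < p) (hpq : 1 / p + 1 / q = 1) {r : ℝ} (hr : 0 ≤ r) (θ : ℝ) :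
    lpn p (r * phi q (cosp q θ)) (r * phi q (sinp q θ)) = r := by
  rw [lpn_smul hp, abs_of_nonneg hr, lpn_eq_of_rpow hp zero_le_one, mul_one]
  rw [abs_phi_rpow hp hpq, abs_phi_rpow hp hpq, cosp_sinp_sphere (one_lt_of_conj hp hpq),
    Real.one_rpow]

@[simp] theorem geodesic_zero (p q r θ w : ℝ) : geodesic p q r θ w 0 = 0 := by
  unfold geodesic
  split_ifs <;> simp [mul_comm (sinp q θ)]

theorem geodesic_zero_left (p q θ w t : ℝ) : geodesic p q 0 θ w t = 0 := by
  unfold geodesic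
  split_ifs <;> simp

theorem curveLength_geodesic (hp : 1 < p) (hpq : 1 / p + 1 / q = 1) {r : ℝ} (hr : 0 ≤ r)
    (θ w : ℝ) {T : ℝ} (hT : 0 ≤ T) :
    curveLength p (geodesic p q r θ w) 0 T = ENNReal.ofReal (r * T) := by
  rw [(geodesic_horCoord hp hpq r θ w hT).curveLength_eq hp hT]
  simp only [lpn_phi hp hpq hr]
  rw [intervalIntegral.integral_const, sub_zero, smul_eq_mul, mul_comm]

/-- Change of the speed of a geodesic. -/
theorem geodesic_scale (p q r θ w : ℝ) {c : ℝ} (hc : c ≠ 0) (t : ℝ) :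
    geodesic p q (c * r) θ (c * w) t = geodesic p q r θ w (c * t) := by
  unfold geodesic
  by_cases hw : w = 0
  · simp only [hw, mul_zero, if_true]
    ext <;> simp <;> ring
  · have h1 : c * w ≠ 0 := mul_ne_zero hc hw
    have h3 : c * w * t = w * (c * t) := by ring
    have h4 : c * r / (c * w) = r / w := by field_simp
    have h5 : (c * r) ^ 2 / (2 * (c * w) ^ 2) = r ^ 2 / (2 * w ^ 2) := by field_simp
    simp only [hw, h1, if_false, h3, h4, h5]

/-- Dilations of geodesics. -/
theorem geodesic_dilate (p q c r θ w t : ℝ) :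
    geodesic p q (c * r) θ w t = (c * (geodesic p q r θ w t).1,
      c * (geodesic p q r θ w t).2.1, c ^ 2 * (geodesic p q r θ w t).2.2) := by
  unfold geodesic
  split_ifs
  · ext <;> simp only <;> ring
  · ext <;> simp only <;> ring

/-- Negating `y` and `z` preserves horizontality and length; this reduces `w < 0` and points of
negative height to the positive cases. -/
theorem geodesic_reflect (hp : 1 < p) (hpq : 1 / p + 1 / q = 1) (r θ w t : ℝ) :
    geodesic p q r (-θ) (-w) t = ((geodesic p q r θ w t).1, -(geodesic p q r θ w t).2.1,
      -(geodesic p q r θ w t).2.2) := by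
  have hq := one_lt_of_conj hp hpq
  unfold geodesic
  by_cases hw : w = 0
  · obtain ⟨h1, h2⟩ := dualAngle_spec hp hpq θ
    obtain ⟨h3, h4⟩ := dualAngle_spec hp hpq (-θ)
    rw [cosp_neg hq] at h3
    rw [sinp_neg hq, phi_neg] at h4
    simp only [hw, neg_zero, if_true, h1, h2, h3, h4]
    ext <;> simp
  · have e : -w * t + -θ = -(w * t + θ) := by ring
    simp only [hw, neg_eq_zero, if_false, e, cosp_neg hq, sinp_neg hq]
    ext
    · simp only; field_simp; ring
    · simp only; field_simp
    · simp only; field_simp; ring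

theorem geodesic_add_pip (hp : 1 < p) (hpq : 1 / p + 1 / q = 1) (r θ w t : ℝ) :
    geodesic p q r (θ + pip q) w t = (-(geodesic p q r θ w t).1, -(geodesic p q r θ w t).2.1,
      (geodesic p q r θ w t).2.2) := by
  have hq := one_lt_of_conj hp hpq
  unfold geodesic
  by_cases hw : w = 0
  · obtain ⟨h1, h2⟩ := dualAngle_spec hp hpq θ
    obtain ⟨h3, h4⟩ := dualAngle_spec hp hpq (θ + pip q)
    rw [cosp_add_pip hq, phi_neg] at h3
    rw [sinp_add_pip hq, phi_neg] at h4
    simp only [hw, if_true, h1, h2, h3, h4]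
    ext <;> simp
  · simp only [hw, if_false, ← add_assoc, cosp_add_pip hq, sinp_add_pip hq]
    ext <;> simp only <;> ring

/-- Geodesics depend only on the covector. -/
theorem geodesic_congr (hp : 1 < p) (hpq : 1 / p + 1 / q = 1) (r w t : ℝ) {θ θ' : ℝ}
    (hc : cosp q θ = cosp q θ') (hs : sinp q θ = sinp q θ') :
    geodesic p q r θ w t = geodesic p q r θ' w t := by
  have hq := one_lt_of_conj hp hpq
  obtain ⟨h5, h6⟩ := trig_add_eq hq hc hs (w * t)
  obtain ⟨h1, h2⟩ := dualAngle_spec hp hpq θ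
  obtain ⟨h3, h4⟩ := dualAngle_spec hp hpq θ'
  simp only [geodesic, h1, h2, h3, h4, h5, h6, hc, hs]

/-- `expMap` recovers `θ` only modulo `2 π_q`, which is enough by `geodesic_congr`. -/
theorem expMap_covector (hp : 1 < p) (hpq : 1 / p + 1 / q = 1) {r : ℝ} (hr : 0 < r)
    (θ w t : ℝ) : expMap p q t (covector q r θ w) = geodesic p q r θ w t := by
  have hq := one_lt_of_conj hp hpq
  obtain ⟨h1, h2⟩ := trig_lpAngle hq hr θ
  have h3 : (|r * cosp q θ| ^ q + |r * sinp q θ| ^ q) ^ (1 / q) = r := by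
    change lpn q _ _ = r
    rw [lpn_smul hq, abs_of_pos hr, lpn_eq_of_rpow hq zero_le_one, mul_one]
    rw [cosp_sinp_sphere hq, Real.one_rpow]
  unfold expMap covector
  simp only [h3]
  exact geodesic_congr hp hpq r w t h1 h2

theorem exists_covector (hp : 1 < p) (hpq : 1 / p + 1 / q = 1) (l : Covector)
    (hl : (l.1, l.2.1) ≠ (0, 0)) : ∃ r θ, 0 < r ∧ θ ∈ Ico 0 (2 * pip q) ∧
      l = covector q r θ l.2.2 := by
  have hq := one_lt_of_conj hp hpq
  have hr := lpn_pos hq hl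
  obtain ⟨θ, h1, h2, h3⟩ := exists_trig_eq hq (lpn_sphere hq hr)
  refine ⟨_, θ, hr, h1, ?_⟩
  rw [covector, h2, h3, mul_div_cancel₀ _ hr.ne', mul_div_cancel₀ _ hr.ne']

/-! ### Minimality of geodesics -/

theorem ACD.ae_deriv_eq {f f' g g' : ℝ → ℝ} {a b : ℝ} (hab : a ≤ b) (hf : ACD f f' a b)
    (hg : ACD g g' a b) (h : EqOn f g (Icc a b)) : ∀ᵐ t, t ∈ Icc a b → f' t = g' t := by
  filter_upwards [(hf.congr hab h).2, hg.2] with t h1 h2 ht using (h1 ht).unique (h2 ht)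

/-- A horizontal curve is determined by its projection to the plane. -/
theorem HorCoord.eq_geodesic_comp (hp : 1 < p) (hpq : 1 / p + 1 / q = 1) {η : ℝ → Heis}
    {x' y' τ τ' : ℝ → ℝ} {r θ w : ℝ} (h : HorCoord η x' y' 0 1) (h0 : η 0 = 0)
    (hτ : ACD τ τ' 0 1) (hτ0 : τ 0 = 0)
    (hx : ∀ t ∈ Icc (0 : ℝ) 1, (η t).1 = (geodesic p q r θ w (τ t)).1)
    (hy : ∀ t ∈ Icc (0 : ℝ) 1, (η t).2.1 = (geodesic p q r θ w (τ t)).2.1) :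
    ∀ t ∈ Icc (0 : ℝ) 1, η t = geodesic p q r θ w (τ t) := by
  obtain ⟨c1, c2⟩ := continuous_control (one_lt_of_conj hp hpq) r θ w
  have c3 := continuous_geodesic hp hpq r θ w
  have d1 := hτ.comp_global zero_le_one
    (fun t => (geodesic_hasDerivAt hp hpq r θ w t).1) c1
  have d2 := hτ.comp_global zero_le_one
    (fun t => (geodesic_hasDerivAt hp hpq r θ w t).2.1) c2
  have d3 := hτ.comp_global zero_le_one
    (fun t => (geodesic_hasDerivAt hp hpq r θ w t).2.2)
    (((c3.fst.mul c2).sub (c3.snd.fst.mul c1)).div_const 2)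
  have e1 := ACD.ae_deriv_eq zero_le_one h.1 d1 hx
  have e2 := ACD.ae_deriv_eq zero_le_one h.2.1 d2 hy
  have hz := h.2.2.congr_deriv (g' := fun t => ((geodesic p q r θ w (τ t)).1 *
      (r * phi q (sinp q (w * τ t + θ))) - (geodesic p q r θ w (τ t)).2.1 *
      (r * phi q (cosp q (w * τ t + θ)))) / 2 * τ' t) (by
    filter_upwards [e1, e2] with t h1 h2 ht
    rw [h1 ht, h2 ht, hx t ht, hy t ht]
    ring)
  have hzz := hz.eqOn_of_deriv_eq d3 (by simp [h0, hτ0])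
  intro t ht
  exact Prod.ext (hx t ht) (Prod.ext (hy t ht) (hzz ht))

theorem HorCoord.acd_length (hp : 1 < p) {η : ℝ → Heis} {x' y' : ℝ → ℝ} {r : ℝ}
    (h : HorCoord η x' y' 0 1) : ACD (fun t => (∫ s in (0 : ℝ)..t, lpn p (x' s) (y' s)) / r)
      (fun t => lpn p (x' t) (y' t) / r) 0 1 := by
  have h1 := (ACD.of_integral (ACD.intervalIntegrable_lpn hp zero_le_one h.1 h.2.1)
    zero_le_one 0).const_mul (1 / r)
  simpa [div_eq_inv_mul] using h1

/-- Dido's argument: the competitor is closed up with the unused part of the geodesic, and the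
equality case of the isoperimetric inequality applies to the closed projection. -/
theorem geodesic_minimal_pos (hp : 1 < p) (hpq : 1 / p + 1 / q = 1) {η : ℝ → Heis}
    {x' y' : ℝ → ℝ} {r θ w : ℝ} (hr : 0 < r) (hw : 0 < w) (hw2 : w ≤ 2 * pip q)
    (h : HorCoord η x' y' 0 1) (h0 : η 0 = 0) (h1 : η 1 = geodesic p q r θ w 1)
    (hL : ∫ t in (0 : ℝ)..1, lpn p (x' t) (y' t) ≤ r) :
    ∫ t in (0 : ℝ)..1, lpn p (x' t) (y' t) = r ∧ (w < 2 * pip q → ∀ t ∈ Icc (0 : ℝ) 1,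
      η t = geodesic p q r θ w ((∫ s in (0 : ℝ)..t, lpn p (x' s) (y' s)) / r)) := by
  have hq := one_lt_of_conj hp hpq
  set g := geodesic p q r θ w with hg
  set u : ℝ → ℝ := fun t => r * phi q (cosp q (w * t + θ)) with hu
  set v : ℝ → ℝ := fun t => r * phi q (sinp q (w * t + θ)) with hv
  -- The time at which the projected geodesic closes up; `w ≤ 2 π_q` means `T ≥ 1`.
  set T : ℝ := 2 * pip q / w with hTdef
  set ρ : ℝ := r / w with hρdef
  have hρ : 0 < ρ := div_pos hr hw
  have hwT : w * T = 2 * pip q := by rw [hTdef]; field_simp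
  have hT1 : 1 ≤ T := by rw [hTdef, le_div_iff₀ hw]; linarith
  have hT0 : 0 ≤ T := zero_le_one.trans hT1
  obtain ⟨gx, gy, gz⟩ := geodesic_horCoord hp hpq r θ w hT1
  have gform : ∀ t, (g t).1 = ρ * (sinp q (w * t + θ) - sinp q θ) ∧
      (g t).2.1 = -ρ * (cosp q (w * t + θ) - cosp q θ) := fun t => by
    simp only [hg, geodesic, hw.ne', if_false, hρdef]
    exact ⟨trivial, trivial⟩
  have gT : (g T).1 = 0 ∧ (g T).2.1 = 0 ∧ (g T).2.2 = pip q * ρ ^ 2 := by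
    have e : w * T + θ = θ + 2 * pip q := by rw [hwT]; ring
    refine ⟨?_, ?_, ?_⟩
    · rw [(gform T).1, e, sinp_add_two_pip hq, sub_self, mul_zero]
    · rw [(gform T).2, e, cosp_add_two_pip hq, sub_self, mul_zero]
    · have e1 : cosp q (2 * pip q + θ) = cosp q θ := by rw [add_comm, cosp_add_two_pip hq]
      have e2 : sinp q (2 * pip q + θ) = sinp q θ := by rw [add_comm, sinp_add_two_pip hq]
      simp only [hg, geodesic, hw.ne', if_false, hρdef, hwT, e1, e2]
      field_simp
      ring
  have key : ∀ f : Heis → ℝ, (if T ≤ 1 then f (η T) else f (g T)) = f (g T) := by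
    intro f
    split_ifs with hT
    · rw [le_antisymm hT hT1, h1]
    · rfl
  have hA := ACD.concat zero_le_one hT1 h.2.1.neg gy.neg (by rw [h1])
  have hB := ACD.concat zero_le_one hT1 h.1 gx (by rw [h1])
  have hZ := ACD.concat zero_le_one hT1 h.2.2 gz (by rw [h1])
  -- The quarter turn `(-y, x)` brings the projected geodesic to the form `ρ (cos_q, sin_q)` up to a
  -- translation.
  set a : ℝ → ℝ := fun t => if t ≤ 1 then -(η t).2.1 else -(g t).2.1 with ha
  set b : ℝ → ℝ := fun t => if t ≤ 1 then (η t).1 else (g t).1 with hb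
  set a' : ℝ → ℝ := fun t => if t ≤ 1 then -y' t else -v t with ha'
  set b' : ℝ → ℝ := fun t => if t ≤ 1 then x' t else u t with hb'
  have aT : a T = 0 := by
    have := key fun g => -g.2.1
    simp only [ha]; rw [this, gT.2.1, neg_zero]
  have bT : b T = 0 := by
    have := key fun g => g.1
    simp only [hb]; rw [this, gT.1]
  have a0 : a 0 = 0 := by simp [ha, h0]
  have b0 : b 0 = 0 := by simp [hb, h0]
  have hArea : ∫ t in (0 : ℝ)..T, (a t * b' t - b t * a' t) = 2 * pip q * ρ ^ 2 := by
    have e1 := hZ.integral_eq hT0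
    have e2 := key fun g => g.2.2
    rw [e2, gT.2.2] at e1
    simp only [zero_le_one, if_true, h0, Prod.snd_zero, sub_zero] at e1
    have e3 : ∀ t, a t * b' t - b t * a' t = 2 * (if t ≤ 1 then
        ((η t).1 * y' t - (η t).2.1 * x' t) / 2 else ((g t).1 * v t - (g t).2.1 * u t) / 2) := by
      intro t
      simp only [ha, hb, ha', hb']
      split_ifs <;> ring
    simp_rw [e3]
    rw [intervalIntegral.integral_const_mul, e1]
    ring
  have iL : IntervalIntegrable (fun t => lpn p (a' t) (b' t)) volume 0 T :=
    ACD.intervalIntegrable_lpn hp hT0 hA hB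
  have l1 : ∀ t ∈ Icc (0 : ℝ) 1, ∫ s in (0 : ℝ)..t, lpn p (a' s) (b' s) =
      ∫ s in (0 : ℝ)..t, lpn p (x' s) (y' s) := by
    intro t ht
    refine intervalIntegral.integral_congr_ae (Eventually.of_forall fun s hs => ?_)
    rw [uIoc_of_le ht.1] at hs
    simp only [ha', hb', hs.2.trans ht.2, if_true, lpn_neg_swap]
  have l2 : ∀ t ∈ Icc 1 T, ∫ s in (1 : ℝ)..t, lpn p (a' s) (b' s) = r * (t - 1) := by
    intro t ht
    have : ∫ s in (1 : ℝ)..t, lpn p (a' s) (b' s) = ∫ s in (1 : ℝ)..t, r := by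
      refine intervalIntegral.integral_congr_ae (Eventually.of_forall fun s hs => ?_)
      rw [uIoc_of_le ht.1] at hs
      simp only [ha', hb', not_le.2 hs.1, if_false, lpn_neg_swap, hu, hv]
      exact lpn_phi hp hpq hr.le _
    rw [this, intervalIntegral.integral_const, smul_eq_mul, mul_comm]
  have l3 : ∀ t ∈ Icc 1 T, ∫ s in (0 : ℝ)..t, lpn p (a' s) (b' s) =
      (∫ s in (0 : ℝ)..1, lpn p (x' s) (y' s)) + r * (t - 1) := by
    intro t ht
    rw [← l2 t ht, ← l1 1 ⟨zero_le_one, le_rfl⟩, intervalIntegral.integral_add_adjacent_intervals]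
    · exact iL.mono_set (by rw [uIcc_of_le hT0, uIcc_of_le zero_le_one]
                            exact Icc_subset_Icc_right hT1)
    · exact iL.mono_set (by rw [uIcc_of_le hT0, uIcc_of_le ht.1]
                            exact Icc_subset_Icc zero_le_one ht.2)
  have hrT : r * T = 2 * pip q * ρ := by rw [← hwT, hρdef]; field_simp
  have hLen : ∫ t in (0 : ℝ)..T, lpn p (a' t) (b' t) ≤ 2 * pip q * ρ := by
    rw [l3 T ⟨hT1, le_rfl⟩, ← hrT]; linarith
  obtain ⟨hLe, α, β, ψ, hpar⟩ := isoperimetric_param hp hpq hT0 hA hB (a0.trans aT.symm)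
    (b0.trans bT.symm) hρ hArea hLen
  have hLr : ∫ t in (0 : ℝ)..1, lpn p (x' t) (y' t) = r := by
    rw [l3 T ⟨hT1, le_rfl⟩, ← hrT] at hLe; linarith
  refine ⟨hLr, fun hw3 => ?_⟩
  have hT1' : 1 < T := by rw [hTdef, lt_div_iff₀ hw]; linarith
  have hρw : ∀ s, r * s / ρ = w * s := fun s => by rw [hρdef]; field_simp
  have hp1 : ∀ t ∈ Ioo 1 T, -(g t).2.1 = α + ρ * cosp q (w * t + ψ) ∧
      (g t).1 = β + ρ * sinp q (w * t + ψ) := by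
    intro t ht
    have e1 := hpar t ⟨zero_le_one.trans ht.1.le, ht.2.le⟩
    rw [l3 t ⟨ht.1.le, ht.2.le⟩, hLr, show r + r * (t - 1) = r * t by ring, hρw] at e1
    simpa only [ha, hb, not_le.2 ht.1, if_false, add_comm ψ] using e1
  -- For `w < 2 π_q` the added arc occupies the nonempty interval `(1, T)`. There the two
  -- descriptions of the circle agree: their derivatives at `t₀` give the phase `ψ`, and their
  -- values then give the centre.
  obtain ⟨t₀, ht₀⟩ := exists_between hT1'
  have hnear : ∀ᶠ t in 𝓝 t₀, t ∈ Ioo 1 T := Ioo_mem_nhds ht₀.1 ht₀.2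
  have hl : HasDerivAt (fun t => w * t + ψ) w t₀ := by
    simpa using ((hasDerivAt_id t₀).const_mul w).add_const ψ
  obtain ⟨gd1, gd2, -⟩ := geodesic_hasDerivAt hp hpq r θ w t₀
  have hc : sinp q (w * t₀ + θ) = sinp q (w * t₀ + ψ) := by
    have d1 := (((hasDerivAt_trig hq (w * t₀ + ψ)).1.comp t₀ hl).const_mul ρ).const_add α
    have d2 : HasDerivAt (fun t => α + ρ * cosp q (w * t + ψ)) _ t₀ :=
      gd2.neg.congr_of_eventuallyEq (hnear.mono fun t ht => (hp1 t ht).1.symm)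
    have := d1.unique d2
    apply (phi_strictMono hq).injective
    rw [hρdef] at this
    field_simp at this
    linarith
  have hs : cosp q (w * t₀ + θ) = cosp q (w * t₀ + ψ) := by
    have d1 := (((hasDerivAt_trig hq (w * t₀ + ψ)).2.comp t₀ hl).const_mul ρ).const_add β
    have d2 : HasDerivAt (fun t => β + ρ * sinp q (w * t + ψ)) _ t₀ :=
      gd1.congr_of_eventuallyEq (hnear.mono fun t ht => (hp1 t ht).2.symm)
    have := d1.unique d2
    apply (phi_strictMono hq).injective
    rw [hρdef] at this
    field_simp at this
    linarith
  have hψ : ∀ s, cosp q (ψ + s) = cosp q (s + θ) ∧ sinp q (ψ + s) = sinp q (s + θ) := by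
    intro s
    obtain ⟨e1, e2⟩ := trig_add_eq hq hs hc (s - w * t₀)
    rw [show s - w * t₀ + (w * t₀ + θ) = s + θ by ring,
      show s - w * t₀ + (w * t₀ + ψ) = ψ + s by ring] at e1 e2
    exact ⟨e1.symm, e2.symm⟩
  obtain ⟨hα, hβ⟩ := hp1 t₀ ht₀
  rw [(gform t₀).2, ← hs] at hα
  rw [(gform t₀).1, ← hc] at hβ
  have hα' : α = -ρ * cosp q θ := by linear_combination -hα
  have hβ' : β = -ρ * sinp q θ := by linear_combination -hβ
  refine h.eq_geodesic_comp hp hpq h0 (h.acd_length hp) (by simp) (fun t ht => ?_) fun t ht => ?_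
  all_goals
    obtain ⟨e1, e2⟩ := hpar t ⟨ht.1, ht.2.trans hT1⟩
    have e3 := hρw ((∫ s in (0 : ℝ)..t, lpn p (x' s) (y' s)) / r)
    rw [mul_div_cancel₀ _ hr.ne'] at e3
    rw [l1 t ht, e3, (hψ _).1] at e1
    rw [l1 t ht, e3, (hψ _).2] at e2
    simp only [ha, hb, ht.2, if_true] at e1 e2
  · rw [(gform _).1, e2, hβ']; ring
  · rw [(gform _).2]; linear_combination -e1 - hα'

/-- A calibration: the linear form with coefficients `(cos_q θ, sin_q θ)` has dual norm one and
integrates to `r` along every competitor. Equality in Hölder's inequality then forces all velocities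
into the direction of the segment. -/
theorem geodesic_minimal_zero (hp : 1 < p) (hpq : 1 / p + 1 / q = 1) {η : ℝ → Heis}
    {x' y' : ℝ → ℝ} {r θ : ℝ} (hr : 0 < r)
    (h : HorCoord η x' y' 0 1) (h0 : η 0 = 0) (h1 : η 1 = geodesic p q r θ 0 1)
    (hL : ∫ t in (0 : ℝ)..1, lpn p (x' t) (y' t) ≤ r) :
    ∫ t in (0 : ℝ)..1, lpn p (x' t) (y' t) = r ∧ ∀ t ∈ Icc (0 : ℝ) 1,
      η t = geodesic p q r θ 0 ((∫ s in (0 : ℝ)..t, lpn p (x' s) (y' s)) / r) := by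
  have hq := one_lt_of_conj hp hpq
  have hsph := cosp_sinp_sphere hq θ
  have gform : ∀ t, (geodesic p q r θ 0 t).1 = r * phi q (cosp q θ) * t ∧
      (geodesic p q r θ 0 t).2.1 = r * phi q (sinp q θ) * t := fun t => by
    obtain ⟨e1, e2⟩ := dualAngle_spec hp hpq θ
    simp only [geodesic, if_true, e1, e2]
    exact ⟨trivial, trivial⟩
  have ix := h.1.intervalIntegrable zero_le_one
  have iy := h.2.1.intervalIntegrable zero_le_one
  have iL := ACD.intervalIntegrable_lpn hp zero_le_one h.1 h.2.1
  have iW := (ix.const_mul (cosp q θ)).add (iy.const_mul (sinp q θ))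
  have hle : ∀ t, cosp q θ * x' t + sinp q θ * y' t ≤ lpn p (x' t) (y' t) := fun t => by
    simpa using holder_le hp hpq zero_le_one (hsph.trans (Real.one_rpow q).symm) (x' t) (y' t)
  have eW : ∫ t in (0 : ℝ)..1, (cosp q θ * x' t + sinp q θ * y' t) = r := by
    rw [intervalIntegral.integral_add (ix.const_mul _) (iy.const_mul _),
      intervalIntegral.integral_const_mul, intervalIntegral.integral_const_mul,
      h.1.integral_eq zero_le_one, h.2.1.integral_eq zero_le_one, h0, h1, (gform 1).1, (gform 1).2]
    rw [← phi_mul_self hq, ← phi_mul_self hq] at hsph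
    simp only [Prod.fst_zero, Prod.snd_zero]
    linear_combination r * hsph
  have hge := intervalIntegral.integral_mono_on zero_le_one iW iL fun t _ => hle t
  rw [eW] at hge
  have hLr := le_antisymm hL hge
  refine ⟨hLr, ?_⟩
  have hz : ∫ t in (0 : ℝ)..1,
      (lpn p (x' t) (y' t) - (cosp q θ * x' t + sinp q θ * y' t)) = 0 := by
    rw [intervalIntegral.integral_sub iL iW, eW, hLr, sub_self]
  rw [intervalIntegral.integral_eq_zero_iff_of_le_of_nonneg_ae zero_le_one
    (Eventually.of_forall fun t => sub_nonneg.2 (hle t)) (iL.sub iW)] at hz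
  have hz2 := (ae_restrict_iff' measurableSet_Ioc).1 hz
  have n0 : ∀ᵐ t : ℝ, t ≠ 0 := by simp [ae_iff, measure_singleton]
  have key : ∀ᵐ t, t ∈ Icc (0 : ℝ) 1 → x' t = lpn p (x' t) (y' t) * phi q (cosp q θ) ∧
      y' t = lpn p (x' t) (y' t) * phi q (sinp q θ) := by
    filter_upwards [hz2, n0] with t ht h0 hm
    have h5 := ht ⟨lt_of_le_of_ne hm.1 h0.symm, hm.2⟩
    simp only [Pi.zero_apply] at h5
    simpa using holder_eq hp hpq one_pos (hsph.trans (Real.one_rpow q).symm)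
      (s := x' t) (t := y' t) (by linarith)
  have hl := h.acd_length hp (r := r)
  have ex := h.1.eqOn_of_deriv_eq (g := fun t => r * phi q (cosp q θ) *
    ((∫ s in (0 : ℝ)..t, lpn p (x' s) (y' s)) / r)) ((hl.const_mul _).congr_deriv (by
      filter_upwards [key] with t h1 ht
      have := (h1 ht).1
      field_simp
      linarith)) (by simp [h0])
  have ey := h.2.1.eqOn_of_deriv_eq (g := fun t => r * phi q (sinp q θ) *
    ((∫ s in (0 : ℝ)..t, lpn p (x' s) (y' s)) / r)) ((hl.const_mul _).congr_deriv (by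
      filter_upwards [key] with t h1 ht
      have := (h1 ht).2
      field_simp
      linarith)) (by simp [h0])
  exact h.eq_geodesic_comp hp hpq h0 hl (by simp) (fun t ht => by rw [(gform _).1]; exact ex ht)
    fun t ht => by rw [(gform _).2]; exact ey ht

theorem HorCoord.reflect {η : ℝ → Heis} {x' y' : ℝ → ℝ} {a b : ℝ} (h : HorCoord η x' y' a b) :
    HorCoord (fun t => ((η t).1, -(η t).2.1, -(η t).2.2)) x' (fun t => -y' t) a b :=
  ⟨h.1, h.2.1.neg, h.2.2.neg.congr_deriv (Eventually.of_forall fun t _ => by ring)⟩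

/-- Geodesics with `|w| ≤ 2 π_q` are minimising, uniquely so if `|w| < 2 π_q`. -/
theorem geodesic_minimal (hp : 1 < p) (hpq : 1 / p + 1 / q = 1) {η : ℝ → Heis}
    {x' y' : ℝ → ℝ} {r θ w : ℝ} (hr : 0 < r) (hw : |w| ≤ 2 * pip q)
    (h : HorCoord η x' y' 0 1) (h0 : η 0 = 0) (h1 : η 1 = geodesic p q r θ w 1)
    (hL : ∫ t in (0 : ℝ)..1, lpn p (x' t) (y' t) ≤ r) :
    ∫ t in (0 : ℝ)..1, lpn p (x' t) (y' t) = r ∧ (|w| < 2 * pip q → ∀ t ∈ Icc (0 : ℝ) 1,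
      η t = geodesic p q r θ w ((∫ s in (0 : ℝ)..t, lpn p (x' s) (y' s)) / r)) := by
  rcases lt_trichotomy w 0 with hw0 | rfl | hw0
  · rw [abs_of_neg hw0] at hw ⊢
    have hlp : ∀ t, lpn p (x' t) (-y' t) = lpn p (x' t) (y' t) := fun t => by simp [lpn]
    have hm := geodesic_minimal_pos hp hpq (θ := -θ) hr (neg_pos.2 hw0) hw h.reflect
      (by simp only [h0, Prod.fst_zero, Prod.snd_zero, neg_zero]; rfl)
      (by rw [geodesic_reflect hp hpq, h1]) (by simpa only [hlp] using hL)
    simp only [hlp] at hm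
    refine ⟨hm.1, fun hw1 t ht => ?_⟩
    have e := hm.2 hw1 t ht
    rw [geodesic_reflect hp hpq] at e
    have e1 := congrArg Prod.fst e
    have e2 := congrArg (fun g : Heis => g.2.1) e
    have e3 := congrArg (fun g : Heis => g.2.2) e
    exact Prod.ext e1 (Prod.ext (neg_injective e2) (neg_injective e3))
  · have hm := geodesic_minimal_zero hp hpq hr h h0 h1 hL
    exact ⟨hm.1, fun _ => hm.2⟩
  · rw [abs_of_pos hw0] at hw ⊢
    exact geodesic_minimal_pos hp hpq hr hw0 hw h h0 h1 hL

/-! ### Joint continuity of geodesics -/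

/-- The integral forms, unlike the explicit formulas, have no singularity at `w = 0`; joint
continuity in the parameters is read off from them. -/
theorem geodesic_fst_eq_integral (hp : 1 < p) (hpq : 1 / p + 1 / q = 1) (r θ w t : ℝ) :
    (geodesic p q r θ w t).1 = ∫ s in (0 : ℝ)..t, r * phi q (cosp q (w * s + θ)) := by
  rw [intervalIntegral.integral_eq_sub_of_hasDerivAt
    (fun s _ => (geodesic_hasDerivAt hp hpq r θ w s).1)
    ((continuous_control (one_lt_of_conj hp hpq) r θ w).1.intervalIntegrable _ _)]
  simp

theorem geodesic_snd_eq_integral (hp : 1 < p) (hpq : 1 / p + 1 / q = 1) (r θ w t : ℝ) :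
    (geodesic p q r θ w t).2.1 = ∫ s in (0 : ℝ)..t, r * phi q (sinp q (w * s + θ)) := by
  rw [intervalIntegral.integral_eq_sub_of_hasDerivAt
    (fun s _ => (geodesic_hasDerivAt hp hpq r θ w s).2.1)
    ((continuous_control (one_lt_of_conj hp hpq) r θ w).2.intervalIntegrable _ _)]
  simp

theorem geodesic_thd_eq_integral (hp : 1 < p) (hpq : 1 / p + 1 / q = 1) (r θ w t : ℝ) :
    (geodesic p q r θ w t).2.2 = ∫ s in (0 : ℝ)..t,
      ((geodesic p q r θ w s).1 * (r * phi q (sinp q (w * s + θ))) -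
        (geodesic p q r θ w s).2.1 * (r * phi q (cosp q (w * s + θ)))) / 2 := by
  obtain ⟨c1, c2⟩ := continuous_control (one_lt_of_conj hp hpq) r θ w
  have c3 := continuous_geodesic hp hpq r θ w
  rw [intervalIntegral.integral_eq_sub_of_hasDerivAt
    (fun s _ => (geodesic_hasDerivAt hp hpq r θ w s).2.2)
    ((((c3.fst.mul c2).sub (c3.snd.fst.mul c1)).div_const 2).intervalIntegrable _ _)]
  simp

/-- Geodesics depend continuously on time and on all their parameters `(r, θ, w)`. -/
theorem continuous_geodesic_param (hp : 1 < p) (hpq : 1 / p + 1 / q = 1) :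
    Continuous fun a : (ℝ × ℝ × ℝ) × ℝ => geodesic p q a.1.1 a.1.2.1 a.1.2.2 a.2 := by
  have hq := one_lt_of_conj hp hpq
  have hl : Continuous fun b : (ℝ × ℝ × ℝ) × ℝ => b.1.2.2 * b.2 + b.1.2.1 := by fun_prop
  have hu : Continuous fun b : (ℝ × ℝ × ℝ) × ℝ =>
      b.1.1 * phi q (cosp q (b.1.2.2 * b.2 + b.1.2.1)) :=
    continuous_fst.fst.mul ((continuous_phi hq).comp ((continuous_cosp hq).comp hl))
  have hv : Continuous fun b : (ℝ × ℝ × ℝ) × ℝ =>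
      b.1.1 * phi q (sinp q (b.1.2.2 * b.2 + b.1.2.1)) :=
    continuous_fst.fst.mul ((continuous_phi hq).comp ((continuous_sinp hq).comp hl))
  have hc : ∀ {f : (ℝ × ℝ × ℝ) × ℝ → ℝ}, Continuous f →
      Continuous fun a : (ℝ × ℝ × ℝ) × ℝ => ∫ s in (0 : ℝ)..a.2, f (a.1, s) := by
    intro f hf
    exact intervalIntegral.continuous_parametric_intervalIntegral_of_continuous
      (f := fun (a : (ℝ × ℝ × ℝ) × ℝ) s => f (a.1, s))
      (hf.comp ((continuous_fst.comp continuous_fst).prodMk continuous_snd)) continuous_snd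
  have hX : Continuous fun a : (ℝ × ℝ × ℝ) × ℝ => (geodesic p q a.1.1 a.1.2.1 a.1.2.2 a.2).1 := by
    simp_rw [geodesic_fst_eq_integral hp hpq]
    exact hc hu
  have hY : Continuous fun a : (ℝ × ℝ × ℝ) × ℝ =>
      (geodesic p q a.1.1 a.1.2.1 a.1.2.2 a.2).2.1 := by
    simp_rw [geodesic_snd_eq_integral hp hpq]
    exact hc hv
  have hW := ((hX.mul hv).sub (hY.mul hu)).div_const 2
  have hZ : Continuous fun a : (ℝ × ℝ × ℝ) × ℝ =>
      (geodesic p q a.1.1 a.1.2.1 a.1.2.2 a.2).2.2 := by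
    simp_rw [geodesic_thd_eq_integral hp hpq]
    exact hc hW
  exact hX.prodMk (hY.prodMk hZ)

/-! ### The group law -/

/-- The group law of the Heisenberg group. -/
def mulH (g h : Heis) : Heis :=
  (g.1 + h.1, g.2.1 + h.2.1, g.2.2 + h.2.2 + (g.1 * h.2.1 - h.1 * g.2.1) / 2)

theorem mulH_neg_cancel_left (g h : Heis) : mulH (-g) (mulH g h) = h := by
  unfold mulH
  ext
  · simp
  · simp
  · simp only [Prod.fst_neg, Prod.snd_neg]; ring

theorem mulH_cancel_neg_left (g h : Heis) : mulH g (mulH (-g) h) = h := by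
  unfold mulH
  ext
  · simp
  · simp
  · simp only [Prod.fst_neg, Prod.snd_neg]; ring

theorem mulH_zero (g : Heis) : mulH g 0 = g := by
  unfold mulH
  ext <;> simp

theorem neg_mulH_self (g : Heis) : mulH (-g) g = 0 := by
  unfold mulH
  ext <;> simp

theorem continuous_mulH : Continuous fun a : Heis × Heis => mulH a.1 a.2 := by
  unfold mulH
  fun_prop

theorem HorCoord.mulH {γ : ℝ → Heis} {x' y' : ℝ → ℝ} {a b : ℝ} (h : HorCoord γ x' y' a b)
    (g : Heis) : HorCoord (fun t => mulH g (γ t)) x' y' a b := by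
  obtain ⟨hx, hy, hz⟩ := h
  refine ⟨?_, ?_, ?_⟩
  · simpa [LpHeisenberg.mulH] using (ACD.const g.1 a b).add hx
  · simpa [LpHeisenberg.mulH] using (ACD.const g.2.1 a b).add hy
  · have h1 := ((ACD.const g.2.2 a b).add hz).add
      (((hy.const_mul g.1).sub (hx.const_mul g.2.1)).const_mul (1 / 2))
    have h2 : (fun t => (LpHeisenberg.mulH g (γ t)).2.2) = fun t =>
        g.2.2 + (γ t).2.2 + 1 / 2 * (g.1 * (γ t).2.1 - g.2.1 * (γ t).1) := by
      funext t; simp only [LpHeisenberg.mulH]; ring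
    rw [h2]
    refine h1.congr_deriv (Eventually.of_forall fun t _ => ?_)
    simp only [LpHeisenberg.mulH]; ring

/-- Restarted at time `s`, a geodesic is a left translate of a geodesic from the origin with
advanced angle. With left invariance, distances along geodesics reduce to distances from the origin.
-/
theorem geodesic_add (hp : 1 < p) (hpq : 1 / p + 1 / q = 1) (r θ w s t : ℝ) :
    geodesic p q r θ w (s + t) =
      mulH (geodesic p q r θ w s) (geodesic p q r (w * s + θ) w t) := by
  by_cases hw : w = 0
  · obtain ⟨h1, h2⟩ := dualAngle_spec hp hpq θ
    simp only [geodesic, hw, if_true, h1, h2, mulH, zero_mul, zero_add]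
    ext <;> simp only <;> ring
  · have e : w * (s + t) + θ = w * t + (w * s + θ) := by ring
    simp only [geodesic, hw, if_false, mulH, e]
    ext
    · simp only; ring
    · simp only; ring
    · simp only
      field_simp
      ring

theorem geodesic_neg_time (hp : 1 < p) (hpq : 1 / p + 1 / q = 1) (r θ w t : ℝ) :
    geodesic p q r θ w (-t) = geodesic p q r (θ + pip q) (-w) t := by
  have h1 := geodesic_scale p q r θ w (c := -1) (by norm_num) t
  have h2 := geodesic_dilate p q (-1) r θ (-1 * w) t
  rw [neg_one_mul t] at h1
  rw [← h1, h2, geodesic_add_pip hp hpq]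
  simp

/-! ### The distance -/

theorem heisDist_le (hp : 1 < p) {γ : ℝ → Heis} {x' y' : ℝ → ℝ} (h : HorCoord γ x' y' 0 1) :
    heisDist p (γ 0) (γ 1) ≤ ENNReal.ofReal (∫ t in (0 : ℝ)..1, lpn p (x' t) (y' t)) := by
  rw [← h.curveLength_eq hp zero_le_one]
  exact iInf₂_le γ ⟨h.isHorizontal, rfl, rfl⟩

theorem le_heisDist (hp : 1 < p) {a b : Heis} {c : ENNReal}
    (h : ∀ (γ : ℝ → Heis) (x' y' : ℝ → ℝ), HorCoord γ x' y' 0 1 → γ 0 = a → γ 1 = b →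
      c ≤ ENNReal.ofReal (∫ t in (0 : ℝ)..1, lpn p (x' t) (y' t))) : c ≤ heisDist p a b := by
  refine le_iInf₂ fun γ hγ => ?_
  have h1 := hγ.1.horCoord
  rw [h1.curveLength_eq hp zero_le_one]
  exact h γ _ _ h1 hγ.2.1 hγ.2.2

theorem heisDist_mulH (hp : 1 < p) (g a b : Heis) :
    heisDist p (mulH g a) (mulH g b) = heisDist p a b := by
  have key : ∀ g a b : Heis, heisDist p (mulH g a) (mulH g b) ≤ heisDist p a b := by
    intro g a b
    refine le_heisDist hp fun γ x' y' h h0 h1 => ?_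
    have := heisDist_le hp (h.mulH g)
    simpa only [h0, h1] using this
  refine le_antisymm (key g a b) ?_
  have := key (-g) (mulH g a) (mulH g b)
  rwa [mulH_neg_cancel_left, mulH_neg_cancel_left] at this

theorem heisDist_self (hp : 1 < p) (g : Heis) : heisDist p g g = 0 := by
  have h : HorCoord (fun _ => g) (fun _ => 0) (fun _ => 0) 0 1 :=
    ⟨ACD.const _ _ _, ACD.const _ _ _,
      (ACD.const _ _ _).congr_deriv (Eventually.of_forall fun t _ => by ring)⟩
  have h1 := heisDist_le hp h
  have h2 : lpn p 0 0 = 0 := by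
    have := lpn_smul hp 0 0 0
    simpa using this
  simpa [h2] using h1

theorem heisDist_geodesic_one (hp : 1 < p) (hpq : 1 / p + 1 / q = 1) {r θ w : ℝ} (hr : 0 < r)
    (hw : |w| ≤ 2 * pip q) : heisDist p 0 (geodesic p q r θ w 1) = ENNReal.ofReal r := by
  refine le_antisymm ?_ (le_heisDist hp fun γ x' y' h h0 h1 => ?_)
  · have h := heisDist_le hp (geodesic_horCoord hp hpq r θ w zero_le_one)
    simp only [lpn_phi hp hpq hr.le] at h
    simpa using h
  · refine ENNReal.ofReal_le_ofReal ?_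
    by_contra! hlt
    have := (geodesic_minimal hp hpq hr hw h h0 h1 hlt.le).1
    linarith

theorem heisDist_geodesic_zero (hp : 1 < p) (hpq : 1 / p + 1 / q = 1) {r θ w t : ℝ} (hr : 0 < r)
    (ht : 0 < t) (hw : t * |w| ≤ 2 * pip q) :
    heisDist p 0 (geodesic p q r θ w t) = ENNReal.ofReal (t * r) := by
  have h1 := geodesic_scale p q r θ w ht.ne' 1
  rw [mul_one] at h1
  rw [← h1]
  exact heisDist_geodesic_one hp hpq (mul_pos ht hr) (by rwa [abs_mul, abs_of_pos ht])

theorem heisDist_geodesic (hp : 1 < p) (hpq : 1 / p + 1 / q = 1) {r θ w s t : ℝ} (hr : 0 < r)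
    (hw : |s - t| * |w| ≤ 2 * pip q) :
    heisDist p (geodesic p q r θ w s) (geodesic p q r θ w t) = ENNReal.ofReal (|s - t| * r) := by
  have h1 : geodesic p q r θ w t =
      mulH (geodesic p q r θ w s) (geodesic p q r (w * s + θ) w (t - s)) := by
    rw [← geodesic_add hp hpq, add_sub_cancel]
  have h2 : heisDist p (geodesic p q r θ w s) (geodesic p q r θ w t) =
      heisDist p 0 (geodesic p q r (w * s + θ) w (t - s)) := by
    rw [h1]
    nth_rewrite 1 [← mulH_zero (geodesic p q r θ w s)]
    rw [heisDist_mulH hp]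
  rw [h2]
  rcases lt_trichotomy s t with h | rfl | h
  · rw [abs_of_neg (by linarith)] at hw ⊢
    rw [show t - s = -(s - t) by ring, heisDist_geodesic_zero hp hpq hr (by linarith) hw]
  · simp [heisDist_self hp]
  · rw [abs_of_pos (by linarith)] at hw ⊢
    rw [show t - s = -(s - t) by ring, geodesic_neg_time hp hpq,
      heisDist_geodesic_zero hp hpq hr (by linarith) (by rwa [abs_neg])]

/-- Calibration by the constant covector dual to the normalised displacement: its coefficients are
`phi p` of the normalised coordinates. -/
theorem lpn_le_heisDist (hp : 1 < p) (hpq : 1 / p + 1 / q = 1) (a b : Heis) :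
    ENNReal.ofReal (lpn p (b.1 - a.1) (b.2.1 - a.2.1)) ≤ heisDist p a b := by
  have hq := one_lt_of_conj hp hpq
  have hqp : 1 / q + 1 / p = 1 := by linarith
  refine le_heisDist hp fun γ x' y' h h0 h1 => ENNReal.ofReal_le_ofReal ?_
  set L := lpn p (b.1 - a.1) (b.2.1 - a.2.1) with hL
  have iL := ACD.intervalIntegrable_lpn hp zero_le_one h.1 h.2.1
  rcases (lpn_nonneg p (b.1 - a.1) (b.2.1 - a.2.1)).eq_or_lt with h2 | h2
  · rw [hL, ← h2]
    exact intervalIntegral.integral_nonneg zero_le_one fun t _ => lpn_nonneg _ _ _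
  have hs := lpn_sphere hp h2
  rw [← hL] at hs h2
  have hsq := hs
  rw [← abs_phi_rpow hq hqp, ← abs_phi_rpow hq hqp] at hsq
  have ix := h.1.intervalIntegrable zero_le_one
  have iy := h.2.1.intervalIntegrable zero_le_one
  have hmono := intervalIntegral.integral_mono_on zero_le_one ((ix.const_mul _).add
    (iy.const_mul _)) iL fun t _ => by
      simpa using holder_le hp hpq zero_le_one (hsq.trans (Real.one_rpow q).symm) (x' t) (y' t)
  rw [intervalIntegral.integral_add (ix.const_mul _) (iy.const_mul _),
    intervalIntegral.integral_const_mul, intervalIntegral.integral_const_mul,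
    h.1.integral_eq zero_le_one, h.2.1.integral_eq zero_le_one, h0, h1] at hmono
  refine le_trans (le_of_eq ?_) hmono
  rw [← phi_mul_self hp, ← phi_mul_self hp] at hs
  field_simp at hs
  linarith

/-- Along a curve of length `L` from the origin, `x` and `y` are bounded by `L`, so the height
changes at rate at most `L` times the speed. The constant is not sharp; the quadratic order makes
the height differentiable along Lipschitz curves. -/
theorem sqrt_abs_le_heisDist (hp : 1 < p) (g : Heis) :
    ENNReal.ofReal (√|g.2.2|) ≤ heisDist p 0 g := by
  refine le_heisDist hp fun γ x' y' h h0 h1 => ENNReal.ofReal_le_ofReal ?_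
  set L := ∫ t in (0 : ℝ)..1, lpn p (x' t) (y' t) with hL
  have iL := ACD.intervalIntegrable_lpn hp zero_le_one h.1 h.2.1
  have hL0 : 0 ≤ L := intervalIntegral.integral_nonneg zero_le_one fun t _ => lpn_nonneg _ _ _
  have bound : ∀ {f f' : ℝ → ℝ}, ACD f f' 0 1 → f 0 = 0 → (∀ t, |f' t| ≤ lpn p (x' t) (y' t)) →
      ∀ t ∈ Icc (0 : ℝ) 1, |f t| ≤ L := by
    intro f f' hf hf0 hb t ht
    rw [hf.eq_add_integral ht, hf0, zero_add]
    have hi := (hf.mono le_rfl ht.1 ht.2).intervalIntegrable ht.1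
    have iLt : IntervalIntegrable (fun t => lpn p (x' t) (y' t)) volume 0 t :=
      iL.mono_set (by rw [uIcc_of_le zero_le_one, uIcc_of_le ht.1]
                      exact Icc_subset_Icc_right ht.2)
    calc |∫ s in (0 : ℝ)..t, f' s| ≤ ∫ s in (0 : ℝ)..t, |f' s| :=
          intervalIntegral.abs_integral_le_integral_abs ht.1
      _ ≤ ∫ s in (0 : ℝ)..t, lpn p (x' s) (y' s) :=
          intervalIntegral.integral_mono_on ht.1 hi.abs iLt fun s _ => hb s
      _ ≤ L := intervalIntegral.integral_mono_interval le_rfl ht.1 ht.2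
          (Eventually.of_forall fun s => lpn_nonneg _ _ _) iL
  have hx := bound h.1 (by simp [h0]) fun t => abs_fst_le_lpn hp _ _
  have hy := bound h.2.1 (by simp [h0]) fun t => abs_snd_le_lpn hp _ _
  have hz : |g.2.2| ≤ L ^ 2 := by
    have e := h.2.2.integral_eq zero_le_one
    rw [h0, h1, Prod.snd_zero, Prod.snd_zero, sub_zero] at e
    rw [← e]
    calc _ ≤ ∫ t in (0 : ℝ)..1, |((γ t).1 * y' t - (γ t).2.1 * x' t) / 2| :=
          intervalIntegral.abs_integral_le_integral_abs zero_le_one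
      _ ≤ ∫ t in (0 : ℝ)..1, L * lpn p (x' t) (y' t) := by
          refine intervalIntegral.integral_mono_on zero_le_one
            (h.2.2.intervalIntegrable zero_le_one).abs (iL.const_mul L) fun t ht => ?_
          have e1 : |(γ t).1 * y' t| ≤ L * lpn p (x' t) (y' t) := by
            rw [abs_mul]
            exact mul_le_mul (hx t ht) (abs_snd_le_lpn hp _ _) (abs_nonneg _) hL0
          have e2 : |(γ t).2.1 * x' t| ≤ L * lpn p (x' t) (y' t) := by
            rw [abs_mul]
            exact mul_le_mul (hy t ht) (abs_fst_le_lpn hp _ _) (abs_nonneg _) hL0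
          rw [abs_div, abs_two]
          have := abs_sub ((γ t).1 * y' t) ((γ t).2.1 * x' t)
          linarith
      _ = L ^ 2 := by rw [intervalIntegral.integral_const_mul, ← hL]; ring
  exact Real.sqrt_le_iff.2 ⟨hL0, hz⟩

/-! ### A geodesic determines its covector -/

/-- The speed gives `r`, the velocity gives the point of angle `w t + θ` by injectivity of `phi q`,
and differentiating this point gives `w`. This is done at the interior time `1 / 2`, where two-sided
derivatives are available. -/
theorem geodesic_param_unique (hp : 1 < p) (hpq : 1 / p + 1 / q = 1) {r r' θ θ' w w' : ℝ}
    (hr : 0 < r) (hr' : 0 < r')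
    (h : ∀ t ∈ Icc (0 : ℝ) 1, geodesic p q r θ w t = geodesic p q r' θ' w' t) :
    r = r' ∧ w = w' ∧ cosp q θ = cosp q θ' ∧ sinp q θ = sinp q θ' := by
  have hq := one_lt_of_conj hp hpq
  have hd : ∀ t ∈ Ioo (0 : ℝ) 1,
      r * phi q (cosp q (w * t + θ)) = r' * phi q (cosp q (w' * t + θ')) ∧
      r * phi q (sinp q (w * t + θ)) = r' * phi q (sinp q (w' * t + θ')) := by
    intro t ht
    have hn : ∀ᶠ s in 𝓝 t, s ∈ Icc (0 : ℝ) 1 := Icc_mem_nhds ht.1 ht.2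
    obtain ⟨a1, a2, -⟩ := geodesic_hasDerivAt hp hpq r θ w t
    obtain ⟨b1, b2, -⟩ := geodesic_hasDerivAt hp hpq r' θ' w' t
    exact ⟨a1.unique (b1.congr_of_eventuallyEq (hn.mono fun s hs => by simp only [h s hs])),
      a2.unique (b2.congr_of_eventuallyEq (hn.mono fun s hs => by simp only [h s hs]))⟩
  have hm : (1 / 2 : ℝ) ∈ Ioo (0 : ℝ) 1 := by norm_num
  have hrr : r = r' := by
    obtain ⟨h1, h2⟩ := hd _ hm
    rw [← lpn_phi hp hpq hr.le (w * (1 / 2) + θ), h1, h2, lpn_phi hp hpq hr'.le]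
  have he : ∀ t ∈ Ioo (0 : ℝ) 1, cosp q (w * t + θ) = cosp q (w' * t + θ') ∧
      sinp q (w * t + θ) = sinp q (w' * t + θ') := by
    intro t ht
    obtain ⟨h1, h2⟩ := hd t ht
    rw [← hrr] at h1 h2
    exact ⟨(phi_strictMono hq).injective (mul_left_cancel₀ hr.ne' h1),
      (phi_strictMono hq).injective (mul_left_cancel₀ hr.ne' h2)⟩
  obtain ⟨ec, es⟩ := he _ hm
  have hl : ∀ w θ : ℝ, HasDerivAt (fun t => w * t + θ) w (1 / 2) := fun w θ => by
    simpa using ((hasDerivAt_id (1 / 2 : ℝ)).const_mul w).add_const θ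
  have hn : ∀ᶠ s in 𝓝 (1 / 2 : ℝ), s ∈ Ioo (0 : ℝ) 1 := Ioo_mem_nhds hm.1 hm.2
  have dc := ((hasDerivAt_trig hq _).1.comp (1 / 2) (hl w θ)).unique
    (((hasDerivAt_trig hq _).1.comp (1 / 2) (hl w' θ')).congr_of_eventuallyEq
      (hn.mono fun s hs => (he s hs).1))
  have ds := ((hasDerivAt_trig hq _).2.comp (1 / 2) (hl w θ)).unique
    (((hasDerivAt_trig hq _).2.comp (1 / 2) (hl w' θ')).congr_of_eventuallyEq
      (hn.mono fun s hs => (he s hs).2))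
  rw [ec] at ds
  rw [es] at dc
  have hw : w = w' := by
    have hs := cosp_sinp_sphere hq (w' * (1 / 2) + θ')
    rw [← phi_mul_self hq, ← phi_mul_self hq] at hs
    linear_combination (w' - w) * hs + cosp q (w' * (1 / 2) + θ') * ds
      - sinp q (w' * (1 / 2) + θ') * dc
  subst hw
  obtain ⟨e1, e2⟩ := trig_add_eq hq ec es (-(w * (1 / 2)))
  simp only [neg_add_cancel_left] at e1 e2
  exact ⟨hrr, rfl, e1, e2⟩

/-- The first geodesic is a competitor of the second, of no greater length. As `w` is unrestricted,
this also rules out geodesics beyond the cut time. -/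
theorem geodesic_end_unique (hp : 1 < p) (hpq : 1 / p + 1 / q = 1) {r r' θ θ' w w' : ℝ}
    (hr : 0 < r) (hr' : 0 < r') (hw' : |w'| < 2 * pip q) (hle : r ≤ r')
    (h : geodesic p q r θ w 1 = geodesic p q r' θ' w' 1) :
    r = r' ∧ w = w' ∧ cosp q θ = cosp q θ' ∧ sinp q θ = sinp q θ' := by
  have hc := geodesic_horCoord hp hpq r θ w zero_le_one
  have hm := geodesic_minimal hp hpq hr' hw'.le hc (geodesic_zero _ _ _ _ _) h
    (by simpa only [lpn_phi hp hpq hr.le, intervalIntegral.integral_const, sub_zero, one_smul])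
  simp only [lpn_phi hp hpq hr.le, intervalIntegral.integral_const, sub_zero,
    smul_eq_mul] at hm
  obtain ⟨hrr, hu⟩ := hm
  rw [one_mul] at hrr
  refine geodesic_param_unique hp hpq hr hr' fun t ht => ?_
  rw [hu hw' t ht, hrr, mul_div_cancel_right₀ _ hr'.ne']

/-! ### Surjectivity of the exponential map -/

theorem phi_mul (q x y : ℝ) : phi q (x * y) = phi q x * phi q y := by
  rw [phi, abs_mul, Real.mul_rpow (abs_nonneg _) (abs_nonneg _), phi, phi]
  ring

theorem exists_continuous_inverse {f : ℝ → ℝ} {a b : ℝ} (hab : a ≤ b)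
    (hf : StrictMonoOn f (Icc a b)) (hc : ContinuousOn f (Icc a b)) :
    ∃ g : ℝ → ℝ, Continuous g ∧ ∀ s ∈ Icc (f a) (f b), g s ∈ Icc a b ∧ f (g s) = s := by
  have hm : MapsTo f (Icc a b) (Icc (f a) (f b)) := fun x hx =>
    ⟨hf.monotoneOn ⟨le_rfl, hab⟩ hx hx.1, hf.monotoneOn hx ⟨hab, le_rfl⟩ hx.2⟩
  have hbij : BijOn f (Icc a b) (Icc (f a) (f b)) :=
    ⟨hm, hf.injOn, intermediate_value_Icc hab hc⟩
  let e := hbij.equiv f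
  have hec : Continuous e := hc.mapsToRestrict hm
  let e' : Icc a b ≃ₜ Icc (f a) (f b) := hec.homeoOfEquivCompactToT2
  have hle : f a ≤ f b := hf.monotoneOn ⟨le_rfl, hab⟩ ⟨hab, le_rfl⟩ hab
  refine ⟨fun s => e'.symm (projIcc (f a) (f b) hle s),
    continuous_subtype_val.comp (e'.symm.continuous.comp continuous_projIcc), fun s hs =>
    ⟨(e'.symm _).2, ?_⟩⟩
  have h1 : e' (e'.symm (projIcc (f a) (f b) hle s)) = projIcc (f a) (f b) hle s :=
    e'.apply_symm_apply _
  have h2 := congrArg Subtype.val h1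
  rw [projIcc_of_mem hle hs] at h2
  simp only [projIcc_of_mem hle hs]
  exact h2

/-- Write `V₁ = phi q (R cos β)` and `V₂ = phi q (R sin β)`. At Euclidean angle `α` the derivative
of the linear functional then has the sign of `sin (β - α)`, so the functional increases over the
half turn from `β - π` to `β` and is critical at its end. -/
theorem exists_strictMonoOn_trig (hp : 1 < p) (hpq : 1 / p + 1 / q = 1) {V₁ V₂ : ℝ}
    (hV : (V₁, V₂) ≠ (0, 0)) : ∃ τ₀ : ℝ,
      StrictMonoOn (fun τ => V₁ * cosp q τ + V₂ * sinp q τ) (Icc τ₀ (τ₀ + pip q)) ∧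
      V₂ * phi q (cosp q (τ₀ + pip q)) - V₁ * phi q (sinp q (τ₀ + pip q)) = 0 := by
  have hq := one_lt_of_conj hp hpq
  have hqp : 1 / q + 1 / p = 1 := by linarith
  obtain ⟨R, hR, hm⟩ := exists_polar (v := (phi p V₁, phi p V₂)) (fun h => hV (by
    have h1 : phi p V₁ = phi p 0 := by rw [phi_zero]; exact congrArg Prod.fst h
    have h2 : phi p V₂ = phi p 0 := by rw [phi_zero]; exact congrArg Prod.snd h
    rw [(phi_strictMono hp).injective h1, (phi_strictMono hp).injective h2]))
  set β := euclAngle (phi p V₁, phi p V₂)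
  have m1 : phi p V₁ = R * Real.cos β := congrArg Prod.fst hm
  have m2 : phi p V₂ = R * Real.sin β := congrArg Prod.snd hm
  have hk : ∀ α, V₂ * phi q (cosp q (sweep q α)) - V₁ * phi q (sinp q (sweep q α)) =
      phi q (R * rad q α * (Real.sin β * Real.cos α)) -
        phi q (R * rad q α * (Real.cos β * Real.sin α)) := by
    intro α
    rw [cosp_sweep hq, sinp_sweep hq]
    nth_rewrite 1 [← phi_phi hq hqp V₂]
    nth_rewrite 1 [← phi_phi hq hqp V₁]
    rw [m1, m2, ← phi_mul, ← phi_mul]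
    congr 2 <;> ring
  have hτ : sweep q (β - π) + pip q = sweep q β := by
    rw [pip_eq_sweep hq, ← sweep_add_pi hq, sub_add_cancel]
  refine ⟨sweep q (β - π), ?_, ?_⟩
  · have hd : ∀ τ, HasDerivAt (fun τ => V₁ * cosp q τ + V₂ * sinp q τ)
        (V₂ * phi q (cosp q τ) - V₁ * phi q (sinp q τ)) τ := fun τ =>
      (((hasDerivAt_trig hq τ).1.const_mul V₁).add
        ((hasDerivAt_trig hq τ).2.const_mul V₂)).congr_deriv (by ring)
    refine strictMonoOn_of_deriv_pos (convex_Icc _ _)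
      (fun τ _ => (hd τ).continuousAt.continuousWithinAt) fun τ hτ2 => ?_
    rw [interior_Icc, hτ] at hτ2
    rw [(hd τ).deriv]
    obtain ⟨α, rfl⟩ := sweep_surjective hq τ
    rw [hk, sub_pos]
    have a1 := (sweep_strictMono hq).lt_iff_lt.1 hτ2.1
    have a2 := (sweep_strictMono hq).lt_iff_lt.1 hτ2.2
    have hs := Real.sin_pos_of_pos_of_lt_pi (x := β - α) (by linarith) (by linarith)
    rw [Real.sin_sub] at hs
    exact phi_strictMono hq (mul_lt_mul_of_pos_left (by linarith) (mul_pos hR (rad_pos q α)))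
  · rw [hτ, hk, mul_comm (Real.sin β), sub_self]

theorem geodesic_one_zero (hp : 1 < p) (hpq : 1 / p + 1 / q = 1) (r θ : ℝ) :
    geodesic p q r θ 0 1 = (r * phi q (cosp q θ), r * phi q (sinp q θ), 0) := by
  obtain ⟨e1, e2⟩ := dualAngle_spec hp hpq θ
  simp only [geodesic, if_true, e1, e2, mul_one]

theorem geodesic_loop (hq : 1 < q) (p r θ w : ℝ) (k : ℤ) (hk : k ≠ 0)
    (hw : w = k * (2 * pip q)) : geodesic p q r θ w 1 = (0, 0, r ^ 2 / (2 * w)) := by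
  have hpip := pip_pos hq
  have hw0 : w ≠ 0 := by
    rw [hw]
    exact mul_ne_zero (Int.cast_ne_zero.2 hk) (by linarith)
  have e1 : cosp q (w * 1 + θ) = cosp q θ := by
    rw [mul_one, hw, add_comm, cosp_add_int_mul hq]
  have e2 : sinp q (w * 1 + θ) = sinp q θ := by
    rw [mul_one, hw, add_comm, sinp_add_int_mul hq]
  simp only [geodesic, hw0, if_false, e1, e2]
  ext
  · simp
  · simp
  · simp only; field_simp; ring

theorem geodesic_one_ne_zero (hp : 1 < p) (hpq : 1 / p + 1 / q = 1) {r θ w : ℝ} (hr : 0 < r)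
    (hw : |w| ≤ 2 * pip q) : geodesic p q r θ w 1 ≠ 0 := by
  intro h
  have h1 := heisDist_geodesic_one hp hpq (θ := θ) hr hw
  rw [h, heisDist_self hp] at h1
  exact absurd (ENNReal.ofReal_eq_zero.1 h1.symm) (not_le.2 hr)

/-- The arc from angle `σ s` to `σ (-s) + π_q` has ends with the same value `s` of `k`, which makes
the endpoint's projection a multiple `c s` of `V`. As `s` runs from `-M` to `M`, the arc shrinks
from a full loop, where `c = 0` and the height is positive, to a segment, where the height is zero
and `c ≠ 0`. So height minus `z c²` changes sign; at a zero, dilation by `1 / c` reaches `(V₁, V₂,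
z)`. -/
theorem exists_geodesic_of_pos (hp : 1 < p) (hpq : 1 / p + 1 / q = 1) {V₁ V₂ z : ℝ}
    (hV : (V₁, V₂) ≠ (0, 0)) (hz : 0 < z) : ∃ r θ w : ℝ, 0 < r ∧ |w| < 2 * pip q ∧
      geodesic p q r θ w 1 = (V₁, V₂, z) := by
  have hq := one_lt_of_conj hp hpq
  have hpip := pip_pos hq
  obtain ⟨τ₀, hmono, hcrit⟩ := exists_strictMonoOn_trig hp hpq hV
  set k : ℝ → ℝ := fun τ => V₁ * cosp q τ + V₂ * sinp q τ with hk
  have hkc : Continuous k :=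
    ((continuous_cosp hq).const_mul V₁).add ((continuous_sinp hq).const_mul V₂)
  have hkp : ∀ τ, k (τ + pip q) = -k τ := fun τ => by
    simp only [hk, cosp_add_pip hq, sinp_add_pip hq]; ring
  have hab : τ₀ ≤ τ₀ + pip q := by linarith
  have ma : τ₀ ∈ Icc τ₀ (τ₀ + pip q) := ⟨le_rfl, hab⟩
  have mb : τ₀ + pip q ∈ Icc τ₀ (τ₀ + pip q) := ⟨hab, le_rfl⟩
  obtain ⟨σ, hσc, hσ⟩ := exists_continuous_inverse hab hmono hkc.continuousOn
  set M := k (τ₀ + pip q) with hM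
  have hM0 : k τ₀ = -M := by rw [hM, hkp, neg_neg]
  have hMpos : 0 < M := by
    have := hmono ma mb (by linarith)
    linarith
  rw [hM0] at hσ
  have hσM : σ M = τ₀ + pip q := by
    obtain ⟨h1, h2⟩ := hσ M ⟨by linarith, le_rfl⟩
    exact hmono.injOn h1 mb h2
  have hσM' : σ (-M) = τ₀ := by
    obtain ⟨h1, h2⟩ := hσ (-M) ⟨le_rfl, by linarith⟩
    exact hmono.injOn h1 ma (h2.trans hM0.symm)
  set w : ℝ → ℝ := fun s => σ (-s) + pip q - σ s with hw
  have hwc : Continuous w := ((hσc.comp continuous_neg).add continuous_const).sub hσc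
  set E : ℝ → Heis := fun s => geodesic p q 1 (σ s) (w s) 1 with hE
  have hEc : Continuous E := (continuous_geodesic_param hp hpq).comp
    ((continuous_const.prodMk (hσc.prodMk hwc)).prodMk continuous_const)
  have hneg : ∀ s ∈ Icc (-M) M, -s ∈ Icc (-M) M := fun s hs =>
    ⟨by linarith [hs.2], by linarith [hs.1]⟩
  have hw0 : ∀ s ∈ Icc (-M) M, 0 ≤ w s ∧ w s ≤ 2 * pip q := by
    intro s hs
    have h1 := (hσ s hs).1
    have h2 := (hσ (-s) (hneg s hs)).1
    simp only [hw]
    exact ⟨by linarith [h1.2, h2.1], by linarith [h1.1, h2.2]⟩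
  have horth : ∀ s ∈ Icc (-M) M, V₂ * (E s).1 = V₁ * (E s).2.1 := by
    intro s hs
    obtain ⟨m1, e1⟩ := hσ s hs
    obtain ⟨m2, e2⟩ := hσ (-s) (hneg s hs)
    -- For `w s = 0` the two half-turn bounds force `σ s = τ₀ + π_q`, and the segment is parallel to
    -- `V` because `k` is critical there.
    by_cases h0 : w s = 0
    · have : σ s = τ₀ + pip q := by
        simp only [hw] at h0
        linarith [m1.2, m2.1]
      simp only [hE]
      rw [h0, geodesic_one_zero hp hpq, this]
      simp only [one_mul]
      linarith
    · have e3 : w s * 1 + σ s = σ (-s) + pip q := by simp only [hw]; ring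
      have e4 : k (σ (-s) + pip q) = k (σ s) := by rw [hkp, e2, e1, neg_neg]
      simp only [hE, geodesic, h0, if_false, e3]
      simp only [hk] at e4
      field_simp
      linarith
  have hVV : 0 < V₁ ^ 2 + V₂ ^ 2 := by
    by_contra! h
    apply hV
    have h1 : V₁ = 0 := by nlinarith [sq_nonneg V₁, sq_nonneg V₂]
    have h2 : V₂ = 0 := by nlinarith [sq_nonneg V₁, sq_nonneg V₂]
    rw [h1, h2]
  set c : ℝ → ℝ := fun s => ((E s).1 * V₁ + (E s).2.1 * V₂) / (V₁ ^ 2 + V₂ ^ 2) with hc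
  have hcc : Continuous c :=
    ((hEc.fst.mul continuous_const).add (hEc.snd.fst.mul continuous_const)).div_const _
  have hcE : ∀ s ∈ Icc (-M) M, (E s).1 = c s * V₁ ∧ (E s).2.1 = c s * V₂ := by
    intro s hs
    have := horth s hs
    simp only [hc]
    constructor
    · field_simp; linear_combination V₂ * this
    · field_simp; linear_combination -V₁ * this
  set f : ℝ → ℝ := fun s => (E s).2.2 - z * c s ^ 2 with hf
  have hfc : Continuous f := hEc.snd.snd.sub ((hcc.pow 2).const_mul z)
  have hloop : ∀ s, w s = 2 * pip q → 0 < f s := by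
    intro s h
    have h1 := geodesic_loop hq p 1 (σ s) (w s) 1 one_ne_zero (by rw [h]; simp)
    simp only [hf, hc, hE, h1]
    rw [h]
    simp only [zero_mul, add_zero, zero_div]
    have : 0 < (1 : ℝ) ^ 2 / (2 * (2 * pip q)) := by positivity
    linarith
  have hline : ∀ s ∈ Icc (-M) M, w s = 0 → f s < 0 := by
    intro s hs h
    have h1 := geodesic_one_zero hp hpq 1 (σ s)
    have h2 : (E s).2.2 = 0 := by simp only [hE, h, h1]
    have h3 : c s ≠ 0 := by
      intro h3
      obtain ⟨h4, h5⟩ := hcE s hs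
      rw [h3, zero_mul] at h4 h5
      refine geodesic_one_ne_zero hp hpq (θ := σ s) (w := w s) one_pos ?_
        (Prod.ext h4 (Prod.ext h5 h2))
      rw [h, abs_zero]; linarith
    simp only [hf, h2]
    have := mul_pos hz (sq_pos_of_ne_zero h3)
    linarith
  have hf1 : 0 < f (-M) := hloop _ (by simp only [hw, neg_neg, hσM, hσM']; ring)
  have hf2 : f M < 0 := hline _ ⟨by linarith, le_rfl⟩ (by simp only [hw, hσM, hσM']; ring)
  obtain ⟨s, hs, hs0⟩ := intermediate_value_Icc' (by linarith : -M ≤ M) hfc.continuousOn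
    ⟨hf2.le, hf1.le⟩
  have hws : 0 < w s := lt_of_le_of_ne (hw0 s hs).1 fun h => by
    have := hline s hs h.symm; linarith
  have hws2 : w s < 2 * pip q := lt_of_le_of_ne (hw0 s hs).2 fun h => by
    have := hloop s h; linarith
  have habs : |w s| < 2 * pip q := by rwa [abs_of_pos hws]
  obtain ⟨hE1, hE2⟩ := hcE s hs
  have hE3 : (E s).2.2 = z * c s ^ 2 := by simp only [hf] at hs0; linarith
  have hcs : c s ≠ 0 := by
    intro h3
    rw [h3, zero_mul] at hE1 hE2
    rw [h3, zero_pow two_ne_zero, mul_zero] at hE3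
    exact geodesic_one_ne_zero hp hpq (θ := σ s) one_pos habs.le
      (Prod.ext hE1 (Prod.ext hE2 hE3))
  have hdil := geodesic_dilate p q (c s)⁻¹ 1 (σ s) (w s) 1
  change _ = ((c s)⁻¹ * (E s).1, (c s)⁻¹ * (E s).2.1, (c s)⁻¹ ^ 2 * (E s).2.2) at hdil
  rw [mul_one, hE1, hE2, hE3, inv_mul_cancel_left₀ hcs, inv_mul_cancel_left₀ hcs,
    show (c s)⁻¹ ^ 2 * (z * c s ^ 2) = z by field_simp] at hdil
  -- A negative dilation factor is made positive by adding `π_q` to the angle, which turns the plane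
  -- by `π`.
  rcases lt_or_gt_of_ne hcs with hneg | hpos
  · refine ⟨-(c s)⁻¹, σ s + pip q, w s, neg_pos.2 (inv_lt_zero.2 hneg), habs, ?_⟩
    have h := geodesic_dilate p q (-1) (c s)⁻¹ (σ s) (w s) 1
    rw [neg_one_mul, hdil] at h
    rw [geodesic_add_pip hp hpq, h]
    simp
  · exact ⟨(c s)⁻¹, σ s, w s, inv_pos.2 hpos, habs, hdil⟩

theorem exists_geodesic (hp : 1 < p) (hpq : 1 / p + 1 / q = 1) {g : Heis}
    (hg : (g.1, g.2.1) ≠ (0, 0)) : ∃ r θ w : ℝ, 0 < r ∧ |w| < 2 * pip q ∧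
      geodesic p q r θ w 1 = g := by
  have hq := one_lt_of_conj hp hpq
  have hqp : 1 / q + 1 / p = 1 := by linarith
  obtain ⟨V₁, V₂, z⟩ := g
  simp only at hg
  rcases lt_trichotomy z 0 with hz | rfl | hz
  · obtain ⟨r, θ, w, hr, hw, h⟩ := exists_geodesic_of_pos hp hpq (V₁ := V₁) (V₂ := -V₂) (z := -z)
      (fun h => hg (by
        have h1 := congrArg Prod.fst h
        have h2 := congrArg Prod.snd h
        simp only [neg_eq_zero] at h1 h2
        rw [h1, h2])) (neg_pos.2 hz)
    refine ⟨r, -θ, -w, hr, by rwa [abs_neg], ?_⟩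
    rw [geodesic_reflect hp hpq, h]
    simp
  · have hR := lpn_pos hp hg
    have hs := lpn_sphere hp hR
    rw [← abs_phi_rpow hq hqp, ← abs_phi_rpow hq hqp] at hs
    obtain ⟨θ, -, h1, h2⟩ := exists_trig_eq hq hs
    refine ⟨_, θ, 0, hR, by rw [abs_zero]; linarith [pip_pos hq], ?_⟩
    rw [geodesic_one_zero hp hpq, h1, h2, phi_phi hq hqp, phi_phi hq hqp,
      mul_div_cancel₀ _ hR.ne', mul_div_cancel₀ _ hR.ne']
  · exact exists_geodesic_of_pos hp hpq hg hz

/-! ### Cut times -/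

theorem exists_int_of_planar_zero (hp : 1 < p) (hpq : 1 / p + 1 / q = 1) {r θ w : ℝ} (hr : 0 < r)
    (h1 : (geodesic p q r θ w 1).1 = 0) (h2 : (geodesic p q r θ w 1).2.1 = 0) :
    ∃ k : ℤ, k ≠ 0 ∧ w = k * (2 * pip q) := by
  have hq := one_lt_of_conj hp hpq
  by_cases hw : w = 0
  · exact absurd (Prod.ext h1 (Prod.ext h2 (by rw [hw, geodesic_one_zero hp hpq]; rfl)))
      (geodesic_one_ne_zero hp hpq (θ := θ) (w := w) hr
        (by rw [hw, abs_zero]; linarith [pip_pos hq]))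
  · simp only [geodesic, hw, if_false, mul_eq_zero, neg_eq_zero, div_eq_zero_iff, hr.ne', or_self,
      false_or, mul_one, sub_eq_zero] at h1 h2
    obtain ⟨k, hk⟩ := exists_int_of_trig_eq hq h2 h1
    have hwk : w = k * (2 * pip q) := by linarith
    refine ⟨k, ?_, hwk⟩
    rintro rfl
    exact hw (by rw [hwk]; simp)

theorem isLengthMinimising_geodesic_iff (hp : 1 < p) (hpq : 1 / p + 1 / q = 1) {r θ w T : ℝ}
    (hr : 0 < r) (hT : 0 < T) :
    IsLengthMinimising p (geodesic p q r θ w) 0 T ↔ T * |w| ≤ 2 * pip q := by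
  have hq := one_lt_of_conj hp hpq
  have hpip := pip_pos hq
  unfold IsLengthMinimising
  rw [curveLength_geodesic hp hpq hr.le θ w hT.le, geodesic_zero]
  constructor
  · rintro ⟨-, h⟩
    by_contra! hlt
    have hR : 0 < T * r := mul_pos hT hr
    have hsc := geodesic_scale p q r θ w hT.ne' 1
    rw [mul_one] at hsc
    rw [← hsc, mul_comm r] at h
    by_cases hpl : ((geodesic p q (T * r) θ (T * w) 1).1,
        (geodesic p q (T * r) θ (T * w) 1).2.1) = (0, 0)
    · obtain ⟨k, hk0, hk⟩ := exists_int_of_planar_zero hp hpq hR (congrArg Prod.fst hpl)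
        (congrArg Prod.snd hpl)
      have hkpos : (0 : ℝ) < |(k : ℝ)| := abs_pos.2 (Int.cast_ne_zero.2 hk0)
      have hk1 : (1 : ℝ) < |(k : ℝ)| := by
        have e : T * |w| = |(k : ℝ)| * (2 * pip q) := by
          rw [← abs_of_pos hT, ← abs_mul, hk, abs_mul, abs_of_pos (by linarith : 0 < 2 * pip q)]
        rw [e] at hlt
        by_contra! hle
        nlinarith
      have hsign : (k : ℝ) = (k.sign : ℝ) * |(k : ℝ)| := by
        have := Int.sign_mul_abs k
        exact_mod_cast this.symm
      have hs0 : k.sign ≠ 0 := fun h => hk0 (Int.sign_eq_zero_iff_zero.1 h)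
      have hs1 : |(k.sign : ℝ)| = 1 := by
        have := Int.abs_sign_of_ne_zero hk0
        exact_mod_cast this
      have hsq : 0 < √|(k : ℝ)| := Real.sqrt_pos.2 hkpos
      have hs0' : (k.sign : ℝ) ≠ 0 := Int.cast_ne_zero.2 hs0
      have e1 := geodesic_loop hq p (T * r) θ (T * w) k hk0 hk
      -- A single loop reaching the same height as the `|k|` loops; its length is smaller by the
      -- factor `√|k| > 1`.
      have e2 := geodesic_loop hq p (T * r / √|(k : ℝ)|) θ ((k.sign : ℝ) * (2 * pip q)) k.sign
        hs0 rfl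
      have e3 : (T * r) ^ 2 / (2 * (T * w)) =
          (T * r / √|(k : ℝ)|) ^ 2 / (2 * ((k.sign : ℝ) * (2 * pip q))) := by
        rw [hk, div_pow, Real.sq_sqrt hkpos.le, hsign, abs_mul, hs1, one_mul, abs_abs]
        field_simp
      have e4 := heisDist_geodesic_one hp hpq (r := T * r / √|(k : ℝ)|) (θ := θ)
        (w := (k.sign : ℝ) * (2 * pip q)) (div_pos hR hsq)
        (by rw [abs_mul, hs1, one_mul, abs_of_pos (by linarith)])
      rw [e2, ← e3, ← e1, ← h, ENNReal.ofReal_eq_ofReal_iff hR.le (div_pos hR hsq).le,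
        eq_div_iff hsq.ne'] at e4
      have e5 : √|(k : ℝ)| = 1 := by
        have : T * r * (√|(k : ℝ)| - 1) = 0 := by linarith
        rcases mul_eq_zero.1 this with h6 | h6
        · exact absurd h6 hR.ne'
        · linarith
      rw [Real.sqrt_eq_one] at e5
      linarith
    -- Off the axis there is a minimiser with `|w'| < 2 π_q` to the same endpoint. Equal lengths
    -- would force `w' = T w` by uniqueness.
    · obtain ⟨r', θ', w', hr', hw', he⟩ := exists_geodesic hp hpq hpl
      have e1 := heisDist_geodesic_one hp hpq (θ := θ') hr' hw'.le
      rw [he, ← h, ENNReal.ofReal_eq_ofReal_iff hR.le hr'.le] at e1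
      obtain ⟨-, e2, -⟩ := geodesic_end_unique hp hpq hR hr' hw' e1.le he.symm
      rw [← e2, abs_mul, abs_of_pos hT] at hw'
      linarith
  · intro h
    refine ⟨(geodesic_horCoord hp hpq r θ w hT.le).isHorizontal, ?_⟩
    rw [heisDist_geodesic_zero hp hpq hr hT h, mul_comm]

theorem expMap_covector_fun (hp : 1 < p) (hpq : 1 / p + 1 / q = 1) {r : ℝ} (hr : 0 < r)
    (θ w : ℝ) : (fun t => expMap p q t (covector q r θ w)) = geodesic p q r θ w :=
  funext fun t => expMap_covector hp hpq hr θ w t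

theorem cutTime_covector (hp : 1 < p) (hpq : 1 / p + 1 / q = 1) {r θ w : ℝ} (hr : 0 < r) :
    cutTime p q (covector q r θ w) = ENNReal.ofReal (2 * pip q) / ENNReal.ofReal |w| := by
  have hpip := pip_pos (one_lt_of_conj hp hpq)
  have hset : {T : ℝ | 0 < T ∧ IsLengthMinimising p
      (fun t => expMap p q t (covector q r θ w)) 0 T} = {T : ℝ | 0 < T ∧ T * |w| ≤ 2 * pip q} := by
    ext T
    refine and_congr_right fun hT => ?_
    rw [expMap_covector_fun hp hpq hr, isLengthMinimising_geodesic_iff hp hpq hr hT]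
  unfold cutTime
  rw [hset]
  by_cases hw : w = 0
  · rw [hw, abs_zero, ENNReal.ofReal_zero, ENNReal.div_zero
      (ENNReal.ofReal_pos.2 (by linarith)).ne']
    refine ENNReal.eq_top_of_forall_nnreal_le fun x => ?_
    refine le_iSup₂_of_le ((x : ℝ) + 1) ⟨by positivity, by rw [mul_zero]; linarith⟩ ?_
    rw [← ENNReal.ofReal_coe_nnreal]
    exact ENNReal.ofReal_le_ofReal (by linarith)
  · have hw' := abs_pos.2 hw
    rw [← ENNReal.ofReal_div_of_pos hw']
    refine le_antisymm (iSup₂_le fun T hT => ENNReal.ofReal_le_ofReal ?_) ?_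
    · rw [le_div_iff₀ hw']; exact hT.2
    · exact le_iSup₂_of_le (2 * pip q / |w|)
        ⟨by positivity, (div_mul_cancel₀ _ hw'.ne').le⟩ le_rfl

/-! ### The cotangent injectivity domain -/

theorem HorCoord.lengthParam_mem (hp : 1 < p) {η : ℝ → Heis} {x' y' : ℝ → ℝ} {r : ℝ} (hr : 0 < r)
    (h : HorCoord η x' y' 0 1) (hL : ∫ t in (0 : ℝ)..1, lpn p (x' t) (y' t) = r) :
    MonotoneOn (fun t => (∫ s in (0 : ℝ)..t, lpn p (x' s) (y' s)) / r) (Icc 0 1) ∧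
      ∀ t ∈ Icc (0 : ℝ) 1, (∫ s in (0 : ℝ)..t, lpn p (x' s) (y' s)) / r ∈ Icc (0 : ℝ) 1 := by
  have iL := ACD.intervalIntegrable_lpn hp zero_le_one h.1 h.2.1
  have hm : MonotoneOn (fun t => (∫ s in (0 : ℝ)..t, lpn p (x' s) (y' s)) / r) (Icc 0 1) := by
    intro s hs t ht hst
    refine div_le_div_of_nonneg_right ?_ hr.le
    exact intervalIntegral.integral_mono_interval le_rfl hs.1 hst
      (Eventually.of_forall fun u => lpn_nonneg _ _ _)
      (iL.mono_set (by rw [uIcc_of_le zero_le_one, uIcc_of_le ht.1]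
                       exact Icc_subset_Icc_right ht.2))
  refine ⟨hm, fun t ht => ⟨?_, ?_⟩⟩
  · have := hm ⟨le_rfl, zero_le_one⟩ ht ht.1
    simpa using this
  · have := hm ht ⟨zero_le_one, le_rfl⟩ ht.2
    simpa only [hL, div_self hr.ne'] using this

theorem expMap_of_planar_zero (hq : 1 < q) (p t w : ℝ) : expMap p q t (0, 0, w) = 0 := by
  have h : (|(0 : ℝ)| ^ q + |(0 : ℝ)| ^ q) ^ (1 / q) = 0 := by
    rw [abs_zero, Real.zero_rpow (by linarith), add_zero, Real.zero_rpow (by positivity)]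
  unfold expMap
  simp only [h]
  exact geodesic_zero_left _ _ _ _ _

theorem covector_mem_cotangentInjectivityDomain (hp : 1 < p) (hpq : 1 / p + 1 / q = 1)
    {r θ w : ℝ} (hr : 0 < r) (hw : |w| < 2 * pip q) :
    covector q r θ w ∈ cotangentInjectivityDomain p q := by
  have he := expMap_covector hp hpq hr θ w
  refine ⟨⟨1, ⟨zero_le_one, le_rfl⟩, ?_⟩, ?_, fun η hη h0 h1 => ?_⟩
  · rw [he, he, geodesic_zero]
    exact geodesic_one_ne_zero hp hpq hr hw.le
  · rw [expMap_covector_fun hp hpq hr, isLengthMinimising_geodesic_iff hp hpq hr one_pos, one_mul]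
    exact hw.le
  · rw [he, geodesic_zero] at h0
    rw [he] at h1
    have hc := hη.1.horCoord
    have hlen := hη.2
    rw [hc.curveLength_eq hp zero_le_one, h0, h1, heisDist_geodesic_one hp hpq hr hw.le,
      ENNReal.ofReal_eq_ofReal_iff (intervalIntegral.integral_nonneg zero_le_one
        fun t _ => lpn_nonneg _ _ _) hr.le] at hlen
    have hm := (geodesic_minimal hp hpq hr hw.le hc h0 h1 hlen.le).2 hw
    refine ⟨_, (hc.acd_length hp (r := r)).continuousOn, (hc.lengthParam_mem hp hr hlen).1, ?_, ?_,
      fun t ht => ?_⟩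
    · simp
    · rw [hlen, div_self hr.ne']
    · rw [he]; exact hm t ht

/-- Minimality gives `|w| ≤ 2 π_q`, and non-constancy gives `r > 0`. When `|w| = 2 π_q`, the loop
with angle `θ + π_q` is another minimiser with the same endpoint. -/
theorem cotangentInjectivityDomain_eq (hp : 1 < p) (hpq : 1 / p + 1 / q = 1) :
    cotangentInjectivityDomain p q = domainD q := by
  have hq := one_lt_of_conj hp hpq
  have hpip := pip_pos hq
  apply Subset.antisymm
  · rintro l ⟨⟨t, ht, hne⟩, hmin, huniq⟩
    have hl : (l.1, l.2.1) ≠ (0, 0) := by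
      intro h
      have h1 : l.1 = 0 := congrArg Prod.fst h
      have h2 : l.2.1 = 0 := congrArg Prod.snd h
      have e : l = (0, 0, l.2.2) := Prod.ext h1 (Prod.ext h2 rfl)
      rw [e, expMap_of_planar_zero hq, expMap_of_planar_zero hq] at hne
      exact hne rfl
    obtain ⟨r, θ, hr, -, he⟩ := exists_covector hp hpq l hl
    obtain ⟨w, hw⟩ : ∃ w, w = l.2.2 := ⟨_, rfl⟩
    rw [← hw] at he
    subst he
    rw [expMap_covector_fun hp hpq hr, isLengthMinimising_geodesic_iff hp hpq hr one_pos,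
      one_mul] at hmin
    refine ⟨r, θ, w, hr, lt_of_le_of_ne hmin fun hwe => ?_, rfl⟩
    have hloop : ∃ k : ℤ, k ≠ 0 ∧ w = k * (2 * pip q) := by
      rcases abs_choice w with h | h
      · exact ⟨1, one_ne_zero, by rw [← hwe, h]; simp⟩
      · exact ⟨-1, by norm_num, by rw [← hwe, h]; simp⟩
    obtain ⟨k, hk0, hk⟩ := hloop
    have hη : IsLengthMinimising p (geodesic p q r (θ + pip q) w) 0 1 :=
      (isLengthMinimising_geodesic_iff hp hpq hr one_pos).2 (by rw [one_mul]; exact hmin)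
    simp only [expMap_covector hp hpq hr] at huniq
    obtain ⟨φ, -, hφm, hφ0, hφ1, hφ⟩ := huniq _ hη (by simp)
      (by rw [geodesic_loop hq p r θ w k hk0 hk, geodesic_loop hq p r _ w k hk0 hk])
    -- Both loops have distance `t r` from the origin at time `t`, so a reparametrisation between
    -- them is the identity; then `θ` and `θ + π_q` would give the same covector.
    have hid : ∀ t ∈ Icc (0 : ℝ) 1, φ t = t := by
      intro t ht
      have b0 : 0 ≤ φ t := hφ0 ▸ hφm ⟨le_rfl, zero_le_one⟩ ht ht.1
      have b1 : φ t ≤ 1 := hφ1 ▸ hφm ht ⟨zero_le_one, le_rfl⟩ ht.2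
      have key : ∀ (θ : ℝ) (s : ℝ), 0 ≤ s → s ≤ 1 →
          heisDist p 0 (geodesic p q r θ w s) = ENNReal.ofReal (s * r) := by
        intro θ s hs0 hs1
        have := heisDist_geodesic hp hpq (θ := θ) (w := w) (s := 0) (t := s) hr (by
          rw [zero_sub, abs_neg, abs_of_nonneg hs0, hwe]; nlinarith)
        rwa [geodesic_zero, zero_sub, abs_neg, abs_of_nonneg hs0] at this
      have e := key (θ + pip q) t ht.1 ht.2
      rw [hφ t ht, key θ _ b0 b1, ENNReal.ofReal_eq_ofReal_iff (mul_nonneg b0 hr.le)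
        (mul_nonneg ht.1 hr.le)] at e
      exact mul_right_cancel₀ hr.ne' e
    obtain ⟨-, -, hC, hS⟩ := geodesic_param_unique hp hpq hr hr
      fun t ht => (hφ t ht).trans (by rw [hid t ht])
    rw [cosp_add_pip hq] at hC
    rw [sinp_add_pip hq] at hS
    have hs := cosp_sinp_sphere hq θ
    rw [show cosp q θ = 0 by linarith, show sinp q θ = 0 by linarith, abs_zero,
      Real.zero_rpow (by linarith)] at hs
    norm_num at hs
  · rintro l ⟨r, θ, w, hr, hw, rfl⟩
    exact covector_mem_cotangentInjectivityDomain hp hpq hr hw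

/-! ### The exponential map is a homeomorphism onto its image -/

theorem exists_angle (hq : 1 < q) (l : Covector) :
    ∃ θ ∈ Icc 0 (2 * pip q), l = covector q (lpn q l.1 l.2.1) θ l.2.2 := by
  rcases (lpn_nonneg q l.1 l.2.1).eq_or_lt with hr | hr
  · obtain ⟨h1, h2⟩ := lpn_eq_zero hq hr.symm
    refine ⟨0, ⟨le_rfl, by linarith [pip_pos hq]⟩, ?_⟩
    rw [covector, ← hr, zero_mul, zero_mul]
    exact Prod.ext h1 (Prod.ext h2 rfl)
  · obtain ⟨θ, h1, h2, h3⟩ := exists_trig_eq hq (lpn_sphere hq hr)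
    refine ⟨θ, Ico_subset_Icc_self h1, ?_⟩
    rw [covector, h2, h3, mul_div_cancel₀ _ hr.ne', mul_div_cancel₀ _ hr.ne']

theorem expMap_covector_of_nonneg (hp : 1 < p) (hpq : 1 / p + 1 / q = 1) {r : ℝ} (hr : 0 ≤ r)
    (θ w t : ℝ) : expMap p q t (covector q r θ w) = geodesic p q r θ w t := by
  rcases hr.eq_or_lt with rfl | hr
  · rw [covector, zero_mul, zero_mul, expMap_of_planar_zero (one_lt_of_conj hp hpq),
      geodesic_zero_left]
  · exact expMap_covector hp hpq hr θ w t

theorem continuous_covector (hq : 1 < q) :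
    Continuous fun a : ℝ × ℝ × ℝ => covector q a.1 a.2.1 a.2.2 := by
  have h1 := continuous_cosp hq
  have h2 := continuous_sinp hq
  unfold covector
  fun_prop

/-- The angle of a covector jumps across the positive axis and is undefined at zero. Angles lie in a
compact interval, so along a subsequence they converge to an angle of the limit covector, and
`continuous_geodesic_param` applies. -/
theorem continuous_expMap (hp : 1 < p) (hpq : 1 / p + 1 / q = 1) :
    Continuous fun a : ℝ × Covector => expMap p q a.1 a.2 := by
  have hq := one_lt_of_conj hp hpq
  choose T hT hl using exists_angle hq
  rw [continuous_iff_continuousAt]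
  rintro ⟨t, l⟩
  refine tendsto_of_subseq_tendsto fun u hu => ?_
  obtain ⟨θ, -, φ, hφ, hθ⟩ := isCompact_Icc.tendsto_subseq fun n => hT (u n).2
  refine ⟨φ, ?_⟩
  have hu' := hu.comp hφ.tendsto_atTop
  have h1 : Tendsto (fun n => (u (φ n)).1) atTop (𝓝 t) := (continuous_fst.tendsto _).comp hu'
  have h2 : Tendsto (fun n => (u (φ n)).2) atTop (𝓝 l) := (continuous_snd.tendsto _).comp hu'
  have hr : Tendsto (fun n => lpn q (u (φ n)).2.1 (u (φ n)).2.2.1) atTop (𝓝 (lpn q l.1 l.2.1)) :=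
    (((continuous_lpn hq).comp (continuous_fst.prodMk
      (continuous_fst.comp continuous_snd))).tendsto l).comp h2
  have hw : Tendsto (fun n => (u (φ n)).2.2.2) atTop (𝓝 l.2.2) :=
    ((continuous_snd.comp continuous_snd).tendsto l).comp h2
  have ha := hr.prodMk_nhds (hθ.prodMk_nhds hw)
  have e : l = covector q (lpn q l.1 l.2.1) θ l.2.2 := by
    refine tendsto_nhds_unique h2 ((((continuous_covector hq).tendsto _).comp ha).congr fun n => ?_)
    exact (hl _).symm
  have e1 : expMap p q t l = geodesic p q (lpn q l.1 l.2.1) θ l.2.2 t := by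
    conv_lhs => rw [e]
    exact expMap_covector_of_nonneg hp hpq (lpn_nonneg _ _ _) _ _ _
  have e2 := ((continuous_geodesic_param hp hpq).tendsto _).comp (ha.prodMk_nhds h1)
  change Tendsto _ _ (𝓝 (expMap p q t l))
  rw [e1]
  refine e2.congr fun n => ?_
  change geodesic p q _ (T (u (φ n)).2) _ _ = expMap p q _ _
  conv_rhs => rw [hl (u (φ n)).2]
  exact (expMap_covector_of_nonneg hp hpq (lpn_nonneg _ _ _) _ _ _).symm

theorem mem_domainD_iff (hq : 1 < q) (l : Covector) :
    l ∈ domainD q ↔ 0 < lpn q l.1 l.2.1 ∧ |l.2.2| < 2 * pip q := by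
  constructor
  · rintro ⟨r, θ, w, hr, hw, rfl⟩
    refine ⟨?_, hw⟩
    change 0 < lpn q (r * cosp q θ) (r * sinp q θ)
    rw [lpn_smul hq, abs_of_pos hr, lpn, cosp_sinp_sphere hq, Real.one_rpow, mul_one]
    exact hr
  · rintro ⟨hr, hw⟩
    obtain ⟨θ, -, h⟩ := exists_angle hq l
    exact ⟨_, θ, _, hr, hw, h⟩

theorem injOn_expMap (hp : 1 < p) (hpq : 1 / p + 1 / q = 1) :
    InjOn (expMap p q 1) (domainD q) := by
  rintro _ ⟨r, θ, w, hr, hw, rfl⟩ _ ⟨r', θ', w', hr', hw', rfl⟩ h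
  rw [expMap_covector hp hpq hr, expMap_covector hp hpq hr'] at h
  obtain ⟨rfl, rfl, hc, hs⟩ : r = r' ∧ w = w' ∧ cosp q θ = cosp q θ' ∧ sinp q θ = sinp q θ' := by
    rcases le_total r r' with hle | hle
    · exact geodesic_end_unique hp hpq hr hr' hw' hle h
    · obtain ⟨h1, h2, h3, h4⟩ := geodesic_end_unique hp hpq hr' hr hw hle h.symm
      exact ⟨h1.symm, h2.symm, h3.symm, h4.symm⟩
  rw [covector, covector, hc, hs]

theorem mem_image_expMap_iff (hp : 1 < p) (hpq : 1 / p + 1 / q = 1) (g : Heis) :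
    g ∈ expMap p q 1 '' domainD q ↔ (g.1, g.2.1) ≠ (0, 0) := by
  have hq := one_lt_of_conj hp hpq
  constructor
  · rintro ⟨_, ⟨r, θ, w, hr, hw, rfl⟩, rfl⟩ h
    rw [expMap_covector hp hpq hr] at h
    obtain ⟨k, hk, rfl⟩ := exists_int_of_planar_zero hp hpq hr (congrArg Prod.fst h)
      (congrArg Prod.snd h)
    have hk1 : (1 : ℝ) ≤ |(k : ℝ)| := by exact_mod_cast Int.one_le_abs hk
    have hpip := pip_pos hq
    rw [abs_mul, abs_of_pos (by linarith : 0 < 2 * pip q)] at hw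
    nlinarith
  · intro h
    obtain ⟨r, θ, w, hr, hw, rfl⟩ := exists_geodesic hp hpq h
    exact ⟨_, ⟨r, θ, w, hr, hw, rfl⟩, expMap_covector hp hpq hr θ w 1⟩

/-- A gauge of the Heisenberg group bounds from above the `ℓ^q`-norm of the covectors with
`|w| ≤ 2 π_q`. -/
theorem exists_lpn_le_gauge_expMap (hp : 1 < p) (hpq : 1 / p + 1 / q = 1) : ∃ m : ℝ, 0 < m ∧
    ∀ l : Covector, |l.2.2| ≤ 2 * pip q → m * lpn q l.1 l.2.1 ≤
      |(expMap p q 1 l).1| + |(expMap p q 1 l).2.1| + √|(expMap p q 1 l).2.2| := by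
  have hq := one_lt_of_conj hp hpq
  have hpip := pip_pos hq
  set f : ℝ × ℝ → ℝ := fun a => |(geodesic p q 1 a.1 a.2 1).1| + |(geodesic p q 1 a.1 a.2 1).2.1| +
    √|(geodesic p q 1 a.1 a.2 1).2.2| with hf
  have hc : Continuous fun a : ℝ × ℝ => geodesic p q 1 a.1 a.2 1 :=
    (continuous_geodesic_param hp hpq).comp
      ((continuous_const.prodMk continuous_id).prodMk continuous_const)
  have hfc : Continuous f :=
    (hc.fst.abs.add hc.snd.fst.abs).add hc.snd.snd.abs.sqrt
  -- The constant is the minimum of the gauge over `r = 1` and the compact rectangle of `(θ, w)`. It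
  -- is positive because these geodesics do not return to the origin, and dilations extend the bound
  -- to all `r`.
  obtain ⟨a, ha, hmin⟩ := (isCompact_Icc (a := ((0 : ℝ), -(2 * pip q)))
    (b := (2 * pip q, 2 * pip q))).exists_isMinOn ⟨(0, 0), by
      constructor <;> constructor <;> simp <;> linarith⟩ hfc.continuousOn
  refine ⟨f a, ?_, fun l hl => ?_⟩
  · have h0 : geodesic p q 1 a.1 a.2 1 ≠ 0 :=
      geodesic_one_ne_zero hp hpq one_pos (abs_le.2 ⟨ha.1.2, ha.2.2⟩)
    by_contra! hle
    have b1 := abs_nonneg (geodesic p q 1 a.1 a.2 1).1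
    have b2 := abs_nonneg (geodesic p q 1 a.1 a.2 1).2.1
    have b3 := Real.sqrt_nonneg |(geodesic p q 1 a.1 a.2 1).2.2|
    simp only [hf] at hle
    refine h0 (Prod.ext (abs_eq_zero.1 (by linarith)) (Prod.ext (abs_eq_zero.1 (by linarith))
      (abs_eq_zero.1 ((Real.sqrt_eq_zero (abs_nonneg _)).1 (by linarith)))))
  · obtain ⟨θ, hθ, e⟩ := exists_angle hq l
    have hr := lpn_nonneg q l.1 l.2.1
    have hle : f a ≤ f (θ, l.2.2) :=
      hmin ⟨⟨hθ.1, (abs_le.1 hl).1⟩, ⟨hθ.2, (abs_le.1 hl).2⟩⟩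
    have e1 : expMap p q 1 l = geodesic p q (lpn q l.1 l.2.1 * 1) θ l.2.2 1 := by
      conv_lhs => rw [e]
      rw [expMap_covector_of_nonneg hp hpq hr, mul_one]
    rw [e1, geodesic_dilate]
    simp only [abs_mul, abs_of_nonneg hr, abs_pow]
    rw [Real.sqrt_mul (by positivity), Real.sqrt_sq hr, ← mul_add, ← mul_add, mul_comm]
    exact mul_le_mul_of_nonneg_left hle hr

/-- Continuity of the inverse is a properness argument. The gauge bounds the preimages of a
convergent sequence; a subsequential limit cannot have `r = 0` or `|w| = 2 π_q`, since such
covectors are sent to the vertical axis; injectivity identifies the limit. -/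
theorem exists_homeomorph_expMap (hp : 1 < p) (hpq : 1 / p + 1 / q = 1) :
    ∃ Ψ : domainD q ≃ₜ (expMap p q 1 '' domainD q), ∀ l : domainD q, (Ψ l : Heis) =
      expMap p q 1 l := by
  have hq := one_lt_of_conj hp hpq
  have hcont : Continuous (expMap p q 1) :=
    (continuous_expMap hp hpq).comp (continuous_const.prodMk continuous_id)
  let E := Equiv.Set.imageOfInjOn (expMap p q 1) (domainD q) (injOn_expMap hp hpq)
  have hE : ∀ l, (E l : Heis) = expMap p q 1 l := fun l => rfl
  have hE' : ∀ g, expMap p q 1 (E.symm g) = g := fun g => by rw [← hE, E.apply_symm_apply]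
  refine ⟨⟨E, (hcont.comp continuous_subtype_val).subtype_mk _, ?_⟩, hE⟩
  rw [continuous_iff_continuousAt]
  intro g
  refine tendsto_of_subseq_tendsto fun u hu => ?_
  obtain ⟨m, hm, hbound⟩ := exists_lpn_le_gauge_expMap hp hpq
  have huv : Tendsto (fun n => (u n : Heis)) atTop (𝓝 (g : Heis)) :=
    (continuous_subtype_val.tendsto g).comp hu
  have hN : Tendsto (fun n => |(u n : Heis).1| + |(u n : Heis).2.1| + √|(u n : Heis).2.2|) atTop
      (𝓝 (|(g : Heis).1| + |(g : Heis).2.1| + √|(g : Heis).2.2|)) := by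
    have hc : Continuous fun g : Heis => |g.1| + |g.2.1| + √|g.2.2| := by fun_prop
    exact (hc.tendsto _).comp huv
  obtain ⟨R, hR⟩ := hN.bddAbove_range
  have hmem : ∀ n, (E.symm (u n) : Covector) ∈
      Icc ((-(R / m), -(R / m), -(2 * pip q)) : Covector) (R / m, R / m, 2 * pip q) := by
    intro n
    have hD := (mem_domainD_iff hq _).1 (E.symm (u n)).2
    have h1 := hbound _ hD.2.le
    rw [hE'] at h1
    have h2 : lpn q (E.symm (u n) : Covector).1 (E.symm (u n) : Covector).2.1 ≤ R / m := by
      rw [le_div_iff₀ hm, mul_comm]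
      exact h1.trans (hR ⟨n, rfl⟩)
    have b1 := abs_le.1 ((abs_fst_le_lpn hq _ _).trans h2)
    have b2 := abs_le.1 ((abs_snd_le_lpn hq _ _).trans h2)
    have b3 := abs_lt.1 hD.2
    exact ⟨⟨b1.1, b2.1, b3.1.le⟩, ⟨b1.2, b2.2, b3.2.le⟩⟩
  obtain ⟨l, hl, φ, hφ, hlim⟩ := isCompact_Icc.tendsto_subseq hmem
  have he : expMap p q 1 l = g := by
    refine tendsto_nhds_unique ((hcont.tendsto l).comp hlim) ?_
    refine (huv.comp hφ.tendsto_atTop).congr fun n => (hE' _).symm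
  have hg := (mem_image_expMap_iff hp hpq _).1 g.2
  have hlD : l ∈ domainD q := by
    obtain ⟨θ, -, e⟩ := exists_angle hq l
    have e1 : geodesic p q (lpn q l.1 l.2.1) θ l.2.2 1 = g := by
      rw [← he]
      conv_rhs => rw [e]
      exact (expMap_covector_of_nonneg hp hpq (lpn_nonneg _ _ _) _ _ _).symm
    rw [mem_domainD_iff hq]
    constructor
    · refine (lpn_nonneg _ _ _).lt_of_ne fun h0 => hg ?_
      rw [← e1, ← h0, geodesic_zero_left]; rfl
    · refine (abs_le.2 ⟨hl.1.2.2, hl.2.2.2⟩).lt_of_ne fun h0 => hg ?_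
      obtain ⟨k, hk0, hk⟩ : ∃ k : ℤ, k ≠ 0 ∧ l.2.2 = k * (2 * pip q) := by
        rcases abs_choice l.2.2 with h | h
        · exact ⟨1, one_ne_zero, by rw [← h0, h]; simp⟩
        · exact ⟨-1, by norm_num, by rw [← h0, h]; simp⟩
      rw [← e1, geodesic_loop hq p _ θ _ k hk0 hk]
  refine ⟨φ, tendsto_subtype_rng.2 ?_⟩
  have hfin : l = E.symm g := injOn_expMap hp hpq hlD (E.symm g).2 (he.trans (hE' g).symm)
  rw [hfin] at hlim
  exact hlim

theorem compl_image_expMap (hp : 1 < p) (hpq : 1 / p + 1 / q = 1) :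
    (expMap p q 1 '' domainD q)ᶜ = {g : Heis | g.1 = 0 ∧ g.2.1 = 0} := by
  ext g
  rw [mem_compl_iff, mem_image_expMap_iff hp hpq, not_not, Prod.mk.injEq, mem_ofPred_eq]

theorem volume_vertical_line (a b : ℝ) : volume {g : Heis | g.1 = a ∧ g.2.1 = b} = 0 := by
  refine measure_mono_null (t := {a} ×ˢ univ) (fun g hg => ⟨hg.1, trivial⟩) ?_
  rw [Measure.volume_eq_prod, Measure.prod_prod, Real.volume_singleton, zero_mul]

/-! ### Lipschitz curves are horizontal -/

theorem lpn_sub_le_of_heisDist_le (hp : 1 < p) (hpq : 1 / p + 1 / q = 1) {a b : Heis} {c : ℝ}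
    (hc : 0 ≤ c) (h : heisDist p a b ≤ ENNReal.ofReal c) :
    lpn p (b.1 - a.1) (b.2.1 - a.2.1) ≤ c :=
  (ENNReal.ofReal_le_ofReal_iff hc).1 ((lpn_le_heisDist hp hpq a b).trans h)

theorem abs_vertical_le_of_heisDist_le (hp : 1 < p) {a b : Heis} {c : ℝ}
    (hc : 0 ≤ c) (h : heisDist p a b ≤ ENNReal.ofReal c) :
    |b.2.2 - a.2.2 - (a.1 * (b.2.1 - a.2.1) - a.2.1 * (b.1 - a.1)) / 2| ≤ c ^ 2 := by
  have h1 := sqrt_abs_le_heisDist hp (mulH (-a) b)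
  rw [← neg_mulH_self a, heisDist_mulH hp] at h1
  have h2 := (ENNReal.ofReal_le_ofReal_iff hc).1 (h1.trans h)
  rw [Real.sqrt_le_left hc] at h2
  refine le_of_eq_of_le (congrArg _ ?_) h2
  simp only [mulH, Prod.fst_neg, Prod.snd_neg]
  ring

theorem lpn_deriv_le {γ : ℝ → Heis} {r x' y' t : ℝ} (hp : 1 < p)
    (hL : ∀ s t, lpn p ((γ t).1 - (γ s).1) ((γ t).2.1 - (γ s).2.1) ≤ r * |s - t|)
    (hx : HasDerivAt (fun t => (γ t).1) x' t) (hy : HasDerivAt (fun t => (γ t).2.1) y' t) :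
    lpn p x' y' ≤ r := by
  have h := ((continuous_lpn hp).tendsto (x', y')).comp
    ((hasDerivAt_iff_tendsto_slope.1 hx).prodMk_nhds (hasDerivAt_iff_tendsto_slope.1 hy))
  refine le_of_tendsto h ?_
  filter_upwards [self_mem_nhdsWithin] with s hs
  have hpos : 0 < |s - t| := abs_pos.2 (sub_ne_zero.2 hs)
  change lpn p ((s - t)⁻¹ * ((γ s).1 - (γ t).1)) ((s - t)⁻¹ * ((γ s).2.1 - (γ t).2.1)) ≤ r
  rw [lpn_smul hp, abs_inv, inv_mul_le_iff₀ hpos, mul_comm, ← abs_sub_comm t s]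
  exact hL t s

/-- After left translation to the base point the height is `O(|s - t|²)` and has zero derivative;
undoing the translation yields the horizontality equation. -/
theorem hasDerivAt_vertical {γ : ℝ → Heis} {r x' y' t : ℝ}
    (hZ : ∀ s, |(γ s).2.2 - (γ t).2.2 - ((γ t).1 * ((γ s).2.1 - (γ t).2.1) -
      (γ t).2.1 * ((γ s).1 - (γ t).1)) / 2| ≤ (r * |t - s|) ^ 2)
    (hx : HasDerivAt (fun t => (γ t).1) x' t) (hy : HasDerivAt (fun t => (γ t).2.1) y' t) :
    HasDerivAt (fun t => (γ t).2.2) (((γ t).1 * y' - (γ t).2.1 * x') / 2) t := by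
  have h1 : HasDerivAt (fun s => (γ s).2.2 - (γ t).2.2 - ((γ t).1 * ((γ s).2.1 - (γ t).2.1) -
      (γ t).2.1 * ((γ s).1 - (γ t).1)) / 2) 0 t := by
    refine (hasDerivAt_iff_hasFDerivAt.2 ?_ : HasDerivAt _ (0 : ℝ) t)
    rw [ContinuousLinearMap.toSpanSingleton_zero]
    refine Asymptotics.IsBigO.hasFDerivAt (n := 2) (.of_bound (r ^ 2) ?_) one_lt_two
    refine Eventually.of_forall fun s => ?_
    rw [Real.norm_eq_abs, norm_pow, norm_norm, Real.norm_eq_abs, ← mul_pow, abs_sub_comm s t]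
    exact hZ s
  have h2 := ((h1.add ((((hy.sub_const (γ t).2.1).const_mul (γ t).1).sub
    ((hx.sub_const (γ t).1).const_mul (γ t).2.1)).div_const 2)).add_const (γ t).2.2)
  refine (h2.congr_deriv (by ring)).congr_of_eventuallyEq (Eventually.of_forall fun s => ?_)
  simp

/-- Metric geodesics are not assumed horizontal; this supplies it, together with the speed bound
needed for the length comparison. The height is only Lipschitz on bounded intervals, where `x` and
`y` are bounded. -/
theorem horCoord_of_lipschitz (hp : 1 < p) (hpq : 1 / p + 1 / q = 1) {γ : ℝ → Heis} {r : ℝ}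
    (hr : 0 ≤ r) (hL : ∀ s t, heisDist p (γ s) (γ t) ≤ ENNReal.ofReal (r * |s - t|)) (a b : ℝ) :
    HorCoord γ (deriv fun t => (γ t).1) (deriv fun t => (γ t).2.1) a b ∧
      ∀ᵐ t, lpn p (deriv (fun t => (γ t).1) t) (deriv (fun t => (γ t).2.1) t) ≤ r := by
  have hrt : ∀ s t : ℝ, 0 ≤ r * |s - t| := fun s t => mul_nonneg hr (abs_nonneg _)
  have hl := fun s t => lpn_sub_le_of_heisDist_le hp hpq (hrt s t) (hL s t)
  have hZ := fun s t => abs_vertical_le_of_heisDist_le hp (hrt s t) (hL s t)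
  have hx : LipschitzWith r.toNNReal fun t => (γ t).1 := LipschitzWith.of_dist_le_mul fun s t => by
    rw [Real.dist_eq, Real.dist_eq, Real.coe_toNNReal _ hr, abs_sub_comm]
    exact (abs_fst_le_lpn hp _ _).trans (hl s t)
  have hy : LipschitzWith r.toNNReal fun t => (γ t).2.1 :=
    LipschitzWith.of_dist_le_mul fun s t => by
      rw [Real.dist_eq, Real.dist_eq, Real.coe_toNNReal _ hr, abs_sub_comm]
      exact (abs_snd_le_lpn hp _ _).trans (hl s t)
  obtain ⟨A, hA⟩ := (isCompact_uIcc (a := a) (b := b)).exists_bound_of_continuousOn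
    hx.continuous.continuousOn
  obtain ⟨B, hB⟩ := (isCompact_uIcc (a := a) (b := b)).exists_bound_of_continuousOn
    hy.continuous.continuousOn
  have hz : LipschitzOnWith (A * r + B * r + r ^ 2 * |a - b|).toNNReal (fun t => (γ t).2.2)
      (uIcc a b) := LipschitzOnWith.of_dist_le_mul fun t ht s hs => by
    have hA0 : 0 ≤ A := (norm_nonneg _).trans (hA s hs)
    have hB0 : 0 ≤ B := (norm_nonneg _).trans (hB s hs)
    rw [Real.dist_eq, Real.dist_eq, Real.coe_toNNReal _ (by positivity)]
    have e := hZ s t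
    have e1 := (abs_fst_le_lpn hp _ _).trans (hl s t)
    have e2 := (abs_snd_le_lpn hp _ _).trans (hl s t)
    have hst : |s - t| ≤ |a - b| := by
      rw [abs_sub_comm s t, abs_sub_comm a b]
      exact abs_sub_le_of_uIcc_subset_uIcc (uIcc_subset_uIcc hs ht)
    have e3 : |(γ s).1 * ((γ t).2.1 - (γ s).2.1)| ≤ A * (r * |s - t|) := by
      rw [abs_mul]; exact mul_le_mul (hA s hs) e2 (abs_nonneg _) hA0
    have e4 : |(γ s).2.1 * ((γ t).1 - (γ s).1)| ≤ B * (r * |s - t|) := by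
      rw [abs_mul]; exact mul_le_mul (hB s hs) e1 (abs_nonneg _) hB0
    have e5 : (r * |s - t|) ^ 2 ≤ r ^ 2 * |a - b| * |s - t| := by
      have := mul_le_mul_of_nonneg_left hst (mul_nonneg (sq_nonneg r) (abs_nonneg (s - t)))
      nlinarith
    have f3 := mul_nonneg hA0 (hrt s t)
    have f4 := mul_nonneg hB0 (hrt s t)
    rw [abs_sub_comm t s]
    rw [abs_le] at e e3 e4 ⊢
    constructor <;> linarith
  have hdx := hx.ae_differentiableAt_real
  have hdy := hy.ae_differentiableAt_real
  refine ⟨⟨⟨hx.lipschitzOnWith.absolutelyContinuousOnInterval, ?_⟩,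
    ⟨hy.lipschitzOnWith.absolutelyContinuousOnInterval, ?_⟩,
    ⟨hz.absolutelyContinuousOnInterval, ?_⟩⟩, ?_⟩
  · filter_upwards [hdx] with t h _ using h.hasDerivAt
  · filter_upwards [hdy] with t h _ using h.hasDerivAt
  · filter_upwards [hdx, hdy] with t h1 h2 _
    exact hasDerivAt_vertical (r := r) (fun s => hZ t s) h1.hasDerivAt h2.hasDerivAt
  · filter_upwards [hdx, hdy] with t h1 h2
    exact lpn_deriv_le hp hl h1.hasDerivAt h2.hasDerivAt

/-! ### Uniqueness of minimising geodesics and negligible cut locus -/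

/-- Extended by constants outside `[0, 1]`, the curve is Lipschitz for `d` and horizontal of length
at most `r`, hence a reparametrised geodesic. Comparing distances from the origin shows that the
parameter is unchanged. -/
theorem eq_geodesic_of_heisDist (hp : 1 < p) (hpq : 1 / p + 1 / q = 1) {γ : unitInterval → Heis}
    {r θ w : ℝ} (hr : 0 < r) (hw : |w| < 2 * pip q) (h0 : γ 0 = 0)
    (h1 : γ 1 = geodesic p q r θ w 1)
    (hd : ∀ s t : unitInterval,
      heisDist p (γ s) (γ t) = ENNReal.ofReal (|(s : ℝ) - (t : ℝ)| * r)) (t : unitInterval) :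
    γ t = geodesic p q r θ w t := by
  obtain ⟨e, he⟩ : ∃ e : ℝ → Heis, e = fun t => γ (projIcc 0 1 zero_le_one t) := ⟨_, rfl⟩
  have hL : ∀ s t, heisDist p (e s) (e t) ≤ ENNReal.ofReal (r * |s - t|) := fun s t => by
    rw [he, hd, mul_comm]
    exact ENNReal.ofReal_le_ofReal (mul_le_mul_of_nonneg_left
      (abs_projIcc_sub_projIcc zero_le_one) hr.le)
  obtain ⟨hc, hle⟩ := horCoord_of_lipschitz hp hpq hr.le hL 0 1
  have hint : ∫ t in (0 : ℝ)..1, lpn p (deriv (fun t => (e t).1) t)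
      (deriv (fun t => (e t).2.1) t) ≤ r := by
    have := intervalIntegral.integral_mono_ae zero_le_one
      (ACD.intervalIntegrable_lpn hp zero_le_one hc.1 hc.2.1)
      (intervalIntegrable_const (c := r)) hle
    simpa using this
  have e0 : e 0 = 0 := by rw [he]; simpa using h0
  have e1 : e 1 = geodesic p q r θ w 1 := by rw [he]; simpa using h1
  obtain ⟨hI, hm⟩ := geodesic_minimal hp hpq hr hw.le hc e0 e1 hint
  have het : e t = γ t := by rw [he]; simp
  have hmt := hm hw t t.2
  have hτ := (hc.lengthParam_mem hp hr hI).2 t t.2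
  set τ := (∫ s in (0 : ℝ)..t, lpn p (deriv (fun t => (e t).1) s)
      (deriv (fun t => (e t).2.1) s)) / r with hτd
  have hg := heisDist_geodesic hp hpq (θ := θ) (w := w) (s := 0) (t := τ) hr (by
    rw [zero_sub, abs_neg, abs_of_nonneg hτ.1]
    nlinarith [abs_nonneg w, hτ.2])
  have hdt := hd 0 t
  rw [h0, ← het, hmt] at hdt
  rw [geodesic_zero, hdt, Icc.coe_zero, zero_sub, zero_sub, abs_neg, abs_neg,
    abs_of_nonneg t.2.1, abs_of_nonneg hτ.1,
    ENNReal.ofReal_eq_ofReal_iff (mul_nonneg t.2.1 hr.le) (mul_nonneg hτ.1 hr.le)] at hg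
  rw [← het, hmt, ← mul_right_cancel₀ hr.ne' hg]

/-- The exceptional set is the vertical line through `x`. Off it, `Φ` is the left translate of the
exponential map applied to its inverse, so it is continuous and therefore measurable. -/
theorem hasNegligibleCutLocus_heisDist (hp : 1 < p) (hpq : 1 / p + 1 / q = 1) :
    HasNegligibleCutLocus (heisDist p) (volume : Measure Heis) := by
  intro x
  obtain ⟨Ψ, hΨ⟩ := exists_homeomorph_expMap hp hpq
  refine ⟨{g | g.1 = x.1 ∧ g.2.1 = x.2.1}, volume_vertical_line _ _, ?_⟩
  have hmem : ∀ y : ({g : Heis | g.1 = x.1 ∧ g.2.1 = x.2.1}ᶜ : Set Heis),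
      mulH (-x) y ∈ expMap p q 1 '' domainD q := by
    intro y
    rw [mem_image_expMap_iff hp hpq]
    intro h
    have h1 : -x.1 + (y : Heis).1 = 0 := congrArg Prod.fst h
    have h2 : -x.2.1 + (y : Heis).2.1 = 0 := congrArg Prod.snd h
    exact y.2 ⟨by linarith, by linarith⟩
  have hΨ' : ∀ g, expMap p q 1 (Ψ.symm g) = g := fun g => by rw [← hΨ, Ψ.apply_symm_apply]
  have hc1 : Continuous fun y : ({g : Heis | g.1 = x.1 ∧ g.2.1 = x.2.1}ᶜ : Set Heis) =>
      Ψ.symm ⟨mulH (-x) y, hmem y⟩ :=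
    Ψ.symm.continuous.comp ((continuous_mulH.comp
      (continuous_const.prodMk continuous_subtype_val)).subtype_mk _)
  refine ⟨fun a => mulH x (expMap p q a.2 (Ψ.symm ⟨mulH (-x) a.1, hmem a.1⟩)), ?_, fun y => ?_⟩
  · refine Continuous.measurable ?_
    exact continuous_mulH.comp (continuous_const.prodMk ((continuous_expMap hp hpq).comp
      ((continuous_subtype_val.comp continuous_snd).prodMk
        (continuous_subtype_val.comp (hc1.comp continuous_fst)))))
  · have hy := hΨ' ⟨mulH (-x) y, hmem y⟩
    obtain ⟨r, θ, w, hr, hw, hl⟩ := (Ψ.symm ⟨mulH (-x) y, hmem y⟩).2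
    simp only [hl, expMap_covector hp hpq hr] at hy ⊢
    have hxy : heisDist p x y = ENNReal.ofReal r := by
      rw [← heisDist_mulH hp (-x), neg_mulH_self, ← hy, heisDist_geodesic_one hp hpq hr hw.le]
    refine ⟨⟨?_, ?_, fun s t => ?_⟩, fun γ hγ => ?_⟩
    · beta_reduce
      rw [Icc.coe_zero, geodesic_zero, mulH_zero]
    · beta_reduce
      rw [Icc.coe_one, hy, mulH_cancel_neg_left]
    · have hst : |(s : ℝ) - t| ≤ 1 :=
        abs_le.2 ⟨by linarith [s.2.1, t.2.2], by linarith [s.2.2, t.2.1]⟩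
      rw [heisDist_mulH hp, hxy, heisDist_geodesic hp hpq hr
        (by nlinarith [abs_nonneg w]), ENNReal.ofReal_mul (abs_nonneg _)]
    · obtain ⟨hγ0, hγ1, hγd⟩ := hγ
      funext t
      have := eq_geodesic_of_heisDist hp hpq (γ := fun t => mulH (-x) (γ t)) (θ := θ) hr hw
        (by rw [hγ0, neg_mulH_self]) (by rw [hγ1, hy]) (fun s t => by
          rw [heisDist_mulH hp, hγd, hxy, ENNReal.ofReal_mul (abs_nonneg _)]) t
      rw [← this, mulH_cancel_neg_left]

end LpHeisenberg

end

theorem mainTheorem6 (p q : ℝ) (hp : 1 < p) (hpq : 1 / p + 1 / q = 1) :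
    (∀ r θ w : ℝ, 0 < r →
      cutTime p q (covector q r θ w) = ENNReal.ofReal (2 * pip q) / ENNReal.ofReal |w|) ∧
    cotangentInjectivityDomain p q = domainD q ∧
    (∃ Ψ : domainD q ≃ₜ (expMap p q 1 '' domainD q),
      ∀ l : domainD q, (Ψ l : Heis) = expMap p q 1 l) ∧
    (expMap p q 1 '' domainD q)ᶜ = {g : Heis | g.1 = 0 ∧ g.2.1 = 0} ∧
    MeasureTheory.volume {g : Heis | g.1 = 0 ∧ g.2.1 = 0} = 0 ∧
    HasNegligibleCutLocus (heisDist p) (MeasureTheory.volume : MeasureTheory.Measure Heis) :=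
  have hline := volume_vertical_line 0 0
  ⟨fun _ _ _ hr => cutTime_covector hp hpq hr, cotangentInjectivityDomain_eq hp hpq,
    exists_homeomorph_expMap hp hpq, compl_image_expMap hp hpq, hline,
    hasNegligibleCutLocus_heisDist hp hpq⟩
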